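/- All manifolds are finite-dimensional, smooth, without boundary, Hausdorff and $\sigma$-compact. Let $p:M\to B$ be a complete fibration, i.e. a smooth submersion that admits a complete Ehresmann connection (horizontal lifts of complete vector fields are complete). Put $\mathrm{Ver}=\ker dp$ and let $\omega_V$ be a vertical $2$-form with $d_V\omega_V=0$, with class $[\omega_V]_1\in H^2(\mathrm{Ver})$, the cohomology of the complex of vertical differential forms. Let $A_V=\mathrm{Ver}\times\mathbb R$ with anchor $(Y,f)\mapsto Y$ and bracket $[(Y,f),(Z,g)]=([Y,Z],L_Yg-L_Zf+\omega_V(Y,Z))$, and for a closed $2$-form $\omega$ on $M$ let $A_\omega=TM\times\mathbb R$ with anchor $(X,f)\mapsto X$ and bracket $[(X,f),(Y,g)]=([X,Y],L_Xg-L_Yf+\omega(X,Y))$. A *symmetry* of $A_V$ with symbol $X\in\mathfrak X(M)$ is an additive $D:\Gamma(A_V)\to\Gamma(A_V)$ with $D(fa)=fD(a)+(L_Xf)a$, $D[a,b]=[Da,b]+[a,Db]$ and $D(0,1)=0$. An *extension* $A_V\hookrightarrow A\to TB$ is a Lie algebroid $A$ over $M$ of finite rank with a smooth injective bundle map $i:A_V\to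 A$ over $\mathrm{id}_M$ that is compatible with anchors and brackets, such that $dp\circ\sharp$ is fibrewise surjective with kernel $i(A_V)$ and $i(0,1)$ is central in $\Gamma(A)$. Equivalences of extensions are isomorphisms over $\mathrm{id}_M$ that restrict to the identity of $A_V$. Then closed $2$-forms on $M$ whose class restricts to $[\omega_V]_1$ are the same as extensions $A_V\hookrightarrow A\to TB$, in the following sense. 1. (Forms to extensions.) For a closed $2$-form $\omega$ on $M$, $[\omega]$ restricts to $[\omega_V]_1$ if and only if $A_\omega$ carries the structure $i$ of an extension of $TB$ by $A_V$ with $i(0,1)=(0,1)$. Such $i$ are exactly the maps $i(v,t)=(v,t+\gamma(v))$, where $\gamma$ is a vertical $1$-form with $\omega_V=\omega|_{\mathrm{Ver}}+d_V\gamma$. 2. (Extensions to forms.) Let $A_V\hookrightarrow A\to TB$ be an extension, with inclusion $i$. The anchor has a smooth splitting, and for each smooth splitting $\sigma:TM\to A$ there is a unique closed $2$-form $\omega$ such that $[\omega]$ restricts to $[\omega_V]_1$, $[\sigma X,\sigma Y]-\sigma[X,Y]=i(0,\omega(X,Y))$ for all $X,Y$, and $A$ is equivalent to $A_\omega$, with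 one of the inclusions of part 1, by an equivalence $\Phi:A_\omega\to A$ with $\Phi(v,0)=\sigma(v)$. 3. (Equivalences.) The extensions given by $(\omega,\gamma)$ and $(\omega',\gamma')$ as in part 1 are equivalent if and only if there is a $1$-form $\beta$ on $M$ with $\omega=\omega'+d\beta$ and $\gamma'=\gamma+\beta|_{\mathrm{Ver}}$. Closed $2$-forms $\omega,\omega'$ have the same class in $H^2(M)$ if and only if there is a Lie algebroid isomorphism $A_\omega\to A_{\omega'}$ over $\mathrm{id}_M$ mapping $(0,1)$ to $(0,1)$. 4. (Closedness equations.) Let $h$ be an Ehresmann connection with curvature $C(u,v)=[h(u),h(v)]-h([u,v])$. For a $2$-form $\omega$ on $M$ put $\alpha_H(u)(Y)=\omega(h(u),Y)$ and $\omega_H(u,v)=\omega(h(u),h(v))$, for $u,v\in\mathfrak X(B)$ and $Y$ vertical, and let $d_V,d_H,d_C$ be the components of the de Rham differential of bidegree $(0,1),(1,0),(2,-1)$. Then $\omega$ is closed if and only if (i) $d_V\,\omega|_{\mathrm{Ver}}=0$, (ii) $d_H\,\omega|_{\mathrm{Ver}}+d_V\alpha_H=0$, (iii) $d_C\,\omega|_{\mathrm{Ver}}+d_H\alpha_H+d_V\omega_H=0$,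 (iv) $d_C\alpha_H+d_H\omega_H=0$. Let $\omega|_{\mathrm{Ver}}=\omega_V$ and put $D_u(Y,g)=([h(u),Y],L_{h(u)}g+\alpha_H(u)(Y))$ and $w(u,v)=(C(u,v),\omega_H(u,v))$. Then (ii) holds if and only if every $D_u$ is a symmetry of $A_V$ with symbol $h(u)$; (iii) holds if and only if $[D_u,D_v]-D_{[u,v]}=\mathrm{ad}_{w(u,v)}$ for all $u,v$; and (iv) holds if and only if $\oint_{u,v,t}\bigl(D_uw(v,t)-w([u,v],t)\bigr)=0$ for all $u,v,t$. 5. (Couples.) Consider couples $(D,w)$ where $D$ is a $C^\infty(B)$-linear map from $\mathfrak X(B)$ to symmetries of $A_V$ such that the symbol of $D_u$ projects to $u$, and $w\in\Omega^2(B,\Gamma(A_V))$, subject to the structure equations $[D_u,D_v]-D_{[u,v]}=\mathrm{ad}_{w(u,v)}$ and $\oint_{u,v,t}\bigl(D_uw(v,t)-w([u,v],t)\bigr)=0$. The formulas $D_u=(h(u),\alpha_H(u))$, $w=(C,\omega_H)$ of part 4 are a bijection from the pairs $(h,\omega)$ of an Ehresmann connection and a closed $2$-form with $\omega|_{\mathrm{Ver}}=\omega_V$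 to these couples; the couple of $(h,\omega)$ is the one induced, in the sense below, by $A_\omega$ with the inclusion $i(v,t)=(v,t)$ and the splitting $k=(h,0)$. For every extension $A$, the map $dp\circ\sharp$ has smooth splittings $k:p^*TB\to A$; each of them induces a unique couple by $i(D_us)=[k(u),i(s)]$, $i(w(u,v))=[k(u),k(v)]-k([u,v])$, with symbol $\sharp k(u)$ for $D_u$; this couple satisfies the structure equations; and if $(h,\omega)$ is the pair of this couple, then there is an equivalence of extensions $\Phi:A_\omega\to A$, where $A_\omega$ has the inclusion $(v,t)\mapsto(v,t)$, with $\Phi(h(v),0)=k(v)$. -/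

import Mathlib

set_option linter.unusedSectionVars false

open Bundle Set Filter
open scoped Manifold ContDiff Topology

namespace ClosedExtension

noncomputable section

variable {E : Type*} [NormedAddCommGroup E] [NormedSpace ℝ E] [FiniteDimensional ℝ E]
  {H : Type*} [TopologicalSpace H] {I : ModelWithCorners ℝ E H} [I.Boundaryless]
  {M : Type*} [TopologicalSpace M] [ChartedSpace H M] [IsManifold I ∞ M]
variable {E' : Type*} [NormedAddCommGroup E'] [NormedSpace ℝ E'] [FiniteDimensional ℝ E']
  {H' : Type*} [TopologicalSpace H'] {I' : ModelWithCorners ℝ E' H'} [I'.Boundaryless]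
  {B : Type*} [TopologicalSpace B] [ChartedSpace H' B] [IsManifold I' ∞ B]

/-! ### Vector fields and functions -/

/-- Smooth vector fields on `M`. -/
abbrev VField {E : Type*} [NormedAddCommGroup E] [NormedSpace ℝ E]
    {H : Type*} [TopologicalSpace H] (I : ModelWithCorners ℝ E H)
    (M : Type*) [TopologicalSpace M] [ChartedSpace H M] [IsManifold I ∞ M] :=
  Cₛ^∞⟮I; E, (TangentSpace I : M → Type _)⟯

/-- Smooth real functions on `M`. -/
abbrev SFun {E : Type*} [NormedAddCommGroup E] [NormedSpace ℝ E]
    {H : Type*} [TopologicalSpace H] (I : ModelWithCorners ℝ E H)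
    (M : Type*) [TopologicalSpace M] [ChartedSpace H M] :=
  C^∞⟮I, M; 𝓘(ℝ, ℝ), ℝ⟯

theorem mvfderiv_mlieBracket_aux (f : M → ℝ) (x : M) (hf : ContMDiffAt I 𝓘(ℝ, ℝ) ∞ f x)
    (X Y : VField I M) :
    MDifferentiableAt I 𝓘(ℝ, ℝ) (fun y => mvfderiv I f y (X y)) x ∧
    mvfderiv I f x (VectorField.mlieBracket I X Y x) =
      mvfderiv I (fun y => mvfderiv I f y (Y y)) x (X x)
      - mvfderiv I (fun y => mvfderiv I f y (X y)) x (Y x) := by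
  have : CompleteSpace E := FiniteDimensional.complete ℝ E
  have : IsManifold I (minSmoothness ℝ 2) M :=
    IsManifold.of_le (n := ∞) (by simpa using (WithTop.coe_le_coe.2 le_top : (2 : ℕ∞ω) ≤ ∞))
  set φ := extChartAt I x with hφ
  have hI : range I = univ := I.range_eq_univ
  have hsrc : φ.target ∈ 𝓝 (φ x) := extChartAt_target_mem_nhds x
  have hxx : φ.symm (φ x) = x := by simp [hφ]
  set g : E → ℝ := f ∘ φ.symm with hg
  have hφs : ∀ y ∈ φ.target, ContMDiffAt 𝓘(ℝ, E) I ∞ φ.symm y := by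
    intro y hy
    have := contMDiffWithinAt_extChartAt_symm_range (I := I) (n := ∞) x hy
    rwa [hI, contMDiffWithinAt_univ] at this
  have hinv : ∀ y ∈ φ.target, (mfderiv 𝓘(ℝ, E) I φ.symm y).IsInvertible := by
    intro y hy
    have := isInvertible_mfderivWithin_extChartAt_symm (I := I) (x := x) hy
    rwa [hI, mfderivWithin_univ] at this
  have hx0 : φ x ∈ φ.target := mem_extChartAt_target x
  have hgc : ContDiffAt ℝ ∞ g (φ x) := by
    rw [← contMDiffAt_iff_contDiffAt]
    exact ContMDiffAt.comp_of_eq hf (hφs _ hx0) hxx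
  have hfd : ∀ᶠ y in 𝓝 x, MDifferentiableAt I 𝓘(ℝ, ℝ) f y := by
    have h1 := (contMDiffAt_iff_contMDiffAt_nhds (n := 1) (by simp)).1 (hf.of_le (by simp))
    filter_upwards [h1] with y hy using hy.mdifferentiableAt (by simp)
  have hcont : Tendsto φ.symm (𝓝 (φ x)) (𝓝 x) := by
    have := (hφs _ hx0).continuousAt
    rwa [ContinuousAt, hxx] at this
  -- vector fields in the chart
  let U : VField I M → E → E := fun Z y =>
    VectorField.mpullback 𝓘(ℝ, E) I φ.symm Z y
  have hpull : ∀ (Z : VField I M), ∀ y ∈ φ.target,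
      mfderiv 𝓘(ℝ, E) I φ.symm y (U Z y) = Z (φ.symm y) := by
    intro Z y hy
    obtain ⟨A, hA⟩ := hinv y hy
    change mfderiv 𝓘(ℝ, E) I φ.symm y (VectorField.mpullback 𝓘(ℝ, E) I φ.symm Z y) = _
    rw [VectorField.mpullback_apply, ← hA]
    simp
  have h2le : (2 : ℕ∞ω) ≤ ∞ := WithTop.coe_le_coe.2 le_top
  have hdiff : ∀ (Z : VField I M),
      DifferentiableAt ℝ (U Z) (φ x) := by
    intro Z
    have h1 : MDifferentiableAt 𝓘(ℝ, E) (𝓘(ℝ, E).prod 𝓘(ℝ, E)) (fun y => (TotalSpace.mk' E y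
        (VectorField.mpullback 𝓘(ℝ, E) I φ.symm Z y) : TangentBundle 𝓘(ℝ, E) E)) (φ x) :=
      MDifferentiableAt.mpullback_vectorField (n := ∞) Z.mdifferentiableAt (hφs _ hx0)
        (hinv _ hx0) h2le
    have h2 := (contMDiff_snd_tangentBundle_modelSpace E 𝓘(ℝ, E)
      (n := 1)).contMDiffAt.mdifferentiableAt
      (x := TotalSpace.mk' E (φ x) (VectorField.mpullback 𝓘(ℝ, E) I φ.symm Z (φ x)))
      one_ne_zero |>.comp (φ x) h1
    exact mdifferentiableAt_iff_differentiableAt.1 h2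
  have hchain : ∀ (k : M → ℝ) (y : E), y ∈ φ.target → MDifferentiableAt I 𝓘(ℝ, ℝ) k (φ.symm y) →
      ∀ v : E, fderiv ℝ (k ∘ φ.symm) y v =
        mvfderiv I k (φ.symm y) (mfderiv 𝓘(ℝ, E) I φ.symm y v) := by
    intro k y hy hk v
    have := mvfderiv_comp_apply (I := I) (I' := 𝓘(ℝ, E)) y hk
      ((hφs y hy).mdifferentiableAt (by simp)) v
    rw [← this]
    simp [mvfderiv]
    rfl
  have hdir : ∀ (Z : VField I M),
      (fun y => fderiv ℝ g y (U Z y)) =ᶠ[𝓝 (φ x)]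
      (fun y => mvfderiv I f y (Z y)) ∘ φ.symm := by
    intro Z
    filter_upwards [hsrc, hcont.eventually hfd] with y hy hy2
    rw [hg, hchain f y hy hy2, hpull Z y hy]
    rfl
  have hgd : DifferentiableAt ℝ (fderiv ℝ g) (φ x) :=
    (hgc.fderiv_right (m := 1) h2le).differentiableAt (by simp)
  have hφx : MDifferentiableAt I 𝓘(ℝ, E) φ x :=
    (contMDiffAt_extChartAt (n := 1)).mdifferentiableAt one_ne_zero
  have hsm : ∀ (Z : VField I M),
      MDifferentiableAt I 𝓘(ℝ, ℝ) (fun y => mvfderiv I f y (Z y)) x := by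
    intro Z
    have h1 : DifferentiableAt ℝ (fun y => fderiv ℝ g y (U Z y)) (φ x) :=
      hgd.clm_apply (hdiff Z)
    have h2 := (h1.mdifferentiableAt).comp x hφx
    refine h2.congr_of_eventuallyEq ?_
    have h3 := ((continuousAt_extChartAt (I := I) x).eventually (hdir Z))
    filter_upwards [h3, extChartAt_source_mem_nhds (I := I) x] with y hy hy2
    simp only [Function.comp] at hy ⊢
    rw [hy, φ.left_inv hy2]
  have hbr : VectorField.mlieBracket I X Y (φ.symm (φ x)) = mfderiv 𝓘(ℝ, E) I φ.symm (φ x)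
      (VectorField.lieBracket ℝ (U X) (U Y) (φ x) : E) := by
    have h0 := VectorField.mpullback_mlieBracket (I := 𝓘(ℝ, E)) (I' := I) (f := φ.symm)
      (V := X) (W := Y) (x₀ := φ x) (n := ∞) X.mdifferentiableAt Y.mdifferentiableAt (hφs _ hx0)
      (by simpa using h2le)
    have h1 : VectorField.lieBracket ℝ (U X) (U Y) (φ x) =
      VectorField.mpullback 𝓘(ℝ, E) I φ.symm (VectorField.mlieBracket I X Y) (φ x) := by
      rw [h0, ← VectorField.mlieBracketWithin_univ,
        VectorField.mlieBracketWithin_eq_lieBracketWithin]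
      exact (congrFun (VectorField.lieBracketWithin_univ (𝕜 := ℝ) (V := U X) (W := U Y)) _).symm
    rw [h1, VectorField.mpullback_apply]
    obtain ⟨A, hA⟩ := hinv _ hx0
    rw [← hA]
    simp
  have key := VectorField.fderiv_apply_lieBracket (V := U X) (W := U Y) hgc
    (by simpa using h2le) (hdiff Y) (hdiff X)
  rw [(hdir X).fderiv_eq, (hdir Y).fderiv_eq, hg, hchain f _ hx0 (by rw [hxx]; exact hfd.self_of_nhds),
    hchain _ _ hx0 (by rw [hxx]; exact hsm Y), hchain _ _ hx0 (by rw [hxx]; exact hsm X),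
    hpull X _ hx0, hpull Y _ hx0, ← hbr] at key
  rw [hxx] at key
  exact ⟨hsm X, key⟩

theorem mfderiv_mlieBracket_of_related (p : M → B) (hp : ContMDiff I I' ∞ p)
    (X Y : VField I M)
    (U V : VField I' B)
    (hX : ∀ x, mfderiv I I' p x (X x) = U (p x)) (hY : ∀ x, mfderiv I I' p x (Y x) = V (p x))
    (x : M) :
    mfderiv I I' p x (VectorField.mlieBracket I X Y x) =
      VectorField.mlieBracket I' U V (p x) := by
  have hpd : ∀ y, MDifferentiableAt I I' p y := fun y => (hp y).mdifferentiableAt (by simp)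
  set ψ := extChartAt I' (p x) with hψ
  have hψs : ContMDiffAt I' 𝓘(ℝ, E') ∞ ψ (p x) := contMDiffAt_extChartAt
  have hev : ∀ᶠ y in 𝓝 x, ContMDiffAt I' 𝓘(ℝ, E') ∞ ψ (p y) := by
    filter_upwards [hp.continuous.continuousAt.eventually
      (chart_source_mem_nhds H' (p x))] with y hy
    exact contMDiffAt_extChartAt' hy
  obtain ⟨A, hA⟩ := isInvertible_mfderiv_extChartAt (I := I') (mem_extChartAt_source (I := I') (p x))
  apply A.injective
  have hAA : ∀ w, A w = mfderiv I' 𝓘(ℝ, E') ψ (p x) w := fun w => by rw [← hA]; rfl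
  rw [hAA, hAA]
  -- test against linear functionals
  have hl : ∀ (l : E' →L[ℝ] ℝ) (b : B) (hb : ContMDiffAt I' 𝓘(ℝ, E') ∞ ψ b) (w : TangentSpace I' b),
      l (mfderiv I' 𝓘(ℝ, E') ψ b w : E') = mvfderiv I' (l ∘ ψ) b w := by
    intro l b hb w
    have h1 := mvfderiv_comp_apply (I := 𝓘(ℝ, E')) (I' := I') (g := l) b
      (l.differentiableAt.mdifferentiableAt) (hb.mdifferentiableAt (by simp)) w
    rw [h1]
    simp [mvfderiv]
    rfl
  have key : ∀ l : E' →L[ℝ] ℝ, l (mfderiv I' 𝓘(ℝ, E') ψ (p x) (mfderiv I I' p x (VectorField.mlieBracket I X Y x)) : E') =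
     l (mfderiv I' 𝓘(ℝ, E') ψ (p x) (VectorField.mlieBracket I' U V (p x)) : E') := by
    intro l
    rw [hl l _ hψs, hl l _ hψs]
    have hk : ContMDiffAt I' 𝓘(ℝ, ℝ) ∞ (l ∘ ψ) (p x) := l.contMDiff.contMDiffAt.comp _ hψs
    have hchain : ∀ (k : B → ℝ) (y : M), MDifferentiableAt I' 𝓘(ℝ, ℝ) k (p y) → ∀ v,
        mvfderiv I' k (p y) (mfderiv I I' p y v) = mvfderiv I (k ∘ p) y v :=
      fun k y hk v => (mvfderiv_comp_apply y hk (hpd y) v).symm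
    have hkd : ∀ᶠ y in 𝓝 x, MDifferentiableAt I' 𝓘(ℝ, ℝ) (l ∘ ψ) (p y) := by
      filter_upwards [hev] with y hy
      exact (l.contMDiff.contMDiffAt.comp _ hy).mdifferentiableAt (by simp)
    rw [(mvfderiv_mlieBracket_aux _ _ hk U V).2, hchain _ _ hkd.self_of_nhds,
      (mvfderiv_mlieBracket_aux _ _ (hk.comp x (hp x)) X Y).2]
    have hrel : ∀ (Z : VField I M) (W : VField I' B),
       (∀ x, mfderiv I I' p x (Z x) = W (p x)) →
       (fun y => mvfderiv I ((l ∘ ψ) ∘ p) y (Z y)) =ᶠ[𝓝 x] (fun b => mvfderiv I' (l ∘ ψ) b (W b)) ∘ p := by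
      intro Z W hZ
      filter_upwards [hkd] with y hy
      rw [← hchain _ _ hy, hZ]
      rfl
    have hm : ∀ (k k' : M → ℝ), k =ᶠ[𝓝 x] k' → ∀ v, mvfderiv I k x v = mvfderiv I k' x v :=
      fun k k' h v => DFunLike.congr_fun h.mfderiv_eq v
    rw [hm _ _ (hrel X U hX), hm _ _ (hrel Y V hY), ← hchain _ _ (mvfderiv_mlieBracket_aux _ _ hk V U).1,
      ← hchain _ _ (mvfderiv_mlieBracket_aux _ _ hk U V).1, hX, hY]
  by_contra hne
  obtain ⟨l, hl⟩ := SeparatingDual.exists_separating_of_ne (R := ℝ) (V := E') hne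
  exact hl (key l)
/-- The derivative `L_X f` of a function along a vector field. -/
def lieD (X : VField I M) (f : SFun I M) : SFun I M :=
  ⟨fun x => mvfderiv I f x (X x), by
    have h1 : ContMDiff I.tangent 𝓘(ℝ, ℝ).tangent ∞ (tangentMap I 𝓘(ℝ, ℝ) f) :=
      f.contMDiff.contMDiff_tangentMap (by simp)
    exact (contMDiff_snd_tangentBundle_modelSpace ℝ 𝓘(ℝ, ℝ)).comp (h1.comp X.contMDiff)⟩

/-- The Lie bracket of vector fields. -/
def lieB (X Y : VField I M) : VField I M :=
  ⟨fun x => VectorField.mlieBracket I X Y x, by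
    have : CompleteSpace E := FiniteDimensional.complete ℝ E
    have : IsManifold I (minSmoothness ℝ 2) M :=
      IsManifold.of_le (n := ∞) (by simpa using (WithTop.coe_le_coe.2 le_top : (2 : ℕ∞ω) ≤ ∞))
    have : IsManifold I (((⊤ : ℕ∞) : ℕ∞ω) + 1) M := by
      simpa using (inferInstance : IsManifold I ∞ M)
    exact ContDiff.mlieBracket_vectorField (m := ⊤) (n := ⊤) X.contMDiff Y.contMDiff (by simp)⟩

/-- Multiplication of a section of a vector bundle by a function. -/
def fsmul {F : Type*} [NormedAddCommGroup F] [NormedSpace ℝ F] {A : M → Type*}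
    [TopologicalSpace (TotalSpace F A)] [∀ x, TopologicalSpace (A x)] [FiberBundle F A]
    [∀ x, AddCommGroup (A x)] [∀ x, Module ℝ (A x)] [VectorBundle ℝ F A]
    (f : SFun I M) (s : Cₛ^∞⟮I; F, A⟯) : Cₛ^∞⟮I; F, A⟯ :=
  ⟨fun x => f x • s x, f.contMDiff.smul_section s.contMDiff⟩

@[simp] theorem lieD_apply (X : VField I M) (f : SFun I M) (x : M) :
    lieD X f x = mvfderiv I f x (X x) := rfl

@[simp] theorem lieB_apply (X Y : VField I M) (x : M) :
    lieB X Y x = VectorField.mlieBracket I X Y x := rfl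

@[simp] theorem fsmul_apply {F : Type*} [NormedAddCommGroup F] [NormedSpace ℝ F] {A : M → Type*}
    [TopologicalSpace (TotalSpace F A)] [∀ x, TopologicalSpace (A x)] [FiberBundle F A]
    [∀ x, AddCommGroup (A x)] [∀ x, Module ℝ (A x)] [VectorBundle ℝ F A]
    (f : SFun I M) (s : Cₛ^∞⟮I; F, A⟯) (x : M) : fsmul f s x = f x • s x := rfl

theorem SFun.mdiff (f : SFun I M) (x : M) : MDifferentiableAt I 𝓘(ℝ, ℝ) f x :=
  f.contMDiff.contMDiffAt.mdifferentiableAt (by simp)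

theorem lieD_add (X : VField I M) (f g : SFun I M) : lieD X (f + g) = lieD X f + lieD X g := by
  ext x
  have := congrArg (fun L => L (X x)) (mvfderiv_add (f.mdiff x) (g.mdiff x))
  simpa using this

theorem lieD_const_smul (X : VField I M) (c : ℝ) (f : SFun I M) :
    lieD X (c • f) = c • lieD X f := by
  ext x
  have := congrArg (fun L => L (X x)) (mvfderiv_smul (a := fun _ : M => c)
    mdifferentiableAt_const (f.mdiff x))
  simp [mvfderiv_const] at this
  exact this

theorem lieD_zero (X : VField I M) : lieD X (0 : SFun I M) = 0 := by
  simpa using lieD_const_smul X 0 (0 : SFun I M)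

theorem lieD_neg (X : VField I M) (f : SFun I M) : lieD X (-f) = -lieD X f := by
  simpa using lieD_const_smul X (-1) f

theorem lieD_sub (X : VField I M) (f g : SFun I M) : lieD X (f - g) = lieD X f - lieD X g := by
  rw [sub_eq_add_neg, lieD_add, lieD_neg, sub_eq_add_neg]

theorem lieD_mul (X : VField I M) (f g : SFun I M) :
    lieD X (f * g) = f * lieD X g + lieD X f * g := by
  ext x
  have := congrArg (fun L => L (X x)) (mvfderiv_mul (f.mdiff x) (g.mdiff x))
  simpa [mul_comm] using this

theorem lieD_lieB (X Y : VField I M) (f : SFun I M) :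
    lieD (lieB X Y) f = lieD X (lieD Y f) - lieD Y (lieD X f) := by
  ext x
  exact (mvfderiv_mlieBracket_aux f x f.contMDiff.contMDiffAt X Y).2

theorem lieB_skew (X Y : VField I M) : lieB X Y = -lieB Y X := by
  ext x
  exact VectorField.mlieBracket_swap_apply

theorem lieB_add (X Y Z : VField I M) : lieB X (Y + Z) = lieB X Y + lieB X Z := by
  have : CompleteSpace E := FiniteDimensional.complete ℝ E
  ext x
  exact VectorField.mlieBracket_add_right Y.mdifferentiableAt Z.mdifferentiableAt

theorem lieB_fsmul (X Y : VField I M) (f : SFun I M) :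
    lieB X (fsmul f Y) = fsmul f (lieB X Y) + fsmul (lieD X f) Y := by
  have : CompleteSpace E := FiniteDimensional.complete ℝ E
  ext x
  have := VectorField.mlieBracket_smul_right (V := X) (f.mdiff x) (Y.mdifferentiableAt (x := x))
  rw [add_comm]
  exact this

theorem lieB_jacobi (X Y Z : VField I M) :
    lieB X (lieB Y Z) = lieB (lieB X Y) Z + lieB Y (lieB X Z) := by
  have : CompleteSpace E := FiniteDimensional.complete ℝ E
  have h2 : (2 : ℕ∞ω) ≤ ∞ := WithTop.coe_le_coe.2 le_top
  have h3 : (3 : ℕ∞ω) ≤ ∞ := WithTop.coe_le_coe.2 le_top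
  have : IsManifold I (minSmoothness ℝ 3) M :=
    IsManifold.of_le (n := ∞) (by simpa using h3)
  ext x
  exact VectorField.leibniz_identity_mlieBracket_apply
    ((X.contMDiff.of_le (by simpa using h2)).contMDiffAt)
    ((Y.contMDiff.of_le (by simpa using h2)).contMDiffAt)
    ((Z.contMDiff.of_le (by simpa using h2)).contMDiffAt)

/-! ### Differential forms of degree one and two on `M` -/

/-- Smooth one-forms: families of linear forms on the tangent spaces that are smooth on smooth
vector fields. -/
def Form1 {E : Type*} [NormedAddCommGroup E] [NormedSpace ℝ E]
    {H : Type*} [TopologicalSpace H] (I : ModelWithCorners ℝ E H)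
    (M : Type*) [TopologicalSpace M] [ChartedSpace H M] [IsManifold I ∞ M] :
    Submodule ℝ (∀ x : M, TangentSpace I x →ₗ[ℝ] ℝ) where
  carrier := {β | ∀ X : VField I M, ContMDiff I 𝓘(ℝ, ℝ) ∞ fun x => β x (X x)}
  add_mem' ha hb X := (ha X).add (hb X)
  zero_mem' _ := contMDiff_const
  smul_mem' c _ ha X := (contMDiff_const (c := c)).mul (ha X)

/-- Families of bilinear forms on the tangent spaces of `M`. -/
def Bilin {E : Type*} [NormedAddCommGroup E] [NormedSpace ℝ E]
    {H : Type*} [TopologicalSpace H] (I : ModelWithCorners ℝ E H)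
    (M : Type*) [TopologicalSpace M] [ChartedSpace H M] :=
  ∀ x : M, TangentSpace I x →ₗ[ℝ] TangentSpace I x →ₗ[ℝ] ℝ

instance : AddCommGroup (Bilin I M) :=
  inferInstanceAs (AddCommGroup (∀ x : M, TangentSpace I x →ₗ[ℝ] TangentSpace I x →ₗ[ℝ] ℝ))

instance : Module ℝ (Bilin I M) :=
  inferInstanceAs (Module ℝ (∀ x : M, TangentSpace I x →ₗ[ℝ] TangentSpace I x →ₗ[ℝ] ℝ))

/-- Smooth two-forms: families of alternating bilinear forms on the tangent spaces that are smooth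
on smooth vector fields. -/
def Form2 {E : Type*} [NormedAddCommGroup E] [NormedSpace ℝ E]
    {H : Type*} [TopologicalSpace H] (I : ModelWithCorners ℝ E H)
    (M : Type*) [TopologicalSpace M] [ChartedSpace H M] [IsManifold I ∞ M] :
    Submodule ℝ (Bilin I M) where
  carrier := {θ | (∀ x v, θ x v v = 0) ∧
    ∀ X Y : VField I M, ContMDiff I 𝓘(ℝ, ℝ) ∞ fun x => θ x (X x) (Y x)}
  add_mem' {a b} ha hb := ⟨fun x v => by
    change a x v v + b x v v = 0
    rw [ha.1 x v, hb.1 x v, add_zero], fun X Y => (ha.2 X Y).add (hb.2 X Y)⟩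
  zero_mem' := ⟨fun _ _ => rfl, fun _ _ => contMDiff_const⟩
  smul_mem' c a ha := ⟨fun x v => by
    change c * a x v v = 0
    rw [ha.1 x v, mul_zero],
    fun X Y => (contMDiff_const (c := c)).mul (ha.2 X Y)⟩

/-- The function `β(X)`. -/
def ev1 (β : Form1 I M) (X : VField I M) : SFun I M := ⟨fun x => β.1 x (X x), β.2 X⟩

/-- The function `θ(X, Y)`. -/
def ev2 (θ : Form2 I M) (X Y : VField I M) : SFun I M := ⟨fun x => θ.1 x (X x) (Y x), θ.2.2 X Y⟩

/-- `(dβ)(X, Y)` for a one-form `β`. -/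
def d1 (β : Form1 I M) (X Y : VField I M) : SFun I M :=
  lieD X (ev1 β Y) - lieD Y (ev1 β X) - ev1 β (lieB X Y)

/-- `(dω)(X, Y, Z)` for a two-form `θ`. -/
def d2 (θ : Form2 I M) (X Y Z : VField I M) : SFun I M :=
  lieD X (ev2 θ Y Z) + lieD Y (ev2 θ Z X) + lieD Z (ev2 θ X Y)
    - ev2 θ (lieB X Y) Z - ev2 θ (lieB Y Z) X - ev2 θ (lieB Z X) Y

theorem ev1_add (α β : Form1 I M) (X : VField I M) : ev1 (α + β) X = ev1 α X + ev1 β X := rfl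
theorem ev1_smul (c : ℝ) (β : Form1 I M) (X : VField I M) : ev1 (c • β) X = c • ev1 β X := rfl
theorem ev2_add (θ η : Form2 I M) (X Y : VField I M) :
    ev2 (θ + η) X Y = ev2 θ X Y + ev2 η X Y := rfl
theorem ev2_smul (c : ℝ) (θ : Form2 I M) (X Y : VField I M) :
    ev2 (c • θ) X Y = c • ev2 θ X Y := rfl

theorem d1_add (α β : Form1 I M) (X Y : VField I M) : d1 (α + β) X Y = d1 α X Y + d1 β X Y := by
  simp only [d1, ev1_add, lieD_add]; abel
theorem d1_smul (c : ℝ) (β : Form1 I M) (X Y : VField I M) : d1 (c • β) X Y = c • d1 β X Y := by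
  simp only [d1, ev1_smul, lieD_const_smul, smul_sub]
theorem d2_add (θ η : Form2 I M) (X Y Z : VField I M) :
    d2 (θ + η) X Y Z = d2 θ X Y Z + d2 η X Y Z := by
  simp only [d2, ev2_add, lieD_add]; abel
theorem d2_smul (c : ℝ) (θ : Form2 I M) (X Y Z : VField I M) :
    d2 (c • θ) X Y Z = c • d2 θ X Y Z := by
  simp only [d2, ev2_smul, lieD_const_smul, smul_sub, smul_add]

/-- Closed two-forms on `M`. -/
def Closed2 {E : Type*} [NormedAddCommGroup E] [NormedSpace ℝ E] [FiniteDimensional ℝ E]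
    {H : Type*} [TopologicalSpace H] (I : ModelWithCorners ℝ E H) [I.Boundaryless]
    (M : Type*) [TopologicalSpace M] [ChartedSpace H M] [IsManifold I ∞ M] :
    Submodule ℝ (Form2 I M) where
  carrier := {θ | ∀ X Y Z : VField I M, d2 θ X Y Z = 0}
  add_mem' ha hb X Y Z := by rw [d2_add, ha X Y Z, hb X Y Z, add_zero]
  zero_mem' X Y Z := by simpa using d2_smul 0 (0 : Form2 I M) X Y Z
  smul_mem' c _ ha X Y Z := by rw [d2_smul, ha X Y Z, smul_zero]

/-- Exact two-forms on `M`. -/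
def Exact2 {E : Type*} [NormedAddCommGroup E] [NormedSpace ℝ E] [FiniteDimensional ℝ E]
    {H : Type*} [TopologicalSpace H] (I : ModelWithCorners ℝ E H) [I.Boundaryless]
    (M : Type*) [TopologicalSpace M] [ChartedSpace H M] [IsManifold I ∞ M] :
    Submodule ℝ (Form2 I M) where
  carrier := {θ | ∃ β : Form1 I M, ∀ X Y : VField I M, ev2 θ X Y = d1 β X Y}
  add_mem' := by
    rintro _ _ ⟨α, ha⟩ ⟨β, hb⟩
    exact ⟨α + β, fun X Y => by rw [ev2_add, d1_add, ha, hb]⟩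
  zero_mem' := ⟨0, fun X Y => by
    have := d1_smul 0 (0 : Form1 I M) X Y
    rw [zero_smul, zero_smul] at this
    rw [this]; rfl⟩
  smul_mem' := by
    rintro c _ ⟨α, ha⟩
    exact ⟨c • α, fun X Y => by rw [ev2_smul, d1_smul, ha]⟩

/-- The de Rham cohomology group `H²(M)`. -/
abbrev H2 {E : Type*} [NormedAddCommGroup E] [NormedSpace ℝ E] [FiniteDimensional ℝ E]
    {H : Type*} [TopologicalSpace H] (I : ModelWithCorners ℝ E H) [I.Boundaryless]
    (M : Type*) [TopologicalSpace M] [ChartedSpace H M] [IsManifold I ∞ M] :=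
  Closed2 I M ⧸ (Exact2 I M).submoduleOf (Closed2 I M)

/-- The de Rham class of a closed two-form. -/
def class2 (θ : Closed2 I M) : H2 I M := Submodule.Quotient.mk θ

/-! ### The vertical bundle and vertical forms -/

/-- The vertical space `ker dp` at a point. -/
def vert (p : C^∞⟮I, M; I', B⟯) (x : M) : Submodule ℝ (TangentSpace I x) :=
  LinearMap.ker (mfderiv I I' p x : TangentSpace I x →ₗ[ℝ] TangentSpace I' (p x))

/-- Smooth vertical vector fields, i.e. smooth sections of the vertical bundle. -/
def VSec (p : C^∞⟮I, M; I', B⟯) : Submodule ℝ (VField I M) where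
  carrier := {X | ∀ x, X x ∈ vert p x}
  add_mem' ha hb x := (vert p x).add_mem (ha x) (hb x)
  zero_mem' x := (vert p x).zero_mem
  smul_mem' c _ ha x := (vert p x).smul_mem c (ha x)

/-- The value of a vertical vector field at a point, as a vertical vector. -/
def vat {p : C^∞⟮I, M; I', B⟯} (Y : VSec p) (x : M) : vert p x := ⟨Y.1 x, Y.2 x⟩

/-- A vector field on `M` that projects to a vector field on `B`. -/
def Projects (p : C^∞⟮I, M; I', B⟯) (X : VField I M) (u : VField I' B) : Prop :=
  ∀ x, mfderiv I I' p x (X x) = u (p x)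

theorem vprojects {p : C^∞⟮I, M; I', B⟯} (Y : VSec p) : Projects p Y.1 0 := fun x => Y.2 x

theorem Projects.lieB {p : C^∞⟮I, M; I', B⟯} {X Y : VField I M} {u v : VField I' B}
    (hX : Projects p X u) (hY : Projects p Y v) : Projects p (lieB X Y) (lieB u v) :=
  fun x => mfderiv_mlieBracket_of_related p p.contMDiff X Y u v hX hY x

theorem lieB_zero_right (X : VField I M) : ClosedExtension.lieB X (0 : VField I M) = 0 := by
  ext x
  exact congrFun VectorField.mlieBracket_zero_right x

/-- The bracket `[X, Y]` of a projectable field `X` with a vertical field `Y`, a vertical field. -/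
def brV {p : C^∞⟮I, M; I', B⟯} {u : VField I' B} (X : VField I M) (hX : Projects p X u)
    (Y : VSec p) : VSec p :=
  ⟨lieB X Y.1, fun x => by
    have h := hX.lieB (vprojects Y) x
    rw [lieB_zero_right] at h
    exact h⟩

/-- Multiplication of a vertical vector field by a function. -/
def vfsmul {p : C^∞⟮I, M; I', B⟯} (f : SFun I M) (Y : VSec p) : VSec p :=
  ⟨ClosedExtension.fsmul f Y.1, fun x => (vert p x).smul_mem (f x) (Y.2 x)⟩

/-- Smooth vertical one-forms. -/
def VForm1 (p : C^∞⟮I, M; I', B⟯) : Submodule ℝ (∀ x : M, vert p x →ₗ[ℝ] ℝ) where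
  carrier := {β | ∀ Y : VSec p, ContMDiff I 𝓘(ℝ, ℝ) ∞ fun x => β x (vat Y x)}
  add_mem' ha hb X := (ha X).add (hb X)
  zero_mem' _ := contMDiff_const
  smul_mem' c _ ha X := (contMDiff_const (c := c)).mul (ha X)

/-- Families of bilinear forms on the vertical spaces. -/
def VBilin (p : C^∞⟮I, M; I', B⟯) := ∀ x : M, vert p x →ₗ[ℝ] vert p x →ₗ[ℝ] ℝ

instance (p : C^∞⟮I, M; I', B⟯) : AddCommGroup (VBilin p) :=
  inferInstanceAs (AddCommGroup (∀ x : M, vert p x →ₗ[ℝ] vert p x →ₗ[ℝ] ℝ))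

instance (p : C^∞⟮I, M; I', B⟯) : Module ℝ (VBilin p) :=
  inferInstanceAs (Module ℝ (∀ x : M, vert p x →ₗ[ℝ] vert p x →ₗ[ℝ] ℝ))

/-- Smooth vertical two-forms. -/
def VForm2 (p : C^∞⟮I, M; I', B⟯) : Submodule ℝ (VBilin p) where
  carrier := {θ | (∀ x v, θ x v v = 0) ∧
    ∀ Y Z : VSec p, ContMDiff I 𝓘(ℝ, ℝ) ∞ fun x => θ x (vat Y x) (vat Z x)}
  add_mem' {a b} ha hb := ⟨fun x v => by
    change a x v v + b x v v = 0
    rw [ha.1 x v, hb.1 x v, add_zero], fun X Y => (ha.2 X Y).add (hb.2 X Y)⟩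
  zero_mem' := ⟨fun _ _ => rfl, fun _ _ => contMDiff_const⟩
  smul_mem' c a ha := ⟨fun x v => by
    change c * a x v v = 0
    rw [ha.1 x v, mul_zero],
    fun X Y => (contMDiff_const (c := c)).mul (ha.2 X Y)⟩

variable {p : C^∞⟮I, M; I', B⟯}

/-- The function `α(Y)`. -/
def vev1 (α : VForm1 p) (Y : VSec p) : SFun I M := ⟨fun x => α.1 x (vat Y x), α.2 Y⟩

/-- The function `θ(Y, Z)`. -/
def vev2 (θ : VForm2 p) (Y Z : VSec p) : SFun I M :=
  ⟨fun x => θ.1 x (vat Y x) (vat Z x), θ.2.2 Y Z⟩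

/-- The bracket of vertical vector fields. -/
def vbr (Y Z : VSec p) : VSec p := brV Y.1 (vprojects Y) Z

/-- `(d_V α)(Y, Z)` for a vertical one-form `α`. -/
def dV1 (α : VForm1 p) (Y Z : VSec p) : SFun I M :=
  lieD Y.1 (vev1 α Z) - lieD Z.1 (vev1 α Y) - vev1 α (vbr Y Z)

/-- `(d_V θ)(Y, Z, W)` for a vertical two-form `θ`. -/
def dV2 (θ : VForm2 p) (Y Z W : VSec p) : SFun I M :=
  lieD Y.1 (vev2 θ Z W) + lieD Z.1 (vev2 θ W Y) + lieD W.1 (vev2 θ Y Z)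
    - vev2 θ (vbr Y Z) W - vev2 θ (vbr Z W) Y - vev2 θ (vbr W Y) Z

theorem vev1_add (α β : VForm1 p) (X : VSec p) : vev1 (α + β) X = vev1 α X + vev1 β X := rfl
theorem vev1_smul (c : ℝ) (β : VForm1 p) (X : VSec p) : vev1 (c • β) X = c • vev1 β X := rfl
theorem vev2_add (θ η : VForm2 p) (X Y : VSec p) :
    vev2 (θ + η) X Y = vev2 θ X Y + vev2 η X Y := rfl
theorem vev2_smul (c : ℝ) (θ : VForm2 p) (X Y : VSec p) :
    vev2 (c • θ) X Y = c • vev2 θ X Y := rfl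
theorem dV1_add (α β : VForm1 p) (X Y : VSec p) : dV1 (α + β) X Y = dV1 α X Y + dV1 β X Y := by
  simp only [dV1, vev1_add, lieD_add]; abel
theorem dV1_smul (c : ℝ) (β : VForm1 p) (X Y : VSec p) : dV1 (c • β) X Y = c • dV1 β X Y := by
  simp only [dV1, vev1_smul, lieD_const_smul, smul_sub]
theorem dV2_add (θ η : VForm2 p) (X Y Z : VSec p) :
    dV2 (θ + η) X Y Z = dV2 θ X Y Z + dV2 η X Y Z := by
  simp only [dV2, vev2_add, lieD_add]; abel
theorem dV2_smul (c : ℝ) (θ : VForm2 p) (X Y Z : VSec p) :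
    dV2 (c • θ) X Y Z = c • dV2 θ X Y Z := by
  simp only [dV2, vev2_smul, lieD_const_smul, smul_sub, smul_add]

/-- Vertically closed vertical two-forms. -/
def VClosed2 (p : C^∞⟮I, M; I', B⟯) : Submodule ℝ (VForm2 p) where
  carrier := {θ | ∀ X Y Z : VSec p, dV2 θ X Y Z = 0}
  add_mem' ha hb X Y Z := by rw [dV2_add, ha X Y Z, hb X Y Z, add_zero]
  zero_mem' X Y Z := by simpa using dV2_smul 0 (0 : VForm2 p) X Y Z
  smul_mem' c _ ha X Y Z := by rw [dV2_smul, ha X Y Z, smul_zero]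

/-- Vertically exact vertical two-forms. -/
def VExact2 (p : C^∞⟮I, M; I', B⟯) : Submodule ℝ (VForm2 p) where
  carrier := {θ | ∃ β : VForm1 p, ∀ X Y : VSec p, vev2 θ X Y = dV1 β X Y}
  add_mem' := by
    rintro _ _ ⟨α, ha⟩ ⟨β, hb⟩
    exact ⟨α + β, fun X Y => by rw [vev2_add, dV1_add, ha, hb]⟩
  zero_mem' := ⟨0, fun X Y => by
    have := dV1_smul 0 (0 : VForm1 p) X Y
    rw [zero_smul, zero_smul] at this
    rw [this]; rfl⟩
  smul_mem' := by
    rintro c _ ⟨α, ha⟩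
    exact ⟨c • α, fun X Y => by rw [vev2_smul, dV1_smul, ha]⟩

/-- The second cohomology of the vertical de Rham complex. -/
abbrev HV2 (p : C^∞⟮I, M; I', B⟯) := VClosed2 p ⧸ (VExact2 p).submoduleOf (VClosed2 p)

/-- The class `[θ]₁` of a vertically closed two-form. -/
def vclass2 (θ : VClosed2 p) : HV2 p := Submodule.Quotient.mk θ

/-- Restriction of one-forms to the fibres. -/
def restrict1 (p : C^∞⟮I, M; I', B⟯) (β : Form1 I M) : VForm1 p :=
  ⟨fun x => (β.1 x).comp (vert p x).subtype, fun Y => β.2 Y.1⟩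

/-- Restriction of two-forms to the fibres. -/
def restrict2 (p : C^∞⟮I, M; I', B⟯) : Form2 I M →ₗ[ℝ] VForm2 p where
  toFun θ := ⟨fun x => (θ.1 x).compl₁₂ (vert p x).subtype (vert p x).subtype,
    fun x v => θ.2.1 x v, fun Y Z => θ.2.2 Y.1 Z.1⟩
  map_add' _ _ := rfl
  map_smul' _ _ := rfl

/-- Restriction of closed two-forms to the fibres. -/
def restrictClosed (p : C^∞⟮I, M; I', B⟯) : Closed2 I M →ₗ[ℝ] VClosed2 p :=
  (restrict2 p).restrict fun _ hω Y Z W => hω Y.1 Z.1 W.1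

/-- The restriction map `H²(M) → H²(Ver)`. -/
def restrictH (p : C^∞⟮I, M; I', B⟯) : H2 I M →ₗ[ℝ] HV2 p :=
  Submodule.mapQ _ _ (restrictClosed p) (by
    rintro θ ⟨β, hβ⟩
    exact ⟨restrict1 p β, fun Y Z => hβ Y.1 Z.1⟩)


/-! ### Ehresmann connections and complete fibrations -/

/-- An Ehresmann connection on `p`, given by its horizontal lift: a smooth right inverse
`p^* TB → TM` of `dp`. The horizontal bundle is the image of the lift. -/
structure EhresmannConnection (p : C^∞⟮I, M; I', B⟯) where
  /-- the horizontal lift of tangent vectors -/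
  lift : ∀ x : M, TangentSpace I' (p x) →ₗ[ℝ] TangentSpace I x
  mfderiv_lift : ∀ (x : M) (w : TangentSpace I' (p x)), mfderiv I I' p x (lift x w) = w
  contMDiff_lift : ∀ u : VField I' B, ContMDiff I I.tangent ∞
    fun x => (TotalSpace.mk' E x (lift x (u (p x))) : TangentBundle I M)

/-- The horizontal lift `h(u)` of a vector field. -/
def hlift (h : EhresmannConnection p) (u : VField I' B) : VField I M :=
  ⟨fun x => h.lift x (u (p x)), h.contMDiff_lift u⟩

theorem hlift_projects (h : EhresmannConnection p) (u : VField I' B) :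
    Projects p (hlift h u) u := fun x => h.mfderiv_lift x (u (p x))

/-- A vector field is complete if through every point passes an integral curve defined on all of
the real line. -/
def IsCompleteField (X : VField I M) : Prop :=
  ∀ x : M, ∃ γ : ℝ → M, γ 0 = x ∧ IsMIntegralCurve γ (fun y => X y)

/-- A connection is complete if horizontal lifts of complete vector fields are complete. -/
def EhresmannConnection.IsComplete (h : EhresmannConnection p) : Prop :=
  ∀ u : VField I' B, IsCompleteField u → IsCompleteField (hlift h u)

/-- A complete fibration: a smooth submersion that admits a complete Ehresmann connection. -/
def IsCompleteFibration (p : C^∞⟮I, M; I', B⟯) : Prop :=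
  (∀ x : M, Function.Surjective (mfderiv I I' p x)) ∧ ∃ h : EhresmannConnection p, h.IsComplete

/-- The curvature `C(u, v) = [h(u), h(v)] - h([u, v])`, a vertical vector field. -/
def curv (h : EhresmannConnection p) (u v : VField I' B) : VSec p :=
  ⟨lieB (hlift h u) (hlift h v) - hlift h (lieB u v), fun x => by
    have h1 := (hlift_projects h u).lieB (hlift_projects h v) x
    have h2 := hlift_projects h (lieB u v) x
    change mfderiv I I' p x (lieB (hlift h u) (hlift h v) x - hlift h (lieB u v) x) = 0
    rw [map_sub, h1, h2, sub_self]⟩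

/-- The bracket `[h(u), Y]` with a vertical field. -/
def brH (h : EhresmannConnection p) (u : VField I' B) (Y : VSec p) : VSec p :=
  brV (hlift h u) (hlift_projects h u) Y

/-- The component `α_H` of a two-form: `α_H(u)(Y) = θ(h(u), Y)`. -/
def alphaH (h : EhresmannConnection p) (θ : Form2 I M) (u : VField I' B) : VForm1 p :=
  ⟨fun x => (θ.1 x (hlift h u x)).comp (vert p x).subtype, fun Y => θ.2.2 (hlift h u) Y.1⟩

/-- The component `ω_H` of a two-form: `ω_H(u, v) = θ(h(u), h(v))`. -/
def omegaH (h : EhresmannConnection p) (θ : Form2 I M) (u v : VField I' B) : SFun I M :=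
  ev2 θ (hlift h u) (hlift h v)

/-! ### The components of the de Rham differential

`Ω^{i,j}` denotes the `i`-forms on `B` with values in vertical `j`-forms. -/

/-- `(d_H η)(u) = L_{h(u)} η` for `η` in `Ω^{0,2}`. -/
def dH02 (h : EhresmannConnection p) (η : VForm2 p) (u : VField I' B) (Y Z : VSec p) : SFun I M :=
  lieD (hlift h u) (vev2 η Y Z) - vev2 η (brH h u Y) Z - vev2 η Y (brH h u Z)

/-- `d_V α` for `α` in `Ω^{1,1}`. -/
def dV11 (α : VField I' B → VForm1 p) (u : VField I' B) (Y Z : VSec p) : SFun I M :=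
  -dV1 (α u) Y Z

/-- `d_C η` for `η` in `Ω^{0,2}`. -/
def dC02 (h : EhresmannConnection p) (η : VForm2 p) (u v : VField I' B) (Y : VSec p) : SFun I M :=
  -vev2 η (curv h u v) Y

/-- `d_H α` for `α` in `Ω^{1,1}`. -/
def dH11 (h : EhresmannConnection p) (α : VField I' B → VForm1 p) (u v : VField I' B)
    (Y : VSec p) : SFun I M :=
  (lieD (hlift h u) (vev1 (α v) Y) - vev1 (α v) (brH h u Y))
    - (lieD (hlift h v) (vev1 (α u) Y) - vev1 (α u) (brH h v Y))
    - vev1 (α (lieB u v)) Y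

/-- `d_V κ` for `κ` in `Ω^{2,0}`. -/
def dV20 (κ : VField I' B → VField I' B → SFun I M) (u v : VField I' B) (Y : VSec p) : SFun I M :=
  lieD Y.1 (κ u v)

/-- `d_C α` for `α` in `Ω^{1,1}`. -/
def dC11 (h : EhresmannConnection p) (α : VField I' B → VForm1 p) (u v w : VField I' B) :
    SFun I M :=
  vev1 (α u) (curv h v w) + vev1 (α v) (curv h w u) + vev1 (α w) (curv h u v)

/-- `d_H κ` for `κ` in `Ω^{2,0}`. -/
def dH20 (h : EhresmannConnection p) (κ : VField I' B → VField I' B → SFun I M)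
    (u v w : VField I' B) : SFun I M :=
  (lieD (hlift h u) (κ v w) - κ (lieB u v) w) + (lieD (hlift h v) (κ w u) - κ (lieB v w) u)
    + (lieD (hlift h w) (κ u v) - κ (lieB w u) v)

/-- The equation `d_V ω_V = 0`. -/
def ClosedEq1 (p : C^∞⟮I, M; I', B⟯) (θ : Form2 I M) : Prop :=
  ∀ Y Z W : VSec p, dV2 (restrict2 p θ) Y Z W = 0

/-- The equation `d_H ω_V + d_V α_H = 0`. -/
def ClosedEq2 (h : EhresmannConnection p) (θ : Form2 I M) : Prop :=
  ∀ (u : VField I' B) (Y Z : VSec p),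
    dH02 h (restrict2 p θ) u Y Z + dV11 (alphaH h θ) u Y Z = 0

/-- The equation `d_C ω_V + d_H α_H + d_V ω_H = 0`. -/
def ClosedEq3 (h : EhresmannConnection p) (θ : Form2 I M) : Prop :=
  ∀ (u v : VField I' B) (Y : VSec p),
    dC02 h (restrict2 p θ) u v Y + dH11 h (alphaH h θ) u v Y + dV20 (omegaH h θ) u v Y = 0

/-- The equation `d_C α_H + d_H ω_H = 0`. -/
def ClosedEq4 (h : EhresmannConnection p) (θ : Form2 I M) : Prop :=
  ∀ u v w : VField I' B, dC11 h (alphaH h θ) u v w + dH20 h (omegaH h θ) u v w = 0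

/-! ### The fibred prequantization `A_V = Ver × ℝ` -/

/-- Smooth sections of `A_V = Ver × ℝ`. -/
abbrev ASec (p : C^∞⟮I, M; I', B⟯) := VSec p × SFun I M

/-- Multiplication of a section of `A_V` by a function. -/
def asmul (f : SFun I M) (a : ASec p) : ASec p := (vfsmul f a.1, f * a.2)

/-- The bracket `[(Y, f), (Z, g)] = ([Y, Z], L_Y g - L_Z f + ω_V(Y, Z))` on sections of `A_V`. -/
def avBracket (ωV : VForm2 p) (a b : ASec p) : ASec p :=
  (vbr a.1 b.1, lieD a.1.1 b.2 - lieD b.1.1 a.2 + vev2 ωV a.1 b.1)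

/-- `D` is a symmetry with symbol `X` of the fibred prequantization `M × ℝ → A_V → Ver`: a
derivation of the Lie algebroid `A_V` that preserves the constant section `(0, 1)` of the
centre `M × ℝ`. -/
structure IsSymmetry (ωV : VForm2 p) (X : VField I M) (D : ASec p → ASec p) : Prop where
  map_add : ∀ a b, D (a + b) = D a + D b
  leibniz : ∀ (f : SFun I M) (a), D (asmul f a) = asmul f (D a) + asmul (lieD X f) a
  bracket : ∀ a b, D (avBracket ωV a b) = avBracket ωV (D a) b + avBracket ωV a (D b)
  central : D (0, 1) = 0

/-- A couple `(D, w)` of a `C^∞(B)`-linear map `D` from vector fields on `B` to symmetries of `A_V`,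
compatible with the projections to vector fields on `B`, and a two-form `w` on `B` with values in
sections of `A_V`. -/
structure Couple (ωV : VForm2 p) where
  /-- the symmetry `D_u` -/
  D : VField I' B → ASec p → ASec p
  /-- the symbol of `D_u` -/
  symbol : VField I' B → VField I M
  isSymmetry : ∀ u, IsSymmetry ωV (symbol u) (D u)
  projects : ∀ u, Projects p (symbol u) u
  D_add : ∀ u v a, D (u + v) a = D u a + D v a
  D_fsmul : ∀ (f : SFun I' B) (u a), D (fsmul f u) a = asmul (f.comp p) (D u a)
  /-- the two-form `w` -/
  w : VField I' B → VField I' B → ASec p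
  w_self : ∀ u, w u u = 0
  w_add : ∀ u v t, w (u + v) t = w u t + w v t
  w_fsmul : ∀ (f : SFun I' B) (u t), w (fsmul f u) t = asmul (f.comp p) (w u t)
  w_skew : ∀ u v, w u v = -w v u

/-- The structure equation `[D_u, D_v] - D_{[u, v]} = ad (w(u, v))`. -/
def CurvEq (ωV : VForm2 p) (D : VField I' B → ASec p → ASec p)
    (w : VField I' B → VField I' B → ASec p) : Prop :=
  ∀ u v a, D u (D v a) - D v (D u a) - D (lieB u v) a = avBracket ωV (w u v) a

/-- The structure equation `∮ (D_u w(v, t) - w([u, v], t)) = 0`. -/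
def BianchiEq (D : VField I' B → ASec p → ASec p) (w : VField I' B → VField I' B → ASec p) : Prop :=
  ∀ u v t, (D u (w v t) - w (lieB u v) t) + (D v (w t u) - w (lieB v t) u)
    + (D t (w u v) - w (lieB t u) v) = 0

/-- `D_u = (h(u), α_H(u))`, acting by `D_u (Y, g) = ([h(u), Y], L_{h(u)} g + α_H(u)(Y))`. -/
def formD (h : EhresmannConnection p) (θ : Form2 I M) (u : VField I' B) (a : ASec p) : ASec p :=
  (brH h u a.1, lieD (hlift h u) a.2 + vev1 (alphaH h θ u) a.1)

/-- `w(u, v) = (C(u, v), ω_H(u, v))`. -/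
def formW (h : EhresmannConnection p) (θ : Form2 I M) (u v : VField I' B) : ASec p :=
  (curv h u v, omegaH h θ u v)

/-- The couple `c` is given by the connection `h` and the components of the two-form `θ`. -/
structure Couple.IsOf {ωV : VForm2 p} (c : Couple ωV) (h : EhresmannConnection p)
    (θ : Form2 I M) : Prop where
  symbol_eq : ∀ u, c.symbol u = hlift h u
  D_eq : ∀ u a, c.D u a = formD h θ u a
  w_eq : ∀ u v, c.w u v = formW h θ u v

/-! ### Lie algebroids -/

/-- A Lie algebroid structure over `M` on the vector bundle `A` with model fibre `F`. -/
structure LieAlgebroid {E : Type*} [NormedAddCommGroup E] [NormedSpace ℝ E] [FiniteDimensional ℝ E]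
    {H : Type*} [TopologicalSpace H] (I : ModelWithCorners ℝ E H) [I.Boundaryless]
    {M : Type*} [TopologicalSpace M] [ChartedSpace H M] [IsManifold I ∞ M]
    (F : Type*) [NormedAddCommGroup F] [NormedSpace ℝ F] (A : M → Type*)
    [TopologicalSpace (TotalSpace F A)] [∀ x, TopologicalSpace (A x)] [FiberBundle F A]
    [∀ x, AddCommGroup (A x)] [∀ x, Module ℝ (A x)] [VectorBundle ℝ F A] where
  /-- the anchor -/
  anchor : ∀ x, A x →ₗ[ℝ] TangentSpace I x
  contMDiff_anchor : ∀ s : Cₛ^∞⟮I; F, A⟯, ContMDiff I I.tangent ∞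
    fun x => (TotalSpace.mk' E x (anchor x (s x)) : TangentBundle I M)
  /-- the bracket of sections -/
  bracket : Cₛ^∞⟮I; F, A⟯ → Cₛ^∞⟮I; F, A⟯ → Cₛ^∞⟮I; F, A⟯
  bracket_add : ∀ a b c, bracket a (b + c) = bracket a b + bracket a c
  skew : ∀ a b, bracket a b = -bracket b a
  leibniz : ∀ (a) (f : SFun I M) (b), bracket a (fsmul f b) = fsmul f (bracket a b)
    + fsmul (lieD ⟨fun x => anchor x (a x), contMDiff_anchor a⟩ f) b
  jacobi : ∀ a b c, bracket a (bracket b c) = bracket (bracket a b) c + bracket b (bracket a c)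

/-- The bundle `TM × ℝ`. -/
abbrev Preq {E : Type*} [NormedAddCommGroup E] [NormedSpace ℝ E]
    {H : Type*} [TopologicalSpace H] (I : ModelWithCorners ℝ E H)
    (M : Type*) [TopologicalSpace M] [ChartedSpace H M] : M → Type _ :=
  (TangentSpace I : M → Type _) ×ᵇ Bundle.Trivial M ℝ

/-- The section `(X, f)` of `TM × ℝ`. -/
def preqMk (X : VField I M) (f : SFun I M) : Cₛ^∞⟮I; E × ℝ, Preq I M⟯ :=
  ⟨fun x => (X x, f x), fun x => by
    rw [Bundle.contMDiffAt_section]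
    have h1 := (Bundle.contMDiffAt_section x).1 (X.contMDiff x)
    exact h1.prodMk_space (f.contMDiff x)⟩

/-- The first component of a section of `TM × ℝ`. -/
def preqFst (s : Cₛ^∞⟮I; E × ℝ, Preq I M⟯) : VField I M :=
  ⟨fun x => (s x).1, fun x => by
    rw [Bundle.contMDiffAt_section]
    have h1 := (Bundle.contMDiffAt_section x).1 (s.contMDiff x)
    exact (contDiff_fst.contMDiff.contMDiffAt (n := ∞)).comp x h1⟩

/-- The second component of a section of `TM × ℝ`. -/
def preqSnd (s : Cₛ^∞⟮I; E × ℝ, Preq I M⟯) : SFun I M :=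
  ⟨fun x => (s x).2, fun x => by
    have h1 := (Bundle.contMDiffAt_section x).1 (s.contMDiff x)
    exact ((contDiff_snd.contMDiff.contMDiffAt (n := ∞)).comp x h1 :)⟩

theorem ev2_swap (θ : Form2 I M) (X Y : VField I M) : ev2 θ X Y = -ev2 θ Y X := by
  ext x
  have h := θ.2.1 x (X x + Y x)
  simp only [map_add, LinearMap.add_apply, θ.2.1 x (X x), θ.2.1 x (Y x)] at h
  change θ.1 x (X x) (Y x) = -θ.1 x (Y x) (X x)
  linarith

theorem ev2_add_right (θ : Form2 I M) (X Y Z : VField I M) :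
    ev2 θ X (Y + Z) = ev2 θ X Y + ev2 θ X Z := by
  ext x
  exact map_add (θ.1 x (X x)) (Y x) (Z x)

theorem ev2_fsmul_right (θ : Form2 I M) (f : SFun I M) (X Y : VField I M) :
    ev2 θ X (fsmul f Y) = f * ev2 θ X Y := by
  ext x
  exact map_smul (θ.1 x (X x)) (f x) (Y x)

theorem ev2_neg_right (θ : Form2 I M) (X Y : VField I M) : ev2 θ X (-Y) = -ev2 θ X Y := by
  ext x
  exact map_neg (θ.1 x (X x)) (Y x)

theorem lieD_add_left (X Y : VField I M) (f : SFun I M) :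
    lieD (X + Y) f = lieD X f + lieD Y f := by
  ext x
  exact map_add (mvfderiv I f x) (X x) (Y x)

theorem lieD_fsmul_left (g : SFun I M) (X : VField I M) (f : SFun I M) :
    lieD (fsmul g X) f = g * lieD X f := by
  ext x
  exact map_smul (mvfderiv I f x) (g x) (X x)

theorem preq_ext {s t : Cₛ^∞⟮I; E × ℝ, Preq I M⟯} (h1 : preqFst s = preqFst t)
    (h2 : preqSnd s = preqSnd t) : s = t := by
  apply ContMDiffSection.ext
  intro x
  exact Prod.ext (congrArg (fun X : VField I M => X x) h1) (congrArg (fun f : SFun I M => f x) h2)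

/-- The bracket `[(X, f), (Y, g)] = ([X, Y], L_X g - L_Y f + θ(X, Y))`. -/
def preqBracket (θ : Form2 I M) (a b : Cₛ^∞⟮I; E × ℝ, Preq I M⟯) : Cₛ^∞⟮I; E × ℝ, Preq I M⟯ :=
  preqMk (lieB (preqFst a) (preqFst b))
    (lieD (preqFst a) (preqSnd b) - lieD (preqFst b) (preqSnd a) + ev2 θ (preqFst a) (preqFst b))

/-- The prequantization Lie algebroid `A_θ = TM × ℝ` of a closed two-form. -/
def preqAlgebroid (θ : Closed2 I M) : LieAlgebroid I (E × ℝ) (Preq I M) where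
  anchor x := LinearMap.fst ℝ (TangentSpace I x) ℝ
  contMDiff_anchor s := (preqFst s).contMDiff
  bracket := preqBracket θ.1
  bracket_add a b c := by
    apply preq_ext
    · exact lieB_add (preqFst a) (preqFst b) (preqFst c)
    · change lieD (preqFst a) (preqSnd b + preqSnd c) - lieD (preqFst b + preqFst c) (preqSnd a)
          + ev2 θ.1 (preqFst a) (preqFst b + preqFst c)
        = (lieD (preqFst a) (preqSnd b) - lieD (preqFst b) (preqSnd a)
          + ev2 θ.1 (preqFst a) (preqFst b))
        + (lieD (preqFst a) (preqSnd c) - lieD (preqFst c) (preqSnd a)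
          + ev2 θ.1 (preqFst a) (preqFst c))
      rw [lieD_add, lieD_add_left, ev2_add_right]
      abel
  skew a b := by
    apply preq_ext
    · exact lieB_skew (preqFst a) (preqFst b)
    · change lieD (preqFst a) (preqSnd b) - lieD (preqFst b) (preqSnd a)
          + ev2 θ.1 (preqFst a) (preqFst b)
        = -(lieD (preqFst b) (preqSnd a) - lieD (preqFst a) (preqSnd b)
          + ev2 θ.1 (preqFst b) (preqFst a))
      rw [ev2_swap]
      abel
  leibniz a f b := by
    apply preq_ext
    · exact lieB_fsmul (preqFst a) (preqFst b) f
    · change lieD (preqFst a) (f * preqSnd b) - lieD (fsmul f (preqFst b)) (preqSnd a)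
          + ev2 θ.1 (preqFst a) (fsmul f (preqFst b))
        = f * (lieD (preqFst a) (preqSnd b) - lieD (preqFst b) (preqSnd a)
          + ev2 θ.1 (preqFst a) (preqFst b)) + lieD (preqFst a) f * preqSnd b
      rw [lieD_mul, lieD_fsmul_left, ev2_fsmul_right]
      ring
  jacobi a b c := by
    apply preq_ext
    · exact lieB_jacobi (preqFst a) (preqFst b) (preqFst c)
    · set X := preqFst a
      set Y := preqFst b
      set Z := preqFst c
      set f := preqSnd a
      set g := preqSnd b
      set k := preqSnd c
      change lieD X (lieD Y k - lieD Z g + ev2 θ.1 Y Z) - lieD (lieB Y Z) f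
          + ev2 θ.1 X (lieB Y Z)
        = (lieD (lieB X Y) k - lieD Z (lieD X g - lieD Y f + ev2 θ.1 X Y)
          + ev2 θ.1 (lieB X Y) Z)
        + (lieD Y (lieD X k - lieD Z f + ev2 θ.1 X Z) - lieD (lieB X Z) g
          + ev2 θ.1 Y (lieB X Z))
      have hc := θ.2 X Y Z
      have h1 := ev2_swap θ.1 X (lieB Y Z)
      have h2 : lieD Y (ev2 θ.1 X Z) = -lieD Y (ev2 θ.1 Z X) := by
        rw [ev2_swap θ.1 X Z, lieD_neg]
      have h3 : ev2 θ.1 Y (lieB X Z) = ev2 θ.1 (lieB Z X) Y := by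
        rw [lieB_skew X Z, ev2_neg_right, ev2_swap θ.1 (lieB Z X) Y]
      rw [d2] at hc
      rw [h1, h3]
      simp only [lieD_add, lieD_sub, lieD_lieB]
      rw [h2]
      linear_combination hc

/-- A Lie algebroid extension `A_V → A → TB` of prequantizations: the inclusion of
`A_V = Ver × ℝ` is an isomorphism onto the kernel of the composition of the anchor with `dp`, which
is surjective; it commutes with anchors and brackets, and the centre `M × ℝ` of `A_V` remains
central in `A`. -/
structure Extension (p : C^∞⟮I, M; I', B⟯) (ωV : VClosed2 p)
    {F : Type*} [NormedAddCommGroup F] [NormedSpace ℝ F] {A : M → Type*}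
    [TopologicalSpace (TotalSpace F A)] [∀ x, TopologicalSpace (A x)] [FiberBundle F A]
    [∀ x, AddCommGroup (A x)] [∀ x, Module ℝ (A x)] [VectorBundle ℝ F A]
    (L : LieAlgebroid I F A) where
  /-- the inclusion of `A_V` -/
  incl : ∀ x, vert p x × ℝ →ₗ[ℝ] A x
  contMDiff_incl : ∀ s : ASec p, ContMDiff I (I.prod 𝓘(ℝ, F)) ∞
    fun x => (TotalSpace.mk' F x (incl x (vat s.1 x, s.2 x)) : TotalSpace F A)
  injective : ∀ x, Function.Injective (incl x)
  ker_iff : ∀ x (a : A x), mfderiv I I' p x (L.anchor x a) = 0 ↔ a ∈ LinearMap.range (incl x)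
  surjective : ∀ x (w : TangentSpace I' (p x)), ∃ a : A x, mfderiv I I' p x (L.anchor x a) = w
  anchor_incl : ∀ x (v : vert p x) (t : ℝ), L.anchor x (incl x (v, t)) = v
  bracket_incl : ∀ s t : ASec p,
    L.bracket ⟨fun x => incl x (vat s.1 x, s.2 x), contMDiff_incl s⟩
        ⟨fun x => incl x (vat t.1 x, t.2 x), contMDiff_incl t⟩
      = ⟨fun x => incl x (vat (avBracket ωV.1 s t).1 x, (avBracket ωV.1 s t).2 x),
          contMDiff_incl (avBracket ωV.1 s t)⟩
  central : ∀ a : Cₛ^∞⟮I; F, A⟯,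
    L.bracket a ⟨fun x => incl x (vat (0 : VSec p) x, (1 : SFun I M) x), contMDiff_incl (0, 1)⟩ = 0

section Bundles

variable {F : Type*} [NormedAddCommGroup F] [NormedSpace ℝ F] {A : M → Type*}
  [TopologicalSpace (TotalSpace F A)] [∀ x, TopologicalSpace (A x)] [FiberBundle F A]
  [∀ x, AddCommGroup (A x)] [∀ x, Module ℝ (A x)] [VectorBundle ℝ F A]
  {F' : Type*} [NormedAddCommGroup F'] [NormedSpace ℝ F'] {A' : M → Type*}
  [TopologicalSpace (TotalSpace F' A')] [∀ x, TopologicalSpace (A' x)] [FiberBundle F' A']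
  [∀ x, AddCommGroup (A' x)] [∀ x, Module ℝ (A' x)] [VectorBundle ℝ F' A']

/-- The image in `A` of a section of `A_V`. -/
def Extension.inclSec {ωV : VClosed2 p} {L : LieAlgebroid I F A} (e : Extension p ωV L)
    (s : ASec p) : Cₛ^∞⟮I; F, A⟯ :=
  ⟨fun x => e.incl x (vat s.1 x, s.2 x), e.contMDiff_incl s⟩

/-- Smooth splittings `TM → A` of the anchor. -/
structure AnchorSplitting (L : LieAlgebroid I F A) where
  /-- the splitting -/
  map : ∀ x, TangentSpace I x →ₗ[ℝ] A x
  anchor_map : ∀ x v, L.anchor x (map x v) = v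
  contMDiff_map : ∀ X : VField I M, ContMDiff I (I.prod 𝓘(ℝ, F)) ∞
    fun x => (TotalSpace.mk' F x (map x (X x)) : TotalSpace F A)

/-- The section `σ(X)`. -/
def AnchorSplitting.sec {L : LieAlgebroid I F A} (σ : AnchorSplitting L) (X : VField I M) :
    Cₛ^∞⟮I; F, A⟯ := ⟨fun x => σ.map x (X x), σ.contMDiff_map X⟩

/-- The curvature `[σ(X), σ(Y)] - σ([X, Y])` of a splitting of the anchor. -/
def AnchorSplitting.curvature {L : LieAlgebroid I F A} (σ : AnchorSplitting L) (X Y : VField I M) :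
    Cₛ^∞⟮I; F, A⟯ := L.bracket (σ.sec X) (σ.sec Y) - σ.sec (lieB X Y)

/-- Smooth splittings `p^* TB → A` of the composition of the anchor with `dp`, i.e. choices of a
sub-bundle of `A` complementary to the kernel `A_V`. -/
structure HorSplitting (p : C^∞⟮I, M; I', B⟯) (L : LieAlgebroid I F A) where
  /-- the splitting -/
  map : ∀ x, TangentSpace I' (p x) →ₗ[ℝ] A x
  mfderiv_map : ∀ x w, mfderiv I I' p x (L.anchor x (map x w)) = w
  contMDiff_map : ∀ u : VField I' B, ContMDiff I (I.prod 𝓘(ℝ, F)) ∞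
    fun x => (TotalSpace.mk' F x (map x (u (p x))) : TotalSpace F A)

/-- The section given by the splitting on a vector field of `B`. -/
def HorSplitting.sec {L : LieAlgebroid I F A} (k : HorSplitting p L) (u : VField I' B) :
    Cₛ^∞⟮I; F, A⟯ := ⟨fun x => k.map x (u (p x)), k.contMDiff_map u⟩

/-- The couple `c` is induced by the splitting `k` of the extension `e`: `D_u = [k(u), ·]` on `A_V`
and `w(u, v) = [k(u), k(v)] - k([u, v])`, and the symbol of `D_u` is the anchor of `k(u)`. -/
structure Couple.IsInduced {ωV : VClosed2 p} {L : LieAlgebroid I F A} (c : Couple ωV.1)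
    (e : Extension p ωV L) (k : HorSplitting p L) : Prop where
  symbol_eq : ∀ u x, c.symbol u x = L.anchor x (k.sec u x)
  D_eq : ∀ u s, e.inclSec (c.D u s) = L.bracket (k.sec u) (e.inclSec s)
  w_eq : ∀ u v, e.inclSec (c.w u v) = L.bracket (k.sec u) (k.sec v) - k.sec (lieB u v)

/-- Isomorphisms of Lie algebroids over the identity of `M`. -/
structure AlgebroidIso (L : LieAlgebroid I F A) (L' : LieAlgebroid I F' A') where
  /-- the isomorphism on fibres -/
  map : ∀ x, A x ≃ₗ[ℝ] A' x
  contMDiff_map : ∀ s : Cₛ^∞⟮I; F, A⟯, ContMDiff I (I.prod 𝓘(ℝ, F')) ∞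
    fun x => (TotalSpace.mk' F' x (map x (s x)) : TotalSpace F' A')
  contMDiff_symm : ∀ s : Cₛ^∞⟮I; F', A'⟯, ContMDiff I (I.prod 𝓘(ℝ, F)) ∞
    fun x => (TotalSpace.mk' F x ((map x).symm (s x)) : TotalSpace F A)
  anchor_map : ∀ x a, L'.anchor x (map x a) = L.anchor x a
  bracket_map : ∀ s t : Cₛ^∞⟮I; F, A⟯,
    (⟨fun x => map x (L.bracket s t x), contMDiff_map (L.bracket s t)⟩ : Cₛ^∞⟮I; F', A'⟯)
      = L'.bracket ⟨fun x => map x (s x), contMDiff_map s⟩ ⟨fun x => map x (t x), contMDiff_map t⟩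

/-- Equivalences of extensions of `A_V`: isomorphisms that restrict to the identity of `A_V`. -/
structure ExtensionIso {ωV : VClosed2 p} {L : LieAlgebroid I F A} {L' : LieAlgebroid I F' A'}
    (e : Extension p ωV L) (e' : Extension p ωV L') extends AlgebroidIso L L' where
  map_incl : ∀ x a, map x (e.incl x a) = e'.incl x a

end Bundles

end

end ClosedExtension

open ClosedExtension

/-!
# Closed extensions of fibrewise closed two-forms as extensions of Lie algebroids

The proof rests on one reduction. If `i : A_V → A` is an extension of `TB` with anchor `♯`, then
the kernel of `♯` is the line bundle spanned by the central section `i(0, 1)`. Hence for a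
splitting `σ` of the anchor the section `[σX, σY] - σ[X, Y]`, which is killed by the anchor, equals
`i(0, θ(X, Y))` for a unique two-form `θ`; the Jacobi identity in `A`, with `i(0, 1)` central, says
that `θ` is closed, and `(X, f) ↦ σX + i(0, f)` is an isomorphism `A_θ → A`
(`AnchorSplitting.splitIso`). On vertical vectors `σ` differs from `i` by a vertical one-form `γ`
with values in the centre, and comparing brackets gives `ω_V = θ|_Ver + d_V γ`, so that `i`
corresponds to `(v, t) ↦ (v, t + γ(v))` on `A_θ` (`AnchorSplitting.existsUnique_form`). In the
same way an isomorphism `A_θ → A_θ'` over the identity that fixes `(0, 1)` is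
`(X, f) ↦ (X, f + β(X))` for a one-form `β` with `θ = θ' + dβ`, which settles equivalences and
cohomology classes.

A connection `h` splits every vector field into a vertical one and, locally, a combination of
horizontal lifts. Since `dθ` is tensorial, it vanishes as soon as it vanishes on triples of vertical
and lifted fields, and the four types of triples give the four closedness equations
(`mem_closed2_iff`). Each of the last three equations is one component of a structure
equation of `D_u = (h(u), α_H(u))` and `w = (C, ω_H)`; the components of those structure
equations in `Ver` hold by the Jacobi identity of vector fields (`closedEq2_iff`,
`closedEq3_iff`, `closedEq4_iff`).

For the correspondence with couples, a symmetry `D` of `A_V` is determined by its symbol `X` and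
a vertical one-form: the bracket rule forces `D(Y, g) = ([X, Y], L_X g + α(Y))`. Thus a
couple `(D, w)` yields a connection and forms `α_H`, `ω_H`, which together with `ω_V` are
the components of a unique two-form; by the equivalences above it is closed
(`Couple.existsUnique_isOf`). A splitting `k` of `dp ∘ ♯` induces a couple, and the splitting of the
anchor equal to `k` on horizontal and to `i(·, 0)` on vertical vectors has as curvature the closed
form of that couple, so the isomorphism of the first paragraph gives the equivalence with the
original extension (`HorSplitting.correspondence`).

Smooth splittings of the anchor are glued from local ones by a partition of unity, the condition on
the value at a point being convex (`nonempty_anchorSplitting`).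
-/

namespace ClosedExtension

noncomputable section

variable {E : Type*} [NormedAddCommGroup E] [NormedSpace ℝ E] [FiniteDimensional ℝ E]
  {H : Type*} [TopologicalSpace H] {I : ModelWithCorners ℝ E H} [I.Boundaryless]
  {M : Type*} [TopologicalSpace M] [ChartedSpace H M] [IsManifold I ∞ M]
variable {E' : Type*} [NormedAddCommGroup E'] [NormedSpace ℝ E'] [FiniteDimensional ℝ E']
  {H' : Type*} [TopologicalSpace H'] {I' : ModelWithCorners ℝ E' H'} [I'.Boundaryless]
  {B : Type*} [TopologicalSpace B] [ChartedSpace H' B] [IsManifold I' ∞ B]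

/-! ### Local frames, extension of vectors and tensoriality -/

section Frames

variable {F : Type*} [NormedAddCommGroup F] [NormedSpace ℝ F] [FiniteDimensional ℝ F]
  {A : M → Type*}
  [TopologicalSpace (TotalSpace F A)] [∀ x, TopologicalSpace (A x)] [FiberBundle F A]
  [∀ x, AddCommGroup (A x)] [∀ x, Module ℝ (A x)] [VectorBundle ℝ F A]

/-- A local frame at `x₀` and its dual frame, both cut off to global smooth objects: the cut-off
function `ρ` satisfies `ρ v = ∑ cᵢ(v) sᵢ` for all vectors `v`. -/
theorem exists_frame [ContMDiffVectorBundle ∞ F A I] [T2Space M] (x₀ : M) :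
    ∃ (ι : Type) (_ : Fintype ι) (ρ : SFun I M) (s : ι → Cₛ^∞⟮I; F, A⟯)
      (c : ι → ∀ x, A x →ₗ[ℝ] ℝ), (∀ᶠ x in 𝓝 x₀, ρ x = 1) ∧
      (∀ i, ContMDiff (I.prod 𝓘(ℝ, F)) 𝓘(ℝ, ℝ) ∞ fun z : TotalSpace F A => c i z.1 z.2) ∧
      ∀ x (v : A x), ρ x • v = ∑ i, c i x v • s i x := by
  set e := trivializationAt F A x₀ with he
  have hx : e.baseSet ∈ 𝓝 x₀ :=
    e.open_baseSet.mem_nhds (FiberBundle.mem_baseSet_trivializationAt' x₀)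
  obtain ⟨ψ, -, hψ⟩ := (SmoothBumpFunction.nhds_basis_tsupport (I := I) x₀).mem_iff.1 hx
  let b := Module.finBasis ℝ F
  have hs : ∀ i, ContMDiff I (I.prod 𝓘(ℝ, F)) ∞
      (fun x => TotalSpace.mk' F x (((ψ : M → ℝ) • fun y => e.symm y (b i)) x)) := by
    intro i
    refine ContMDiffOn.smul_section_of_tsupport (ψ.contMDiff.contMDiffOn) e.open_baseSet hψ ?_
    rw [e.contMDiffOn_section_baseSet_iff]
    refine (contMDiffOn_const (c := b i)).congr fun y hy => ?_
    rw [e.apply_mk_symm hy]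
  -- frame and dual frame each carry one factor of the bump function, hence the square
  refine ⟨Fin (Module.finrank ℝ F), inferInstance,
    ⟨fun x => ψ x * ψ x, ψ.contMDiff.mul ψ.contMDiff⟩,
    fun i => ⟨_, hs i⟩, fun i x => ψ x • (b.coord i ∘ₗ e.linearMapAt ℝ x), ?_, ?_, ?_⟩
  · filter_upwards [ψ.eventuallyEq_one] with x hx
    change ψ x * ψ x = 1
    rw [hx]
    simp
  · intro i
    refine contMDiff_of_tsupport fun z hz => ?_
    have hz1 : z.1 ∈ e.baseSet := by
      refine hψ ?_
      have h1 : IsClosed ((TotalSpace.proj : TotalSpace F A → M) ⁻¹' tsupport ψ) :=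
        (isClosed_tsupport ψ).preimage (FiberBundle.continuous_proj F A)
      refine closure_minimal (X := TotalSpace F A) (fun z hz => ?_) h1 hz
      refine subset_closure ?_
      intro h0
      apply hz
      change ψ z.1 * _ = 0
      rw [h0, zero_mul]
    have h1 : ContMDiffAt (I.prod 𝓘(ℝ, F)) 𝓘(ℝ, F) ∞ (fun z : TotalSpace F A => (e z).2) z :=
      ((e.contMDiffAt_iff (f := id) (by simpa [e.mem_source] using hz1)).1 contMDiffAt_id).2
    have h2 : ContMDiffAt (I.prod 𝓘(ℝ, F)) 𝓘(ℝ, ℝ) ∞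
        (fun z : TotalSpace F A => ψ z.1 * (b.coord i).toContinuousLinearMap (e z).2) z :=
      (ψ.contMDiff.contMDiffAt.comp z (Bundle.contMDiffAt_proj A)).mul
        ((b.coord i).toContinuousLinearMap.contMDiff.contMDiffAt.comp z h1)
    refine h2.congr_of_eventuallyEq ?_
    filter_upwards [(e.open_baseSet.preimage (FiberBundle.continuous_proj F A)).mem_nhds hz1]
      with y hy
    change ψ y.1 * b.coord i (e.linearMapAt ℝ y.1 y.2) = _
    rw [e.coe_linearMapAt_of_mem hy]
    rfl
  · intro x v
    change (ψ x * ψ x) • v = ∑ i, (ψ x * b.coord i (e.linearMapAt ℝ x v)) • (ψ x • e.symm x (b i))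
    by_cases hx : x ∈ e.baseSet
    · have h1 : ∑ i, b.coord i (e.linearMapAt ℝ x v) • e.symm x (b i) = v := by
        have h2 := congrArg (e.symmₗ ℝ x) (b.sum_repr (e.linearMapAt ℝ x v))
        rw [map_sum, e.symmₗ_linearMapAt hx] at h2
        refine Eq.trans (Finset.sum_congr rfl fun i _ => ?_) h2
        rw [map_smul, Trivialization.coe_symmₗ _ hx]
        rfl
      conv_lhs => rw [← h1, Finset.smul_sum]
      refine Finset.sum_congr rfl fun i _ => ?_
      rw [smul_smul, smul_smul]
      ring_nf
    · have h0 : ψ x = 0 := image_eq_zero_of_notMem_tsupport fun h => hx (hψ h)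
      simp [h0]

/-- The function `c(s)` for a smooth family `c` of linear forms and a section `s`. -/
def formEval {c : ∀ x, A x →ₗ[ℝ] ℝ}
    (hc : ContMDiff (I.prod 𝓘(ℝ, F)) 𝓘(ℝ, ℝ) ∞ fun z : TotalSpace F A => c z.1 z.2)
    (s : Cₛ^∞⟮I; F, A⟯) : SFun I M := ⟨fun x => c x (s x), hc.comp s.contMDiff⟩

theorem sum_section_apply {ι : Type*} (t : Finset ι) (s : ι → Cₛ^∞⟮I; F, A⟯) (x : M) :
    (∑ i ∈ t, s i) x = ∑ i ∈ t, s i x :=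
  map_sum ((Pi.evalAddMonoidHom _ x).comp (ContMDiffSection.coeAddHom I F ∞ A)) _ _

variable [ContMDiffVectorBundle ∞ F A I] [T2Space M]

variable (I F) in
/-- Every vector extends to a global smooth section. -/
theorem exists_section_eq {x₀ : M} (a : A x₀) : ∃ s : Cₛ^∞⟮I; F, A⟯, s x₀ = a := by
  obtain ⟨ι, _, ρ, s, c, hρ, -, h⟩ := exists_frame (I := I) (F := F) (A := A) x₀
  refine ⟨∑ i, c i x₀ a • s i, ?_⟩
  have h1 := h x₀ a
  rw [hρ.self_of_nhds, one_smul] at h1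
  rw [sum_section_apply]
  exact h1.symm

/-- A functional on sections that is linear over functions evaluated at `x₀` descends to the fibre
over `x₀`. -/
theorem exists_tensor {V : Type*} [AddCommGroup V] [Module ℝ V] {x₀ : M}
    (φ : Cₛ^∞⟮I; F, A⟯ → V) (hadd : ∀ s t, φ (s + t) = φ s + φ t)
    (hsmul : ∀ (f : SFun I M) s, φ (fsmul f s) = f x₀ • φ s) :
    ∃ L : A x₀ →ₗ[ℝ] V, ∀ s, φ s = L (s x₀) := by
  obtain ⟨ι, _, ρ, s, c, hρ, hc, h⟩ := exists_frame (I := I) (F := F) (A := A) x₀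
  refine ⟨∑ i, (c i x₀).smulRight (φ (s i)), fun t => ?_⟩
  have h1 : fsmul ρ t = ∑ i, fsmul (formEval (hc i) t) (s i) := by
    ext x
    refine (h x (t x)).trans ?_
    rw [sum_section_apply]
    rfl
  have h2 : φ t = φ (fsmul ρ t) := by rw [hsmul, hρ.self_of_nhds, one_smul]
  let φ' : Cₛ^∞⟮I; F, A⟯ →+ V := AddMonoidHom.mk' φ hadd
  have h3 : φ (∑ i, fsmul (formEval (hc i) t) (s i)) =
      ∑ i, φ (fsmul (formEval (hc i) t) (s i)) := map_sum φ' _ _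
  rw [h2, h1, h3, LinearMap.sum_apply]
  refine Finset.sum_congr rfl fun i _ => ?_
  rw [hsmul]
  rfl

end Frames

/-- Two-variable version of `exists_tensor`, over points of two manifolds. -/
theorem exists_tensor₂ [T2Space M] [T2Space B]
    {F : Type*} [NormedAddCommGroup F] [NormedSpace ℝ F] [FiniteDimensional ℝ F]
    {A : M → Type*}
    [TopologicalSpace (TotalSpace F A)] [∀ x, TopologicalSpace (A x)] [FiberBundle F A]
    [∀ x, AddCommGroup (A x)] [∀ x, Module ℝ (A x)] [VectorBundle ℝ F A]
    [ContMDiffVectorBundle ∞ F A I]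
    {F' : Type*} [NormedAddCommGroup F'] [NormedSpace ℝ F'] [FiniteDimensional ℝ F']
    {A' : B → Type*}
    [TopologicalSpace (TotalSpace F' A')] [∀ x, TopologicalSpace (A' x)] [FiberBundle F' A']
    [∀ x, AddCommGroup (A' x)] [∀ x, Module ℝ (A' x)] [VectorBundle ℝ F' A']
    [ContMDiffVectorBundle ∞ F' A' I'] {x₀ : M} {y₀ : B}
    {V : Type*} [AddCommGroup V] [Module ℝ V]
    (φ : Cₛ^∞⟮I; F, A⟯ → Cₛ^∞⟮I'; F', A'⟯ → V)
    (hadd : ∀ s s' t, φ (s + s') t = φ s t + φ s' t)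
    (hsmul : ∀ (f : SFun I M) s t, φ (fsmul f s) t = f x₀ • φ s t)
    (hadd' : ∀ s t t', φ s (t + t') = φ s t + φ s t')
    (hsmul' : ∀ (f : SFun I' B) s t, φ s (fsmul f t) = f y₀ • φ s t) :
    ∃ L : A x₀ →ₗ[ℝ] A' y₀ →ₗ[ℝ] V, ∀ s t, φ s t = L (s x₀) (t y₀) := by
  choose L hL using fun s => exists_tensor (φ s) (hadd' s) (fun f t => hsmul' f s t)
  obtain ⟨K, hK⟩ := exists_tensor (x₀ := x₀) L
    (fun s s' => by
      ext a
      obtain ⟨t, rfl⟩ := exists_section_eq I' F' a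
      rw [LinearMap.add_apply, ← hL, ← hL, ← hL, hadd])
    (fun f s => by
      ext a
      obtain ⟨t, rfl⟩ := exists_section_eq I' F' a
      rw [LinearMap.smul_apply, ← hL, ← hL, hsmul])
  exact ⟨K, fun s t => by rw [hL, hK]⟩

/-! ### Separation of tangent vectors by functions -/

theorem exists_mvfderiv_ne_zero [T2Space M] {x : M} {v : TangentSpace I x} (hv : v ≠ 0) :
    ∃ f : SFun I M, mvfderiv I f x v ≠ 0 := by
  obtain ⟨A, hA⟩ := isInvertible_mfderiv_extChartAt (I := I) (mem_extChartAt_source (I := I) x)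
  have hAv : A v ≠ A 0 := fun h => hv (A.injective h)
  obtain ⟨l, hl⟩ := SeparatingDual.exists_separating_of_ne (R := ℝ) (V := E) hAv
  obtain ⟨ψ⟩ : Nonempty (SmoothBumpFunction I x) := inferInstance
  have hg : ContMDiffOn I 𝓘(ℝ, ℝ) ∞ (l ∘ extChartAt I x) (chartAt H x).source :=
    l.contMDiff.comp_contMDiffOn contMDiffOn_extChartAt
  refine ⟨⟨_, ψ.contMDiff_smul hg⟩, ?_⟩
  have h1 : (fun y => ψ y • (l ∘ extChartAt I x) y) =ᶠ[𝓝 x] l ∘ extChartAt I x := by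
    filter_upwards [ψ.eventuallyEq_one] with y hy
    rw [hy]
    simp
  have h2 : mvfderiv I (fun y => ψ y • (l ∘ extChartAt I x) y) x v
      = mvfderiv I (l ∘ extChartAt I x) x v := DFunLike.congr_fun h1.mfderiv_eq v
  have h3 := mvfderiv_comp_apply (I := 𝓘(ℝ, E)) (I' := I) (g := l) x
      (l.differentiableAt.mdifferentiableAt)
      ((contMDiffAt_extChartAt (n := 1)).mdifferentiableAt one_ne_zero) v
  change mvfderiv I (fun y => ψ y • (l ∘ extChartAt I x) y) x v ≠ 0
  rw [h2, h3, ← hA]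
  intro h0
  apply hl
  rw [map_zero]
  simp [mvfderiv] at h0
  exact h0.trans (map_zero l).symm

theorem eq_of_lieD_eq [T2Space M] {X Y : VField I M} (h : ∀ f, lieD X f = lieD Y f) : X = Y := by
  ext x
  by_contra hne
  obtain ⟨f, hf⟩ := exists_mvfderiv_ne_zero (I := I) (sub_ne_zero.2 hne)
  apply hf
  have h1 := congrArg (fun g : SFun I M => g x) (h f)
  rw [map_sub]
  exact sub_eq_zero.2 h1

section HorizontalVertical

variable {p : C^∞⟮I, M; I', B⟯}

/-! ### Horizontal and vertical parts -/

/-- Near `x₀`, the differential of `p` is a combination of vector fields on `B` whose coefficients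
are one-forms on `M`. -/
theorem exists_mfderiv_eq_sum [T2Space B] (p : C^∞⟮I, M; I', B⟯) (x₀ : M) :
    ∃ (ι : Type) (_ : Fintype ι) (u : ι → VField I' B) (d : ι → Form1 I M),
      ∀ᶠ x in 𝓝 x₀, ∀ v : TangentSpace I x,
        mfderiv I I' p x v = ∑ i, (d i).1 x v • u i (p x) := by
  obtain ⟨ι, _, ρ, u, c, hρ, hc, h⟩ :=
    exists_frame (I := I') (F := E') (A := (TangentSpace I' : B → Type _)) (p x₀)
  refine ⟨ι, inferInstance, u, fun i => ⟨fun x => (c i (p x)).comp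
    (mfderiv I I' p x : TangentSpace I x →ₗ[ℝ] TangentSpace I' (p x)), fun X => ?_⟩, ?_⟩
  · have h1 : ContMDiff I.tangent I'.tangent ∞ (tangentMap I I' p) :=
      p.contMDiff.contMDiff_tangentMap (by simp)
    exact (hc i).comp (h1.comp X.contMDiff)
  · filter_upwards [p.contMDiff.continuous.continuousAt.eventually hρ] with x hx v
    have h1 := h (p x) (mfderiv I I' p x v)
    rw [hx, one_smul] at h1
    exact h1

/-- A family of linear maps on the tangent spaces of `B` that is smooth on vector fields of `B` is
smooth on the images under `dp` of vector fields of `M`, although these need not be projectable. -/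
theorem contMDiff_comp_mfderiv [T2Space B] {F : Type*} [NormedAddCommGroup F] [NormedSpace ℝ F]
    {A : M → Type*} [TopologicalSpace (TotalSpace F A)] [∀ x, TopologicalSpace (A x)]
    [FiberBundle F A] [∀ x, AddCommGroup (A x)] [∀ x, Module ℝ (A x)] [VectorBundle ℝ F A]
    (κ : ∀ x, TangentSpace I' (p x) →ₗ[ℝ] A x)
    (hκ : ∀ u : VField I' B, ContMDiff I (I.prod 𝓘(ℝ, F)) ∞
      fun x => (TotalSpace.mk' F x (κ x (u (p x))) : TotalSpace F A)) (X : VField I M) :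
    ContMDiff I (I.prod 𝓘(ℝ, F)) ∞
      fun x => (TotalSpace.mk' F x (κ x (mfderiv I I' p x (X x))) : TotalSpace F A) := by
  intro x₀
  obtain ⟨ι, _, u, d, hd⟩ := exists_mfderiv_eq_sum p x₀
  have h1 : ContMDiffAt I (I.prod 𝓘(ℝ, F)) ∞ (fun x => TotalSpace.mk' F x
      (∑ i, (d i).1 x (X x) • κ x (u i (p x)) : A x)) x₀ :=
    ContMDiffAt.sum_section fun i _ =>
      ((d i).2 X).contMDiffAt.smul_section (hκ (u i)).contMDiffAt
  refine h1.congr_of_eventuallyEq ?_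
  filter_upwards [hd] with x hx
  rw [hx, map_sum]
  simp only [map_smul]

/-- The horizontal part of a vector field. -/
def hor [T2Space B] (h : EhresmannConnection p) (X : VField I M) : VField I M :=
  ⟨fun x => h.lift x (mfderiv I I' p x (X x)), contMDiff_comp_mfderiv h.lift h.contMDiff_lift X⟩

/-- The vertical projection of the tangent space at a point along the horizontal space. -/
def verProj (h : EhresmannConnection p) (x : M) : TangentSpace I x →ₗ[ℝ] vert p x :=
  LinearMap.codRestrict (vert p x)
    (LinearMap.id - (h.lift x).comp
      (mfderiv I I' p x : TangentSpace I x →ₗ[ℝ] TangentSpace I' (p x))) fun v => by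
    change mfderiv I I' p x (v - h.lift x (mfderiv I I' p x v)) = 0
    rw [map_sub, h.mfderiv_lift, sub_self]

theorem coe_verProj (h : EhresmannConnection p) (x : M) (v : TangentSpace I x) :
    (verProj h x v : TangentSpace I x) = v - h.lift x (mfderiv I I' p x v) := rfl

theorem verProj_add_lift (h : EhresmannConnection p) (x : M) (v : TangentSpace I x) :
    (verProj h x v : TangentSpace I x) + h.lift x (mfderiv I I' p x v) = v := by
  rw [coe_verProj, sub_add_cancel]

theorem verProj_vert (h : EhresmannConnection p) (x : M) (v : vert p x) :
    verProj h x (v : TangentSpace I x) = v := by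
  apply Subtype.ext
  have hv : mfderiv I I' p x (v : TangentSpace I x) = 0 := v.2
  rw [coe_verProj, hv, map_zero, sub_zero]

theorem verProj_lift (h : EhresmannConnection p) (x : M) (w : TangentSpace I' (p x)) :
    verProj h x (h.lift x w) = 0 := by
  apply Subtype.ext
  rw [coe_verProj, h.mfderiv_lift, sub_self]
  rfl

/-- The vertical part of a vector field. -/
def ver [T2Space B] (h : EhresmannConnection p) (X : VField I M) : VSec p :=
  ⟨X - hor h X, fun x => (verProj h x (X x)).2⟩

theorem ver_add [T2Space B] (h : EhresmannConnection p) (X Y : VField I M) :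
    ver h (X + Y) = ver h X + ver h Y := by
  apply Subtype.ext
  ext x
  exact congrArg Subtype.val (map_add (verProj h x) (X x) (Y x))

theorem ver_fsmul [T2Space B] (h : EhresmannConnection p) (f : SFun I M) (X : VField I M) :
    ver h (fsmul f X) = vfsmul f (ver h X) := by
  apply Subtype.ext
  ext x
  exact congrArg Subtype.val (map_smul (verProj h x) (f x) (X x))

theorem ver_vertical [T2Space B] (h : EhresmannConnection p) (Y : VSec p) : ver h Y.1 = Y := by
  apply Subtype.ext
  ext x
  exact congrArg Subtype.val (verProj_vert h x (vat Y x))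

/-- At each point, a vector field agrees with the sum of its vertical part and the horizontal lift
of a vector field on `B`. -/
theorem exists_ver_add_hlift [T2Space B] (h : EhresmannConnection p) (X : VField I M) (x : M) :
    ∃ u : VField I' B, ((ver h X).1 + hlift h u) x = X x := by
  obtain ⟨u, hu⟩ := exists_section_eq I' E' (mfderiv I I' p x (X x))
  refine ⟨u, ?_⟩
  change (verProj h x (X x) : TangentSpace I x) + h.lift x (u (p x)) = X x
  rw [hu, verProj_add_lift]

/-! ### Tensoriality of the differential of two-forms -/

theorem lieB_add_left (X Y Z : VField I M) : lieB (X + Y) Z = lieB X Z + lieB Y Z := by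
  rw [lieB_skew, lieB_add, neg_add, ← lieB_skew, ← lieB_skew]

theorem lieB_fsmul_left (f : SFun I M) (X Y : VField I M) :
    lieB (fsmul f X) Y = fsmul f (lieB X Y) - fsmul (lieD Y f) X := by
  rw [lieB_skew, lieB_fsmul, lieB_skew Y X]
  ext x
  change -(f x • -(lieB X Y x) + lieD Y f x • X x) = f x • lieB X Y x - lieD Y f x • X x
  rw [smul_neg]
  abel

theorem ev2_add_left (θ : Form2 I M) (X Y Z : VField I M) :
    ev2 θ (X + Y) Z = ev2 θ X Z + ev2 θ Y Z := by
  rw [ev2_swap, ev2_add_right, neg_add, ← ev2_swap, ← ev2_swap]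

theorem ev2_sub_left (θ : Form2 I M) (X Y Z : VField I M) :
    ev2 θ (X - Y) Z = ev2 θ X Z - ev2 θ Y Z := by
  rw [sub_eq_add_neg, ev2_add_left, ev2_swap θ (-Y), ev2_neg_right, ← ev2_swap, ← sub_eq_add_neg]

theorem ev2_sub_right (θ : Form2 I M) (X Y Z : VField I M) :
    ev2 θ X (Y - Z) = ev2 θ X Y - ev2 θ X Z := by
  rw [sub_eq_add_neg, ev2_add_right, ev2_neg_right, ← sub_eq_add_neg]

theorem ev2_fsmul_left (θ : Form2 I M) (f : SFun I M) (X Y : VField I M) :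
    ev2 θ (fsmul f X) Y = f * ev2 θ X Y := by
  rw [ev2_swap, ev2_fsmul_right, ev2_swap θ X, mul_neg]

theorem d2_cycle (θ : Form2 I M) (X Y Z : VField I M) : d2 θ X Y Z = d2 θ Y Z X := by
  simp only [d2]
  abel

theorem d2_add_first (θ : Form2 I M) (X X' Y Z : VField I M) :
    d2 θ (X + X') Y Z = d2 θ X Y Z + d2 θ X' Y Z := by
  simp only [d2, lieD_add_left, lieB_add_left, lieB_add, ev2_add_left, ev2_add_right, lieD_add]
  abel

theorem d2_fsmul_first (θ : Form2 I M) (f : SFun I M) (X Y Z : VField I M) :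
    d2 θ (fsmul f X) Y Z = f * d2 θ X Y Z := by
  simp only [d2, lieD_fsmul_left, lieB_fsmul_left, lieB_fsmul, ev2_fsmul_left, ev2_fsmul_right,
    ev2_add_left, ev2_sub_left, lieD_mul]
  rw [ev2_swap θ X Z]
  ring

theorem d2_congr_first [T2Space M] (θ : Form2 I M) {X X' : VField I M} (Y Z : VField I M) {x : M}
    (hX : X x = X' x) : d2 θ X Y Z x = d2 θ X' Y Z x := by
  obtain ⟨L, hL⟩ := exists_tensor (x₀ := x) (fun W : VField I M => d2 θ W Y Z x)
    (fun s t => by rw [d2_add_first]; rfl) (fun f s => by rw [d2_fsmul_first]; rfl)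
  rw [hL, hL, hX]

/-- The value of `dθ` on three vector fields at a point depends only on their values there. -/
theorem d2_congr [T2Space M] (θ : Form2 I M) {X X' Y Y' Z Z' : VField I M} {x : M}
    (hX : X x = X' x) (hY : Y x = Y' x) (hZ : Z x = Z' x) :
    d2 θ X Y Z x = d2 θ X' Y' Z' x := by
  rw [d2_congr_first θ Y Z hX, d2_cycle, d2_congr_first θ Z X' hY, d2_cycle,
    d2_congr_first θ X' Y' hZ, d2_cycle]

/-! ### The closedness equations -/

/-- The left-hand side of the second closedness equation is the value of `dθ` on a horizontal lift
and two vertical fields. The next two lemmas treat the other types of triples. -/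
theorem dH02_add_dV11_eq (h : EhresmannConnection p) (θ : Form2 I M) (u : VField I' B)
    (Y Z : VSec p) : dH02 h (restrict2 p θ) u Y Z + dV11 (alphaH h θ) u Y Z
      = d2 θ (hlift h u) Y.1 Z.1 := by
  change lieD (hlift h u) (ev2 θ Y.1 Z.1) - ev2 θ (lieB (hlift h u) Y.1) Z.1
      - ev2 θ Y.1 (lieB (hlift h u) Z.1)
      + -(lieD Y.1 (ev2 θ (hlift h u) Z.1) - lieD Z.1 (ev2 θ (hlift h u) Y.1)
        - ev2 θ (hlift h u) (lieB Y.1 Z.1)) = _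
  rw [d2, ev2_swap θ Z.1 (hlift h u), lieD_neg, ev2_swap θ (lieB Y.1 Z.1),
    lieB_skew Z.1 (hlift h u), ev2_swap θ (-_) Y.1, ev2_neg_right]
  abel

theorem dC02_add_dH11_add_dV20_eq (h : EhresmannConnection p) (θ : Form2 I M) (u v : VField I' B)
    (Y : VSec p) : dC02 h (restrict2 p θ) u v Y + dH11 h (alphaH h θ) u v Y
      + dV20 (omegaH h θ) u v Y = d2 θ (hlift h u) (hlift h v) Y.1 := by
  change -ev2 θ (lieB (hlift h u) (hlift h v) - hlift h (lieB u v)) Y.1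
      + ((lieD (hlift h u) (ev2 θ (hlift h v) Y.1) - ev2 θ (hlift h v) (lieB (hlift h u) Y.1))
        - (lieD (hlift h v) (ev2 θ (hlift h u) Y.1) - ev2 θ (hlift h u) (lieB (hlift h v) Y.1))
        - ev2 θ (hlift h (lieB u v)) Y.1)
      + lieD Y.1 (ev2 θ (hlift h u) (hlift h v)) = _
  rw [d2, ev2_sub_left, ev2_swap θ Y.1 (hlift h u), lieD_neg, ev2_swap θ (lieB (hlift h v) Y.1),
    lieB_skew Y.1 (hlift h u), ev2_swap θ (-_) (hlift h v), ev2_neg_right]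
  abel

theorem dC11_add_dH20_eq (h : EhresmannConnection p) (θ : Form2 I M) (u v w : VField I' B) :
    dC11 h (alphaH h θ) u v w + dH20 h (omegaH h θ) u v w
      = d2 θ (hlift h u) (hlift h v) (hlift h w) := by
  change (ev2 θ (hlift h u) (lieB (hlift h v) (hlift h w) - hlift h (lieB v w))
      + ev2 θ (hlift h v) (lieB (hlift h w) (hlift h u) - hlift h (lieB w u))
      + ev2 θ (hlift h w) (lieB (hlift h u) (hlift h v) - hlift h (lieB u v)))
    + ((lieD (hlift h u) (ev2 θ (hlift h v) (hlift h w)) - ev2 θ (hlift h (lieB u v)) (hlift h w))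
      + (lieD (hlift h v) (ev2 θ (hlift h w) (hlift h u)) - ev2 θ (hlift h (lieB v w)) (hlift h u))
      + (lieD (hlift h w) (ev2 θ (hlift h u) (hlift h v))
        - ev2 θ (hlift h (lieB w u)) (hlift h v))) = _
  simp only [d2, ev2_sub_right]
  rw [ev2_swap θ (hlift h (lieB u v)), ev2_swap θ (hlift h (lieB v w)),
    ev2_swap θ (hlift h (lieB w u)), ev2_swap θ (lieB _ _) (hlift h w),
    ev2_swap θ (lieB _ _) (hlift h u), ev2_swap θ (lieB _ _) (hlift h v)]
  abel

/-- A two-form is closed if and only if its differential vanishes on all combinations of vertical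
fields and horizontal lifts, because these span the tangent spaces. -/
theorem mem_closed2_iff [T2Space M] [T2Space B] (h : EhresmannConnection p) (θ : Form2 I M) :
    θ ∈ Closed2 I M ↔ ClosedEq1 p θ ∧ ClosedEq2 h θ ∧ ClosedEq3 h θ ∧ ClosedEq4 h θ := by
  constructor
  · intro hθ
    exact ⟨fun Y Z W => hθ Y.1 Z.1 W.1,
      fun u Y Z => (dH02_add_dV11_eq h θ u Y Z).trans (hθ _ _ _),
      fun u v Y => (dC02_add_dH11_add_dV20_eq h θ u v Y).trans (hθ _ _ _),
      fun u v w => (dC11_add_dH20_eq h θ u v w).trans (hθ _ _ _)⟩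
  · rintro ⟨h1, h2, h3, h4⟩ X Y Z
    ext x
    obtain ⟨u, hu⟩ := exists_ver_add_hlift h X x
    obtain ⟨v, hv⟩ := exists_ver_add_hlift h Y x
    obtain ⟨w, hw⟩ := exists_ver_add_hlift h Z x
    have e1 : ∀ Y Z W : VSec p, d2 θ Y.1 Z.1 W.1 = 0 := h1
    have e2 : ∀ u (Y Z : VSec p), d2 θ (hlift h u) Y.1 Z.1 = 0 :=
      fun u Y Z => (dH02_add_dV11_eq h θ u Y Z).symm.trans (h2 u Y Z)
    have e3 : ∀ u v (Y : VSec p), d2 θ (hlift h u) (hlift h v) Y.1 = 0 :=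
      fun u v Y => (dC02_add_dH11_add_dV20_eq h θ u v Y).symm.trans (h3 u v Y)
    have e4 : ∀ u v w, d2 θ (hlift h u) (hlift h v) (hlift h w) = 0 :=
      fun u v w => (dC11_add_dH20_eq h θ u v w).symm.trans (h4 u v w)
    rw [d2_congr θ hu.symm hv.symm hw.symm]
    have e : d2 θ ((ver h X).1 + hlift h u) ((ver h Y).1 + hlift h v)
        ((ver h Z).1 + hlift h w) = 0 := by
      have a2 : ∀ X Y Y' Z, d2 θ X (Y + Y') Z = d2 θ X Y Z + d2 θ X Y' Z := fun X Y Y' Z => by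
        rw [d2_cycle, d2_add_first, ← d2_cycle θ X, ← d2_cycle θ X]
      have a3 : ∀ X Y Z Z', d2 θ X Y (Z + Z') = d2 θ X Y Z + d2 θ X Y Z' := fun X Y Z Z' => by
        rw [d2_cycle, a2, ← d2_cycle θ X, ← d2_cycle θ X]
      -- of the eight terms, those with a vertical field first are brought to the form of `e2` or
      -- `e3` by cyclic permutation
      rw [d2_add_first, a2, a2, a3, a3, a3, a3, e1, e2, e3, e4, d2_cycle θ (ver h X).1 (ver h Y).1,
        d2_cycle θ (ver h Y).1, e2, d2_cycle θ (ver h X).1, e2, d2_cycle θ (ver h X).1, e3,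
        d2_cycle θ (hlift h u) (ver h Y).1, d2_cycle θ (ver h Y).1, e3]
      simp
    rw [e]

end HorizontalVertical

/-! ### Symmetries and the structure equations of a two-form -/

section StructureEquations

variable {p : C^∞⟮I, M; I', B⟯}

theorem lieB_neg (X Y : VField I M) : lieB X (-Y) = -lieB X Y := by
  have h := lieB_add X Y (-Y)
  rw [add_neg_cancel, lieB_zero_right] at h
  exact (neg_eq_of_add_eq_zero_right h.symm).symm

theorem lieB_sub (X Y Z : VField I M) : lieB X (Y - Z) = lieB X Y - lieB X Z := by
  rw [sub_eq_add_neg, lieB_add, lieB_neg, ← sub_eq_add_neg]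

theorem lieB_sub_left (X Y Z : VField I M) : lieB (X - Y) Z = lieB X Z - lieB Y Z := by
  rw [lieB_skew, lieB_sub, neg_sub, lieB_skew Y Z, lieB_skew X Z]
  abel

theorem lieD_sub_left (X Y : VField I M) (f : SFun I M) :
    lieD (X - Y) f = lieD X f - lieD Y f := by
  have h := lieD_add_left (X - Y) Y f
  rw [sub_add_cancel] at h
  rw [h, add_sub_cancel_right]

theorem lieD_one (X : VField I M) : lieD X (1 : SFun I M) = 0 := by
  have h := lieD_mul X (1 : SFun I M) 1
  rw [one_mul, one_mul, mul_one] at h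
  exact left_eq_add.1 h

theorem hlift_add (h : EhresmannConnection p) (u v : VField I' B) :
    hlift h (u + v) = hlift h u + hlift h v :=
  ContMDiffSection.ext fun x => map_add (h.lift x) (u (p x)) (v (p x))

theorem hlift_fsmul (h : EhresmannConnection p) (f : SFun I' B) (u : VField I' B) :
    hlift h (fsmul f u) = fsmul (f.comp p) (hlift h u) :=
  ContMDiffSection.ext fun x => map_smul (h.lift x) (f (p x)) (u (p x))

theorem brH_add (h : EhresmannConnection p) (u : VField I' B) (Y Z : VSec p) :
    brH h u (Y + Z) = brH h u Y + brH h u Z :=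
  Subtype.ext (lieB_add (hlift h u) Y.1 Z.1)

theorem brH_vfsmul (h : EhresmannConnection p) (u : VField I' B) (f : SFun I M) (Y : VSec p) :
    brH h u (vfsmul f Y) = vfsmul f (brH h u Y) + vfsmul (lieD (hlift h u) f) Y :=
  Subtype.ext (lieB_fsmul (hlift h u) Y.1 f)

theorem brH_vbr (h : EhresmannConnection p) (u : VField I' B) (Y Z : VSec p) :
    brH h u (vbr Y Z) = vbr (brH h u Y) Z + vbr Y (brH h u Z) :=
  Subtype.ext (lieB_jacobi (hlift h u) Y.1 Z.1)

/-- The curvature of the connection acts on vertical fields as the commutator of horizontal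
lifts. -/
theorem brH_commutator (h : EhresmannConnection p) (u v : VField I' B) (Y : VSec p) :
    brH h u (brH h v Y) - brH h v (brH h u Y) - brH h (lieB u v) Y = vbr (curv h u v) Y := by
  apply Subtype.ext
  change lieB (hlift h u) (lieB (hlift h v) Y.1) - lieB (hlift h v) (lieB (hlift h u) Y.1)
    - lieB (hlift h (lieB u v)) Y.1
      = lieB (lieB (hlift h u) (hlift h v) - hlift h (lieB u v)) Y.1
  rw [lieB_sub_left, lieB_jacobi (hlift h u)]
  abel

/-- The Bianchi identity of the curvature of the connection. -/
theorem curv_bianchi (h : EhresmannConnection p) (u v t : VField I' B) :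
    (brH h u (curv h v t) - curv h (lieB u v) t) + (brH h v (curv h t u) - curv h (lieB v t) u)
      + (brH h t (curv h u v) - curv h (lieB t u) v) = 0 := by
  have hj : lieB (lieB u v) t + lieB (lieB v t) u + lieB (lieB t u) v = 0 := by
    rw [lieB_skew (lieB v t) u, lieB_jacobi u v t, lieB_skew (lieB t u) v, lieB_skew t u, lieB_neg]
    abel
  have hh : hlift h (lieB (lieB u v) t) + hlift h (lieB (lieB v t) u)
      + hlift h (lieB (lieB t u) v) = 0 := by
    ext x
    change h.lift x (lieB (lieB u v) t (p x)) + h.lift x (lieB (lieB v t) u (p x))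
      + h.lift x (lieB (lieB t u) v (p x)) = 0
    rw [← map_add, ← map_add]
    have := congrArg (fun X : VField I' B => X (p x)) hj
    exact (congrArg (h.lift x) this).trans (map_zero _)
  have hj' : lieB (hlift h u) (lieB (hlift h v) (hlift h t))
      + lieB (hlift h v) (lieB (hlift h t) (hlift h u))
      + lieB (hlift h t) (lieB (hlift h u) (hlift h v)) = 0 := by
    rw [lieB_jacobi (hlift h u), lieB_skew (hlift h t) (hlift h u), lieB_neg,
      lieB_skew (hlift h t) (lieB _ _)]
    abel
  apply Subtype.ext
  change (lieB (hlift h u) (lieB (hlift h v) (hlift h t) - hlift h (lieB v t))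
      - (lieB (hlift h (lieB u v)) (hlift h t) - hlift h (lieB (lieB u v) t)))
    + (lieB (hlift h v) (lieB (hlift h t) (hlift h u) - hlift h (lieB t u))
      - (lieB (hlift h (lieB v t)) (hlift h u) - hlift h (lieB (lieB v t) u)))
    + (lieB (hlift h t) (lieB (hlift h u) (hlift h v) - hlift h (lieB u v))
      - (lieB (hlift h (lieB t u)) (hlift h v) - hlift h (lieB (lieB t u) v))) = 0
  rw [lieB_sub, lieB_sub, lieB_sub, lieB_skew (hlift h (lieB u v)), lieB_skew (hlift h (lieB v t)),
    lieB_skew (hlift h (lieB t u))]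
  rw [← sub_eq_zero] at hh hj'
  rw [← sub_eq_zero, ← add_zero (0 : VField I M)]
  -- the sum of the two Jacobi identities `hj'` and `hh` is the claim up to bilinearity
  nth_rewrite 2 [← hh]
  nth_rewrite 1 [← hj']
  abel

theorem formD_bracket_fst (h : EhresmannConnection p) (θ : Form2 I M) (u : VField I' B)
    (a b : ASec p) : (formD h θ u (avBracket (restrict2 p θ) a b)).1
      = (avBracket (restrict2 p θ) (formD h θ u a) b
          + avBracket (restrict2 p θ) a (formD h θ u b)).1 :=
  brH_vbr h u a.1 b.1

/-- The defect of the derivation property of `D_u` lies in the function component and is a value of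
`dθ`. -/
theorem formD_bracket_snd (h : EhresmannConnection p) (θ : Form2 I M) (u : VField I' B)
    (a b : ASec p) : (formD h θ u (avBracket (restrict2 p θ) a b)).2
      - (avBracket (restrict2 p θ) (formD h θ u a) b
          + avBracket (restrict2 p θ) a (formD h θ u b)).2
      = d2 θ (hlift h u) a.1.1 b.1.1 := by
  obtain ⟨Y, f⟩ := a
  obtain ⟨Z, g⟩ := b
  rw [← dH02_add_dV11_eq]
  change (lieD (hlift h u) (lieD Y.1 g - lieD Z.1 f + ev2 θ Y.1 Z.1)
      + ev2 θ (hlift h u) (lieB Y.1 Z.1))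
    - ((lieD (lieB (hlift h u) Y.1) g - lieD Z.1 (lieD (hlift h u) f + ev2 θ (hlift h u) Y.1)
        + ev2 θ (lieB (hlift h u) Y.1) Z.1)
      + (lieD Y.1 (lieD (hlift h u) g + ev2 θ (hlift h u) Z.1) - lieD (lieB (hlift h u) Z.1) f
        + ev2 θ Y.1 (lieB (hlift h u) Z.1)))
    = lieD (hlift h u) (ev2 θ Y.1 Z.1) - ev2 θ (lieB (hlift h u) Y.1) Z.1
      - ev2 θ Y.1 (lieB (hlift h u) Z.1)
      + -(lieD Y.1 (ev2 θ (hlift h u) Z.1) - lieD Z.1 (ev2 θ (hlift h u) Y.1)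
        - ev2 θ (hlift h u) (lieB Y.1 Z.1))
  simp only [lieD_add, lieD_sub, lieD_lieB]
  abel

theorem formD_add (h : EhresmannConnection p) (θ : Form2 I M) (u : VField I' B) (a b : ASec p) :
    formD h θ u (a + b) = formD h θ u a + formD h θ u b := by
  refine Prod.ext (brH_add h u a.1 b.1) ?_
  change lieD (hlift h u) (a.2 + b.2) + ev2 θ (hlift h u) (a.1.1 + b.1.1)
    = (lieD (hlift h u) a.2 + ev2 θ (hlift h u) a.1.1)
      + (lieD (hlift h u) b.2 + ev2 θ (hlift h u) b.1.1)
  rw [lieD_add, ev2_add_right]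
  abel

theorem formD_asmul (h : EhresmannConnection p) (θ : Form2 I M) (u : VField I' B) (f : SFun I M)
    (a : ASec p) :
    formD h θ u (asmul f a) = asmul f (formD h θ u a) + asmul (lieD (hlift h u) f) a := by
  refine Prod.ext (brH_vfsmul h u f a.1) ?_
  change lieD (hlift h u) (f * a.2) + ev2 θ (hlift h u) (fsmul f a.1.1)
    = f * (lieD (hlift h u) a.2 + ev2 θ (hlift h u) a.1.1) + lieD (hlift h u) f * a.2
  rw [lieD_mul, ev2_fsmul_right]
  ring

theorem formD_zero_right (h : EhresmannConnection p) (θ : Form2 I M) (u : VField I' B)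
    (g : SFun I M) : formD h θ u (0, g) = (0, lieD (hlift h u) g) := by
  refine Prod.ext (Subtype.ext (lieB_zero_right (hlift h u))) ?_
  change lieD (hlift h u) g + ev2 θ (hlift h u) 0 = lieD (hlift h u) g
  have h0 := ev2_sub_right θ (hlift h u) 0 0
  rw [sub_self, sub_self] at h0
  rw [h0, add_zero]

theorem closedEq2_iff (h : EhresmannConnection p) (θ : Form2 I M) :
    ClosedEq2 h θ ↔
      ∀ u : VField I' B, IsSymmetry (restrict2 p θ) (hlift h u) (formD h θ u) := by
  constructor
  · intro h2 u
    refine ⟨formD_add h θ u, formD_asmul h θ u, fun a b => ?_, ?_⟩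
    · refine Prod.ext (formD_bracket_fst h θ u a b) (sub_eq_zero.1 ?_)
      rw [formD_bracket_snd, ← dH02_add_dV11_eq]
      exact h2 u a.1 b.1
    · rw [formD_zero_right, lieD_one]
      rfl
  · intro hs u Y Z
    rw [dH02_add_dV11_eq]
    have h1 := formD_bracket_snd h θ u (Y, 0) (Z, 0)
    rw [(hs u).bracket, sub_self] at h1
    exact h1.symm

theorem formD_commutator_fst (h : EhresmannConnection p) (θ : Form2 I M) (u v : VField I' B)
    (a : ASec p) :
    (formD h θ u (formD h θ v a) - formD h θ v (formD h θ u a) - formD h θ (lieB u v) a).1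
      = (avBracket (restrict2 p θ) (formW h θ u v) a).1 :=
  brH_commutator h u v a.1

/-- The defect of the curvature equation lies in the function component and is a value of `dθ`. -/
theorem formD_commutator_snd (h : EhresmannConnection p) (θ : Form2 I M) (u v : VField I' B)
    (a : ASec p) :
    (formD h θ u (formD h θ v a) - formD h θ v (formD h θ u a) - formD h θ (lieB u v) a).2
      - (avBracket (restrict2 p θ) (formW h θ u v) a).2 = d2 θ (hlift h u) (hlift h v) a.1.1 := by
  obtain ⟨Y, g⟩ := a
  rw [← dC02_add_dH11_add_dV20_eq]
  change ((lieD (hlift h u) (lieD (hlift h v) g + ev2 θ (hlift h v) Y.1)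
        + ev2 θ (hlift h u) (lieB (hlift h v) Y.1))
      - (lieD (hlift h v) (lieD (hlift h u) g + ev2 θ (hlift h u) Y.1)
        + ev2 θ (hlift h v) (lieB (hlift h u) Y.1))
      - (lieD (hlift h (lieB u v)) g + ev2 θ (hlift h (lieB u v)) Y.1))
    - (lieD (lieB (hlift h u) (hlift h v) - hlift h (lieB u v)) g
      - lieD Y.1 (ev2 θ (hlift h u) (hlift h v))
      + ev2 θ (lieB (hlift h u) (hlift h v) - hlift h (lieB u v)) Y.1)
    = -ev2 θ (lieB (hlift h u) (hlift h v) - hlift h (lieB u v)) Y.1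
      + ((lieD (hlift h u) (ev2 θ (hlift h v) Y.1) - ev2 θ (hlift h v) (lieB (hlift h u) Y.1))
        - (lieD (hlift h v) (ev2 θ (hlift h u) Y.1) - ev2 θ (hlift h u) (lieB (hlift h v) Y.1))
        - ev2 θ (hlift h (lieB u v)) Y.1)
      + lieD Y.1 (ev2 θ (hlift h u) (hlift h v))
  simp only [lieD_add, lieD_lieB, lieD_sub_left]
  abel

theorem closedEq3_iff (h : EhresmannConnection p) (θ : Form2 I M) :
    ClosedEq3 h θ ↔ CurvEq (restrict2 p θ) (formD h θ) (formW h θ) := by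
  constructor
  · intro h3 u v a
    refine Prod.ext (formD_commutator_fst h θ u v a) (sub_eq_zero.1 ?_)
    rw [formD_commutator_snd, ← dC02_add_dH11_add_dV20_eq]
    exact h3 u v a.1
  · intro hc u v Y
    have h1 := formD_commutator_snd h θ u v (Y, 0)
    rw [hc, sub_self] at h1
    rw [dC02_add_dH11_add_dV20_eq]
    exact h1.symm

theorem closedEq4_iff (h : EhresmannConnection p) (θ : Form2 I M) :
    ClosedEq4 h θ ↔ BianchiEq (formD h θ) (formW h θ) := by
  have key : ∀ u v t, ((formD h θ u (formW h θ v t) - formW h θ (lieB u v) t)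
      + (formD h θ v (formW h θ t u) - formW h θ (lieB v t) u)
      + (formD h θ t (formW h θ u v) - formW h θ (lieB t u) v)).2
      = dC11 h (alphaH h θ) u v t + dH20 h (omegaH h θ) u v t := by
    intro u v t
    change ((lieD (hlift h u) (omegaH h θ v t) + vev1 (alphaH h θ u) (curv h v t))
        - omegaH h θ (lieB u v) t)
      + ((lieD (hlift h v) (omegaH h θ t u) + vev1 (alphaH h θ v) (curv h t u))
        - omegaH h θ (lieB v t) u)
      + ((lieD (hlift h t) (omegaH h θ u v) + vev1 (alphaH h θ t) (curv h u v))
        - omegaH h θ (lieB t u) v) = _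
    rw [dC11, dH20]
    abel
  constructor
  · intro h4 u v t
    exact Prod.ext (curv_bianchi h u v t) ((key u v t).trans (h4 u v t))
  · intro hb u v t
    rw [← key, hb]
    rfl

end StructureEquations

/-! ### The prequantization algebroids of closed two-forms -/

section Prequantization

variable {p : C^∞⟮I, M; I', B⟯}

theorem form2_ext [T2Space M] {θ θ' : Form2 I M}
    (h : ∀ X Y : VField I M, ev2 θ X Y = ev2 θ' X Y) : θ = θ' := by
  apply Subtype.ext
  funext x
  ext v w
  obtain ⟨X, rfl⟩ := exists_section_eq I E v
  obtain ⟨Y, rfl⟩ := exists_section_eq I E w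
  exact congrArg (fun f : SFun I M => f x) (h X Y)

theorem restrictH_class2_eq_iff (θ : Closed2 I M) (ωV : VClosed2 p) :
    restrictH p (class2 θ) = vclass2 ωV ↔
      ∃ γ : VForm1 p, ∀ Y Z : VSec p,
        vev2 ωV.1 Y Z = vev2 (restrict2 p θ.1) Y Z + dV1 γ Y Z := by
  have h1 : restrictH p (class2 θ) = vclass2 ωV ↔
      ωV - restrictClosed p θ ∈ (VExact2 p).submoduleOf (VClosed2 p) := by
    rw [eq_comm]
    exact Submodule.Quotient.eq _
  rw [h1]
  refine exists_congr fun γ => forall_congr' fun Y => forall_congr' fun Z => ?_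
  change vev2 ωV.1 Y Z - vev2 (restrict2 p θ.1) Y Z = dV1 γ Y Z ↔ _
  rw [sub_eq_iff_eq_add, add_comm]

/-- The inclusion `(v, t) ↦ (v, t + γ(v))` of `A_V` in `A_θ`. -/
def preqIncl (γ : VForm1 p) (x : M) : vert p x × ℝ →ₗ[ℝ] Preq I M x :=
  LinearMap.prod ((vert p x).subtype.comp (LinearMap.fst ℝ (vert p x) ℝ))
    (LinearMap.snd ℝ (vert p x) ℝ + (γ.1 x).comp (LinearMap.fst ℝ (vert p x) ℝ))

/-- The extension of `TB` by `A_V` given by a closed form `θ` and a primitive `γ` of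
`ωV - θ|_V`. -/
def preqExtension (hp : ∀ x : M, Function.Surjective (mfderiv I I' p x)) {ωV : VClosed2 p}
    (θ : Closed2 I M) (γ : VForm1 p)
    (hγ : ∀ Y Z : VSec p, vev2 ωV.1 Y Z = vev2 (restrict2 p θ.1) Y Z + dV1 γ Y Z) :
    Extension p ωV (preqAlgebroid θ) where
  incl := preqIncl γ
  contMDiff_incl s := (preqMk s.1.1 (s.2 + vev1 γ s.1)).contMDiff
  injective x := by
    rintro ⟨v, t⟩ ⟨w, r⟩ hvw
    have h1 : v = w := Subtype.ext (congrArg Prod.fst hvw)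
    subst h1
    have h2 : t + γ.1 x v = r + γ.1 x v := congrArg Prod.snd hvw
    rw [add_right_cancel h2]
  ker_iff x a := by
    constructor
    · intro ha
      refine ⟨(⟨a.1, ha⟩, a.2 - γ.1 x ⟨a.1, ha⟩), ?_⟩
      exact Prod.ext rfl (sub_add_cancel a.2 (γ.1 x ⟨a.1, ha⟩))
    · rintro ⟨v, rfl⟩
      exact v.1.2
  surjective x w := by
    obtain ⟨v, hv⟩ := hp x w
    exact ⟨(v, (0 : ℝ)), hv⟩
  anchor_incl x v t := rfl
  bracket_incl s t := by
    obtain ⟨Y, f⟩ := s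
    obtain ⟨Z, g⟩ := t
    apply preq_ext
    · rfl
    · change lieD Y.1 (g + vev1 γ Z) - lieD Z.1 (f + vev1 γ Y) + ev2 θ.1 Y.1 Z.1
        = lieD Y.1 g - lieD Z.1 f + vev2 ωV.1 Y Z + vev1 γ (vbr Y Z)
      rw [hγ, dV1, lieD_add, lieD_add]
      change _ = lieD Y.1 g - lieD Z.1 f + (ev2 θ.1 Y.1 Z.1 + _) + _
      abel
  central a := by
    have h0 : ev2 θ.1 (preqFst a) (0 : VField I M) = 0 := by
      have h0 := ev2_sub_right θ.1 (preqFst a) 0 0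
      rwa [sub_self, sub_self] at h0
    have h1 : vev1 γ (0 : VSec p) = 0 := by
      ext x
      exact map_zero (γ.1 x)
    have h2 : lieD (0 : VField I M) (preqSnd a) = 0 := by
      ext x
      exact map_zero (mvfderiv I (preqSnd a) x)
    apply preq_ext
    · exact lieB_zero_right (preqFst a)
    · change lieD (preqFst a) (1 + vev1 γ 0) - lieD 0 (preqSnd a) + ev2 θ.1 (preqFst a) 0 = 0
      rw [h0, h1, h2, add_zero, add_zero, lieD_one, sub_zero]

theorem preqExtension_incl (hp : ∀ x : M, Function.Surjective (mfderiv I I' p x))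
    {ωV : VClosed2 p} (θ : Closed2 I M) (γ : VForm1 p)
    (hγ : ∀ Y Z : VSec p, vev2 ωV.1 Y Z = vev2 (restrict2 p θ.1) Y Z + dV1 γ Y Z)
    (x : M) (v : vert p x) (t : ℝ) :
    (preqExtension hp θ γ hγ).incl x (v, t) = ((v : TangentSpace I x), t + γ.1 x v) := rfl

/-- An inclusion of the form `(v, t) ↦ (v, t + γ(v))` commutes with the brackets only if
`ωV = θ|_V + d_V γ`. -/
theorem vev2_eq_of_incl {ωV : VClosed2 p} {θ : Closed2 I M} {γ : VForm1 p}
    (e : Extension p ωV (preqAlgebroid θ))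
    (he : ∀ x (v : vert p x) (t : ℝ), e.incl x (v, t) = ((v : TangentSpace I x), t + γ.1 x v))
    (Y Z : VSec p) : vev2 ωV.1 Y Z = vev2 (restrict2 p θ.1) Y Z + dV1 γ Y Z := by
  have hs : ∀ s : ASec p, (⟨fun x => e.incl x (vat s.1 x, s.2 x), e.contMDiff_incl s⟩ :
      Cₛ^∞⟮I; E × ℝ, Preq I M⟯) = preqMk s.1.1 (s.2 + vev1 γ s.1) := by
    intro s
    apply ContMDiffSection.ext
    intro x
    exact he x (vat s.1 x) (s.2 x)
  have hb := e.bracket_incl (Y, 0) (Z, 0)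
  rw [hs, hs, hs] at hb
  have h2 : lieD Y.1 (0 + vev1 γ Z) - lieD Z.1 (0 + vev1 γ Y) + ev2 θ.1 Y.1 Z.1
      = (lieD Y.1 0 - lieD Z.1 0 + vev2 ωV.1 Y Z) + vev1 γ (vbr Y Z) := congrArg preqSnd hb
  rw [zero_add, zero_add, lieD_zero, lieD_zero, sub_zero, zero_add] at h2
  rw [eq_sub_of_add_eq h2.symm, dV1]
  change _ = ev2 θ.1 Y.1 Z.1 + _
  abel

/-- Inclusions of `A_V` that map `(0, 1)` to `(0, 1)` are of the form `(v, t) ↦ (v, t + γ(v))`. -/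
theorem exists_vform_of_incl {ωV : VClosed2 p} {θ : Closed2 I M}
    (e : Extension p ωV (preqAlgebroid θ)) (he : ∀ x, e.incl x (0, 1) = (0, (1 : ℝ))) :
    ∃ γ : VForm1 p, ∀ x (v : vert p x) (t : ℝ),
      e.incl x (v, t) = ((v : TangentSpace I x), t + γ.1 x v) := by
  refine ⟨⟨fun x => (LinearMap.snd ℝ (TangentSpace I x) ℝ).comp
      ((e.incl x).comp (LinearMap.inl ℝ (vert p x) ℝ)), fun Y =>
      (preqSnd ⟨fun x => e.incl x (vat Y x, (0 : SFun I M) x),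
        e.contMDiff_incl (Y, 0)⟩).contMDiff⟩, fun x v t => ?_⟩
  have h1 : ((v, t) : vert p x × ℝ) = (v, 0) + t • (0, 1) := by
    ext <;> simp
  rw [h1, map_add, map_smul, he]
  refine Prod.ext ?_ ?_
  · change (e.incl x (v, 0)).1 + t • (0 : TangentSpace I x) = v
    rw [smul_zero, add_zero]
    exact e.anchor_incl x v 0
  · change (e.incl x (v, 0)).2 + t * 1 = t + (e.incl x (v, 0)).2
    rw [mul_one, add_comm]

/-! ### Isomorphisms of prequantization algebroids -/

theorem class2_eq_iff (θ θ' : Closed2 I M) :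
    class2 θ = class2 θ' ↔
      ∃ β : Form1 I M, ∀ X Y : VField I M, ev2 θ.1 X Y = ev2 θ'.1 X Y + d1 β X Y := by
  have h1 : class2 θ = class2 θ' ↔ θ - θ' ∈ (Exact2 I M).submoduleOf (Closed2 I M) :=
    Submodule.Quotient.eq _
  rw [h1]
  refine exists_congr fun β => forall_congr' fun X => forall_congr' fun Y => ?_
  change ev2 θ.1 X Y - ev2 θ'.1 X Y = d1 β X Y ↔ _
  rw [sub_eq_iff_eq_add, add_comm]

/-- The isomorphism `(v, t) ↦ (v, t + β(v))` from `A_θ` to `A_θ'` for `θ = θ' + dβ`. -/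
def preqIso (θ θ' : Closed2 I M) (β : Form1 I M)
    (hβ : ∀ X Y : VField I M, ev2 θ.1 X Y = ev2 θ'.1 X Y + d1 β X Y) :
    AlgebroidIso (preqAlgebroid θ) (preqAlgebroid θ') where
  map x :=
    { toFun := fun a => (a.1, a.2 + β.1 x a.1)
      map_add' := fun a b => Prod.ext rfl (by
        change a.2 + b.2 + β.1 x (a.1 + b.1) = a.2 + β.1 x a.1 + (b.2 + β.1 x b.1)
        rw [map_add]
        ring)
      map_smul' := fun c a => Prod.ext rfl (by
        change c * a.2 + β.1 x (c • a.1) = c * (a.2 + β.1 x a.1)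
        rw [map_smul, smul_eq_mul]
        ring)
      invFun := fun a => (a.1, a.2 - β.1 x a.1)
      left_inv := fun a => Prod.ext rfl (add_sub_cancel_right a.2 _)
      right_inv := fun a => Prod.ext rfl (sub_add_cancel a.2 _) }
  contMDiff_map s := (preqMk (preqFst s) (preqSnd s + ev1 β (preqFst s))).contMDiff
  contMDiff_symm s := (preqMk (preqFst s) (preqSnd s - ev1 β (preqFst s))).contMDiff
  anchor_map x a := rfl
  bracket_map s t := by
    apply preq_ext
    · rfl
    · change lieD (preqFst s) (preqSnd t) - lieD (preqFst t) (preqSnd s)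
          + ev2 θ.1 (preqFst s) (preqFst t) + ev1 β (lieB (preqFst s) (preqFst t))
        = lieD (preqFst s) (preqSnd t + ev1 β (preqFst t))
          - lieD (preqFst t) (preqSnd s + ev1 β (preqFst s))
          + ev2 θ'.1 (preqFst s) (preqFst t)
      rw [hβ, d1, lieD_add, lieD_add]
      abel

/-- An isomorphism `A_θ → A_θ'` that preserves `(0, 1)` is of the form `(v, t) ↦ (v, t + β(v))`
with `θ = θ' + dβ`. -/
theorem exists_form_of_iso {θ θ' : Closed2 I M}
    (Φ : AlgebroidIso (preqAlgebroid θ) (preqAlgebroid θ'))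
    (hΦ : ∀ x, Φ.map x (0, (1 : ℝ)) = (0, (1 : ℝ))) :
    ∃ β : Form1 I M, (∀ X Y : VField I M, ev2 θ.1 X Y = ev2 θ'.1 X Y + d1 β X Y) ∧
      ∀ x (v : TangentSpace I x) (t : ℝ), Φ.map x (v, t) = (v, t + β.1 x v) := by
  let β : Form1 I M := ⟨fun x => (LinearMap.snd ℝ (TangentSpace I x) ℝ).comp
      ((Φ.map x).toLinearMap.comp (LinearMap.inl ℝ (TangentSpace I x) ℝ)), fun X =>
      (preqSnd ⟨fun x => Φ.map x (preqMk X (0 : SFun I M) x),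
        Φ.contMDiff_map (preqMk X 0)⟩).contMDiff⟩
  have hβ : ∀ x (v : TangentSpace I x) (t : ℝ), Φ.map x (v, t) = (v, t + β.1 x v) := by
    intro x v t
    have h1 : ((v, t) : Preq I M x) = (v, (0 : ℝ)) + t • ((0 : TangentSpace I x), (1 : ℝ)) := by
      refine Prod.ext ?_ ?_
      · change v = v + t • (0 : TangentSpace I x)
        rw [smul_zero, add_zero]
      · change t = 0 + t * 1
        rw [zero_add, mul_one]
    rw [h1, map_add, map_smul, hΦ]
    refine Prod.ext ?_ ?_
    · change (Φ.map x (v, (0 : ℝ))).1 + t • (0 : TangentSpace I x) = v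
      rw [smul_zero, add_zero]
      exact Φ.anchor_map x (v, (0 : ℝ))
    · change (Φ.map x (v, (0 : ℝ))).2 + t * 1 = t + (Φ.map x (v, (0 : ℝ))).2
      rw [mul_one, add_comm]
  refine ⟨β, fun X Y => ?_, hβ⟩
  have hs : ∀ s : Cₛ^∞⟮I; E × ℝ, Preq I M⟯,
      (⟨fun x => Φ.map x (s x), Φ.contMDiff_map s⟩ : Cₛ^∞⟮I; E × ℝ, Preq I M⟯)
        = preqMk (preqFst s) (preqSnd s + ev1 β (preqFst s)) := by
    intro s
    apply ContMDiffSection.ext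
    intro x
    exact hβ x (s x).1 (s x).2
  have hb := Φ.bracket_map (preqMk X 0) (preqMk Y 0)
  rw [hs, hs, hs] at hb
  have h2 : lieD X 0 - lieD Y 0 + ev2 θ.1 X Y + ev1 β (lieB X Y)
      = lieD X (0 + ev1 β Y) - lieD Y (0 + ev1 β X) + ev2 θ'.1 X Y := congrArg preqSnd hb
  rw [zero_add, zero_add, lieD_zero, lieD_zero, sub_zero, zero_add] at h2
  rw [eq_sub_of_add_eq h2, d1]
  abel

theorem exists_iso_iff_class2_eq (θ θ' : Closed2 I M) :
    (∃ Φ : AlgebroidIso (preqAlgebroid θ) (preqAlgebroid θ'),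
      ∀ x, Φ.map x (0, (1 : ℝ)) = (0, (1 : ℝ))) ↔ class2 θ = class2 θ' := by
  rw [class2_eq_iff]
  constructor
  · rintro ⟨Φ, hΦ⟩
    obtain ⟨β, hβ, -⟩ := exists_form_of_iso Φ hΦ
    exact ⟨β, hβ⟩
  · rintro ⟨β, hβ⟩
    refine ⟨preqIso θ θ' β hβ, fun x => Prod.ext rfl ?_⟩
    change (1 : ℝ) + β.1 x 0 = 1
    rw [map_zero, add_zero]

theorem nonempty_extensionIso_iff {ωV : VClosed2 p} {θ θ' : Closed2 I M} {γ γ' : VForm1 p}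
    {e : Extension p ωV (preqAlgebroid θ)} {e' : Extension p ωV (preqAlgebroid θ')}
    (he : ∀ x (v : vert p x) (t : ℝ), e.incl x (v, t) = ((v : TangentSpace I x), t + γ.1 x v))
    (he' : ∀ x (v : vert p x) (t : ℝ),
      e'.incl x (v, t) = ((v : TangentSpace I x), t + γ'.1 x v)) :
    Nonempty (ExtensionIso e e') ↔ ∃ β : Form1 I M,
      (∀ X Y : VField I M, ev2 θ.1 X Y = ev2 θ'.1 X Y + d1 β X Y) ∧ γ' = γ + restrict1 p β := by
  constructor
  · rintro ⟨Φ⟩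
    have h1 : ∀ x, Φ.map x (0, (1 : ℝ)) = (0, (1 : ℝ)) := by
      intro x
      have h2 := Φ.map_incl x (0, 1)
      rw [he, he', map_zero, map_zero, add_zero] at h2
      exact h2
    obtain ⟨β, hβ, hβΦ⟩ := exists_form_of_iso Φ.toAlgebroidIso h1
    refine ⟨β, hβ, Subtype.ext (funext fun x => LinearMap.ext fun v => ?_)⟩
    have h2 := Φ.map_incl x (v, 0)
    rw [he, he', hβΦ] at h2
    have h3 : 0 + γ.1 x v + β.1 x v = 0 + γ'.1 x v := congrArg Prod.snd h2
    rw [zero_add, zero_add] at h3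
    exact h3.symm
  · rintro ⟨β, hβ, hγ⟩
    refine ⟨⟨preqIso θ θ' β hβ, fun x a => ?_⟩⟩
    obtain ⟨v, t⟩ := a
    rw [he, he', hγ]
    refine Prod.ext rfl ?_
    change t + γ.1 x v + β.1 x v = t + (γ.1 x v + β.1 x v)
    rw [add_assoc]

end Prequantization

/-! ### Splittings of the anchor -/

section Splitting

variable {F : Type*} [NormedAddCommGroup F] [NormedSpace ℝ F] [FiniteDimensional ℝ F]
  {A : M → Type*}
  [TopologicalSpace (TotalSpace F A)] [∀ x, TopologicalSpace (A x)] [FiberBundle F A]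
  [∀ x, AddCommGroup (A x)] [∀ x, Module ℝ (A x)] [VectorBundle ℝ F A]
  [ContMDiffVectorBundle ∞ F A I] [T2Space M]

/-- A surjective anchor splits near each point: sections of `A` whose anchors form a basis at `x₀`
do so nearby, and the coefficients of a vector field in this frame are smooth because inversion of
linear maps is smooth. -/
theorem exists_local_splitting (L : LieAlgebroid I F A)
    (hL : ∀ x, Function.Surjective (L.anchor x)) (x₀ : M) :
    ∃ U ∈ 𝓝 x₀, ∃ σ : ∀ x, TangentSpace I x →ₗ[ℝ] A x,
      (∀ X : VField I M, ContMDiffOn I (I.prod 𝓘(ℝ, F)) ∞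
        (fun x => (TotalSpace.mk' F x (σ x (X x)) : TotalSpace F A)) U) ∧
      ∀ x ∈ U, ∀ v, L.anchor x (σ x v) = v := by
  have : CompleteSpace E := FiniteDimensional.complete ℝ E
  set e := trivializationAt E (TangentSpace I : M → Type _) x₀ with he
  have hx₀ : x₀ ∈ e.baseSet := FiberBundle.mem_baseSet_trivializationAt' x₀
  let b := Module.finBasis ℝ E
  choose a ha using fun i => hL x₀ (e.symm x₀ (b i))
  choose s hs using fun i => exists_section_eq I F (a i)
  let Y : Fin (Module.finrank ℝ E) → VField I M :=
    fun i => ⟨fun x => L.anchor x (s i x), L.contMDiff_anchor (s i)⟩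
  have hsm : ∀ X : VField I M, ∀ x ∈ e.baseSet,
      ContMDiffAt I 𝓘(ℝ, E) ∞ (fun x => (e ⟨x, X x⟩).2) x := fun X x hx =>
    (e.contMDiffAt_section_iff hx).1 X.contMDiff.contMDiffAt
  let G : M → E →L[ℝ] E := fun x =>
    ∑ i, ContinuousLinearMap.smulRightL ℝ E E (b.coord i).toContinuousLinearMap (e ⟨x, Y i x⟩).2
  have hG : ∀ x ∈ e.baseSet, ContMDiffAt I 𝓘(ℝ, E →L[ℝ] E) ∞ G x := fun x hx => by
    refine ContMDiffAt.sum fun i _ => ?_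
    exact (ContinuousLinearMap.contMDiff _).contMDiffAt.comp x (hsm (Y i) x hx)
  have hGap : ∀ x w, G x w = ∑ i, b.coord i w • (e ⟨x, Y i x⟩).2 := fun x w => by
    simp [G]
  have hG₀ : G x₀ = 1 := by
    ext w
    rw [hGap]
    have h1 : ∀ i, (e ⟨x₀, Y i x₀⟩).2 = b i := fun i => by
      have h2 : Y i x₀ = e.symm x₀ (b i) := by
        change L.anchor x₀ (s i x₀) = _
        rw [hs, ha]
      rw [h2, e.apply_mk_symm hx₀]
    simp only [h1]
    exact b.sum_repr w
  have hU : e.baseSet ∩ {x | IsUnit (G x)} ∈ 𝓝 x₀ := by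
    refine inter_mem (e.open_baseSet.mem_nhds hx₀) ?_
    change G ⁻¹' {g | IsUnit g} ∈ 𝓝 x₀
    refine (hG x₀ hx₀).continuousAt.preimage_mem_nhds ?_
    refine Units.isOpen.mem_nhds ?_
    rw [hG₀]
    exact isUnit_one
  refine ⟨_, hU, fun x => ∑ i, LinearMap.smulRight
    ((b.coord i).comp ((Ring.inverse (G x)).toLinearMap.comp (e.linearMapAt ℝ x))) (s i x),
    fun X x hx => ?_, fun x hx v => ?_⟩
  · refine ContMDiffAt.contMDiffWithinAt ?_
    have hinv : ContMDiffAt I 𝓘(ℝ, E →L[ℝ] E) ∞ (fun y => Ring.inverse (G y)) x := by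
      obtain ⟨g, hg⟩ := hx.2
      have h1 := contDiffAt_ringInverse ℝ (n := ∞) g
      rw [hg] at h1
      exact h1.contMDiffAt.comp x (hG x hx.1)
    have hc : ∀ i, ContMDiffAt I 𝓘(ℝ, ℝ) ∞ (fun y =>
        (b.coord i).toContinuousLinearMap (Ring.inverse (G y) (e ⟨y, X y⟩).2)) x := fun i =>
      (b.coord i).toContinuousLinearMap.contMDiff.contMDiffAt.comp x
        (hinv.clm_apply (hsm X x hx.1))
    have h1 : ContMDiffAt I (I.prod 𝓘(ℝ, F)) ∞ (fun y => TotalSpace.mk' F y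
        (∑ i, (b.coord i).toContinuousLinearMap (Ring.inverse (G y) (e ⟨y, X y⟩).2) • s i y)) x :=
      ContMDiffAt.sum_section fun i _ => (hc i).smul_section (s i).contMDiff.contMDiffAt
    refine h1.congr_of_eventuallyEq ?_
    filter_upwards [e.open_baseSet.mem_nhds hx.1] with y hy
    congr 1
    rw [LinearMap.sum_apply]
    refine Finset.sum_congr rfl fun i _ => ?_
    change b.coord i (Ring.inverse (G y) (e.linearMapAt ℝ y (X y))) • s i y = _
    rw [e.coe_linearMapAt_of_mem hy]
    rfl
  · have hinj : Function.Injective (e.linearMapAt ℝ x) := by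
      intro v w hvw
      rw [← e.symmₗ_linearMapAt (R := ℝ) hx.1 v, hvw, e.symmₗ_linearMapAt (R := ℝ) hx.1]
    apply hinj
    rw [LinearMap.sum_apply, map_sum, map_sum]
    have h1 : G x (Ring.inverse (G x) (e.linearMapAt ℝ x v)) = e.linearMapAt ℝ x v :=
      DFunLike.congr_fun (Ring.mul_inverse_cancel _ hx.2) _
    rw [hGap] at h1
    refine Eq.trans (Finset.sum_congr rfl fun i _ => ?_) h1
    rw [LinearMap.smulRight_apply, map_smul, map_smul]
    congr 1
    rw [e.coe_linearMapAt_of_mem hx.1]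
    rfl

/-- A surjective anchor has a smooth splitting: local splittings are patched with a partition of
unity. -/
theorem nonempty_anchorSplitting [SigmaCompactSpace M] (L : LieAlgebroid I F A)
    (hL : ∀ x, Function.Surjective (L.anchor x)) : Nonempty (AnchorSplitting L) := by
  choose U hU σ hσ hσU using exists_local_splitting L hL
  obtain ⟨ρ, hρ⟩ : ∃ ρ : SmoothPartitionOfUnity M I M univ,
      ρ.IsSubordinate fun x => interior (U x) :=
    SmoothPartitionOfUnity.exists_isSubordinate I isClosed_univ _ (fun _ => isOpen_interior)
      fun x _ => mem_iUnion.2 ⟨x, mem_interior_iff_mem_nhds.2 (hU x)⟩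
  have hfin : ∀ x, (Function.support fun j => ρ j x • σ j x).Finite := fun x =>
    (ρ.locallyFinite.point_finite x).subset fun j hj => left_ne_zero_of_smul hj
  have hap : ∀ x v, (∑ᶠ j, ρ j x • σ j x) v = ∑ᶠ j, ρ j x • σ j x v := fun x v =>
    AddMonoidHom.map_finsum (LinearMap.applyₗ (R := ℝ) (M₂ := A x) v).toAddMonoidHom (hfin x)
  refine ⟨⟨fun x => ∑ᶠ j, ρ j x • σ j x, fun x v => ?_, fun X => ?_⟩⟩
  · have h1 : L.anchor x ((∑ᶠ j, ρ j x • σ j x) v) = ∑ᶠ j, L.anchor x ((ρ j x • σ j x) v) :=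
      AddMonoidHom.map_finsum
        ((L.anchor x).comp (LinearMap.applyₗ (R := ℝ) (M₂ := A x) v)).toAddMonoidHom (hfin x)
    have h2 : ∀ j, L.anchor x ((ρ j x • σ j x) v) = ρ j x • v := by
      intro j
      rw [LinearMap.smul_apply, map_smul]
      by_cases h0 : ρ j x = 0
      · rw [h0, zero_smul, zero_smul]
      · rw [hσU j x (interior_subset (hρ j (subset_closure h0)))]
    rw [h1, finsum_congr h2]
    have h3 := AddMonoidHom.map_finsum ((LinearMap.toSpanSingleton ℝ (TangentSpace I x) v
      ).toAddMonoidHom) (ρ.locallyFinite.point_finite x)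
    have h4 := ρ.sum_eq_one (mem_univ x)
    refine h3.symm.trans ?_
    change (∑ᶠ j, ρ j x) • v = v
    rw [h4, one_smul]
  · have h1 : ContMDiff I (I.prod 𝓘(ℝ, F)) ∞
        (fun x => (TotalSpace.mk' F x (∑ᶠ j, ρ j x • σ j x (X x)) : TotalSpace F A)) := by
      refine ContMDiff.finsum_section_of_locallyFinite ?_ fun j => ?_
      · exact ρ.locallyFinite.subset fun j x hx => left_ne_zero_of_smul hx
      · exact ContMDiffOn.smul_section_of_tsupport (ρ j).contMDiff.contMDiffOn isOpen_interior
          (hρ j) ((hσ j X).mono interior_subset)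
    simp only [hap]
    exact h1

end Splitting

/-! ### Extensions and their central section -/

section Extensions

variable {p : C^∞⟮I, M; I', B⟯}
variable {F : Type*} [NormedAddCommGroup F] [NormedSpace ℝ F]
  {A : M → Type*}
  [TopologicalSpace (TotalSpace F A)] [∀ x, TopologicalSpace (A x)] [FiberBundle F A]
  [∀ x, AddCommGroup (A x)] [∀ x, Module ℝ (A x)] [VectorBundle ℝ F A]

/-- The anchor of a section, as a vector field. -/
def LieAlgebroid.anchorSec (L : LieAlgebroid I F A) (a : Cₛ^∞⟮I; F, A⟯) : VField I M :=
  ⟨fun x => L.anchor x (a x), L.contMDiff_anchor a⟩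

theorem LieAlgebroid.bracket_fsmul (L : LieAlgebroid I F A) (a : Cₛ^∞⟮I; F, A⟯) (f : SFun I M)
    (b : Cₛ^∞⟮I; F, A⟯) :
    L.bracket a (fsmul f b) = fsmul f (L.bracket a b) + fsmul (lieD (L.anchorSec a) f) b :=
  L.leibniz a f b

theorem fsmul_add_left (f g : SFun I M) (s : Cₛ^∞⟮I; F, A⟯) :
    fsmul (f + g) s = fsmul f s + fsmul g s :=
  ContMDiffSection.ext fun x => add_smul (f x) (g x) (s x)

theorem fsmul_neg_left (f : SFun I M) (s : Cₛ^∞⟮I; F, A⟯) : fsmul (-f) s = -fsmul f s :=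
  ContMDiffSection.ext fun x => neg_smul (f x) (s x)

theorem fsmul_mul (f g : SFun I M) (s : Cₛ^∞⟮I; F, A⟯) :
    fsmul (f * g) s = fsmul f (fsmul g s) :=
  ContMDiffSection.ext fun x => mul_smul (f x) (g x) (s x)

theorem fsmul_zero_left (s : Cₛ^∞⟮I; F, A⟯) : fsmul (0 : SFun I M) s = 0 :=
  ContMDiffSection.ext fun x => zero_smul ℝ (s x)

variable {ωV : VClosed2 p} {L : LieAlgebroid I F A}

/-- The central section `i(0, 1)` of an extension. -/
def Extension.center (e : Extension p ωV L) : Cₛ^∞⟮I; F, A⟯ := e.inclSec (0, 1)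

theorem Extension.center_apply (e : Extension p ωV L) (x : M) : e.center x = e.incl x (0, 1) := rfl

theorem Extension.incl_zero (e : Extension p ωV L) (x : M) (t : ℝ) :
    e.incl x (0, t) = t • e.center x := by
  rw [e.center_apply, ← map_smul]
  congr 1
  ext <;> simp

theorem Extension.incl_eq (e : Extension p ωV L) (x : M) (v : vert p x) (t : ℝ) :
    e.incl x (v, t) = e.incl x (v, 0) + t • e.center x := by
  rw [← e.incl_zero, ← map_add]
  congr 1
  ext <;> simp

theorem Extension.center_ne_zero (e : Extension p ωV L) (x : M) : e.center x ≠ 0 := by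
  intro h
  have h1 := e.injective x (h.trans (map_zero (e.incl x)).symm)
  exact one_ne_zero (congrArg Prod.snd h1)

theorem Extension.inclSec_eq (e : Extension p ωV L) (s : ASec p) :
    e.inclSec s = e.inclSec (s.1, 0) + fsmul s.2 e.center :=
  ContMDiffSection.ext fun x => e.incl_eq x (vat s.1 x) (s.2 x)

theorem Extension.inclSec_injective (e : Extension p ωV L) :
    Function.Injective (e.inclSec : ASec p → Cₛ^∞⟮I; F, A⟯) := by
  intro s t hst
  have h1 : ∀ x, (vat s.1 x, s.2 x) = (vat t.1 x, t.2 x) := fun x =>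
    e.injective x (congrArg (fun r : Cₛ^∞⟮I; F, A⟯ => r x) hst)
  refine Prod.ext (Subtype.ext (ContMDiffSection.ext fun x => ?_)) (ContMDiffMap.ext fun x => ?_)
  · exact congrArg (fun r => (r.1 : TangentSpace I x)) (h1 x)
  · exact congrArg Prod.snd (h1 x)

theorem Extension.fsmul_center_injective (e : Extension p ωV L) {f g : SFun I M}
    (h : fsmul f e.center = fsmul g e.center) : f = g := by
  ext x
  exact smul_left_injective ℝ (e.center_ne_zero x)
    (congrArg (fun s : Cₛ^∞⟮I; F, A⟯ => s x) h)

theorem Extension.anchor_center (e : Extension p ωV L) (x : M) : L.anchor x (e.center x) = 0 :=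
  e.anchor_incl x 0 1

theorem Extension.bracket_fsmul_center (e : Extension p ωV L) (a : Cₛ^∞⟮I; F, A⟯)
    (f : SFun I M) :
    L.bracket a (fsmul f e.center) = fsmul (lieD (L.anchorSec a) f) e.center := by
  have h : L.bracket a e.center = 0 := e.central a
  rw [L.bracket_fsmul, h]
  ext x
  change f x • (0 : A x) + _ = _
  rw [smul_zero, zero_add]

/-- The anchor preserves brackets: the Jacobi identity for two sections and a multiple of the
central section compares the two derivations of functions. -/
theorem Extension.anchorSec_bracket [T2Space M] (e : Extension p ωV L) (a b : Cₛ^∞⟮I; F, A⟯) :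
    L.anchorSec (L.bracket a b) = lieB (L.anchorSec a) (L.anchorSec b) := by
  refine eq_of_lieD_eq fun f => ?_
  have h := L.jacobi a b (fsmul f e.center)
  simp only [e.bracket_fsmul_center, ← fsmul_add_left] at h
  rw [lieD_lieB, e.fsmul_center_injective h, add_sub_cancel_right]

theorem Extension.anchor_surjective (e : Extension p ωV L) (x : M) :
    Function.Surjective (L.anchor x) := by
  intro v
  obtain ⟨a, ha⟩ := e.surjective x (mfderiv I I' p x v)
  have hv : v - L.anchor x a ∈ vert p x := by
    change mfderiv I I' p x (v - L.anchor x a) = 0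
    rw [map_sub, ha, sub_self]
  refine ⟨a + e.incl x (⟨_, hv⟩, 0), ?_⟩
  rw [map_add, e.anchor_incl]
  exact add_sub_cancel (L.anchor x a) v

/-- The kernel of the anchor is spanned by the central section. -/
theorem Extension.exists_eq_smul_center (e : Extension p ωV L) {x : M} {a : A x}
    (ha : L.anchor x a = 0) : ∃ t : ℝ, a = t • e.center x := by
  obtain ⟨⟨v, t⟩, rfl⟩ := (e.ker_iff x a).1 (by rw [ha, map_zero])
  refine ⟨t, ?_⟩
  rw [e.anchor_incl] at ha
  have hv : v = 0 := Subtype.ext ha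
  rw [hv, e.incl_zero]

/-- A smooth section in the kernel of the anchor is a smooth multiple of the central section. -/
theorem Extension.exists_eq_fsmul_center [FiniteDimensional ℝ F] [ContMDiffVectorBundle ∞ F A I]
    [T2Space M] (e : Extension p ωV L) {s : Cₛ^∞⟮I; F, A⟯} (hs : L.anchorSec s = 0) :
    ∃ f : SFun I M, s = fsmul f e.center := by
  choose f hf using fun x => e.exists_eq_smul_center (a := s x)
    (congrArg (fun X : VField I M => X x) hs)
  refine ⟨⟨f, fun x₀ => ?_⟩, ContMDiffSection.ext hf⟩
  obtain ⟨ι, _, ρ, t, c, hρ, hc, h⟩ := exists_frame (I := I) (F := F) (A := A) x₀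
  obtain ⟨i, hi⟩ : ∃ i, c i x₀ (e.center x₀) ≠ 0 := by
    by_contra! h0
    have h1 := h x₀ (e.center x₀)
    rw [hρ.self_of_nhds, one_smul] at h1
    apply e.center_ne_zero x₀
    rw [h1]
    exact Finset.sum_eq_zero fun i _ => by rw [h0, zero_smul]
  have h2 : ContMDiffAt I 𝓘(ℝ, ℝ) ∞
      (fun x => c i x (s x) * (c i x (e.center x))⁻¹) x₀ :=
    (formEval (hc i) s).contMDiff.contMDiffAt.mul
      ((formEval (hc i) e.center).contMDiff.contMDiffAt.inv₀ hi)
  refine h2.congr_of_eventuallyEq ?_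
  have h3 := (formEval (hc i) e.center).contMDiff.continuous.continuousAt.eventually_ne hi
  filter_upwards [h3] with x hx
  have hx' : c i x (e.center x) ≠ 0 := hx
  rw [hf x, map_smul, smul_eq_mul, mul_assoc, mul_inv_cancel₀ hx', mul_one]

/-! ### The curvature form of a splitting of the anchor -/

theorem AnchorSplitting.sec_add (σ : AnchorSplitting L) (X Y : VField I M) :
    σ.sec (X + Y) = σ.sec X + σ.sec Y :=
  ContMDiffSection.ext fun x => map_add (σ.map x) (X x) (Y x)

theorem AnchorSplitting.sec_neg (σ : AnchorSplitting L) (X : VField I M) :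
    σ.sec (-X) = -σ.sec X :=
  ContMDiffSection.ext fun x => map_neg (σ.map x) (X x)

theorem AnchorSplitting.sec_sub (σ : AnchorSplitting L) (X Y : VField I M) :
    σ.sec (X - Y) = σ.sec X - σ.sec Y :=
  ContMDiffSection.ext fun x => map_sub (σ.map x) (X x) (Y x)

theorem AnchorSplitting.sec_fsmul (σ : AnchorSplitting L) (f : SFun I M) (X : VField I M) :
    σ.sec (fsmul f X) = fsmul f (σ.sec X) :=
  ContMDiffSection.ext fun x => map_smul (σ.map x) (f x) (X x)

theorem AnchorSplitting.anchorSec_sec (σ : AnchorSplitting L) (X : VField I M) :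
    L.anchorSec (σ.sec X) = X :=
  ContMDiffSection.ext fun x => σ.anchor_map x (X x)

theorem AnchorSplitting.curvature_swap (σ : AnchorSplitting L) (X Y : VField I M) :
    σ.curvature X Y = -σ.curvature Y X := by
  rw [curvature, curvature, L.skew, lieB_skew, σ.sec_neg]
  abel

theorem AnchorSplitting.curvature_add_right (σ : AnchorSplitting L) (X Y Z : VField I M) :
    σ.curvature X (Y + Z) = σ.curvature X Y + σ.curvature X Z := by
  simp only [curvature, sec_add, L.bracket_add, lieB_add]
  abel

theorem AnchorSplitting.curvature_fsmul_right (σ : AnchorSplitting L) (f : SFun I M)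
    (X Y : VField I M) : σ.curvature X (fsmul f Y) = fsmul f (σ.curvature X Y) := by
  rw [curvature, σ.sec_fsmul, L.bracket_fsmul, lieB_fsmul, σ.sec_add, σ.sec_fsmul, σ.sec_fsmul,
    σ.anchorSec_sec, add_sub_add_right_eq_sub]
  ext x
  exact (smul_sub (f x) _ _).symm

theorem AnchorSplitting.anchorSec_curvature [T2Space M] (σ : AnchorSplitting L)
    (e : Extension p ωV L) (X Y : VField I M) : L.anchorSec (σ.curvature X Y) = 0 := by
  have h1 : L.anchorSec (σ.curvature X Y)
      = L.anchorSec (L.bracket (σ.sec X) (σ.sec Y)) - L.anchorSec (σ.sec (lieB X Y)) :=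
    ContMDiffSection.ext fun x => map_sub (L.anchor x) _ _
  rw [h1, e.anchorSec_bracket, σ.anchorSec_sec, σ.anchorSec_sec, σ.anchorSec_sec, sub_self]

theorem AnchorSplitting.exists_form2 [FiniteDimensional ℝ F] [ContMDiffVectorBundle ∞ F A I]
    [T2Space M] (σ : AnchorSplitting L) (e : Extension p ωV L) :
    ∃ θ : Form2 I M, ∀ X Y, σ.curvature X Y = fsmul (ev2 θ X Y) e.center := by
  choose f hf using fun X Y => e.exists_eq_fsmul_center (σ.anchorSec_curvature e X Y)
  have hadd : ∀ X Y Z, f X (Y + Z) = f X Y + f X Z := fun X Y Z => e.fsmul_center_injective <| by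
    rw [← hf, fsmul_add_left, ← hf, ← hf, σ.curvature_add_right]
  have hsmul : ∀ X g Y, f X (fsmul g Y) = g * f X Y := fun X g Y => e.fsmul_center_injective <| by
    rw [← hf, fsmul_mul, ← hf, σ.curvature_fsmul_right]
  have hswap : ∀ X Y, f X Y = -f Y X := fun X Y => e.fsmul_center_injective <| by
    rw [← hf, fsmul_neg_left, ← hf, σ.curvature_swap]
  choose θ hθ using fun x : M => exists_tensor₂ (x₀ := x) (y₀ := x)
    (fun X Y : VField I M => f X Y x)
    (fun X X' Y => by rw [hswap, hadd, hswap X, hswap X', neg_add]; rfl)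
    (fun g X Y => by rw [hswap, hsmul, hswap X, ← mul_neg]; rfl)
    (fun X Y Y' => by rw [hadd]; rfl) (fun g X Y => by rw [hsmul]; rfl)
  refine ⟨⟨θ, fun x v => ?_, fun X Y => ?_⟩, fun X Y => ?_⟩
  · obtain ⟨X, rfl⟩ := exists_section_eq I E v
    rw [← hθ]
    have h1 : f X X x = -f X X x := congrArg (fun g : SFun I M => g x) (hswap X X)
    linarith
  · simp only [← hθ]
    exact (f X Y).contMDiff
  · rw [hf]
    congr 1
    ext x
    exact hθ x X Y

/-- The curvature form is closed, by the Jacobi identity for three sections of the splitting. -/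
theorem AnchorSplitting.mem_closed2 [T2Space M] (σ : AnchorSplitting L) (e : Extension p ωV L)
    {θ : Form2 I M} (hθ : ∀ X Y, σ.curvature X Y = fsmul (ev2 θ X Y) e.center) :
    θ ∈ Closed2 I M := by
  intro X Y Z
  have hb : ∀ X Y, L.bracket (σ.sec X) (σ.sec Y)
      = σ.sec (lieB X Y) + fsmul (ev2 θ X Y) e.center := fun X Y => by
    rw [← hθ, curvature, add_sub_cancel]
  have hbb : ∀ X Y Z, L.bracket (σ.sec X) (L.bracket (σ.sec Y) (σ.sec Z))
      = σ.sec (lieB X (lieB Y Z))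
        + fsmul (ev2 θ X (lieB Y Z) + lieD X (ev2 θ Y Z)) e.center := fun X Y Z => by
    rw [hb Y Z, L.bracket_add, hb, e.bracket_fsmul_center, σ.anchorSec_sec, fsmul_add_left,
      add_assoc]
  have hj := L.jacobi (σ.sec X) (σ.sec Y) (σ.sec Z)
  rw [L.skew (L.bracket _ _), hbb, hbb, hbb, lieB_jacobi X Y Z, lieB_skew (lieB X Y) Z, σ.sec_add,
    σ.sec_neg] at hj
  have h1 : fsmul (ev2 θ X (lieB Y Z) + lieD X (ev2 θ Y Z)) e.center
      = fsmul (-(ev2 θ Z (lieB X Y) + lieD Z (ev2 θ X Y))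
        + (ev2 θ Y (lieB X Z) + lieD Y (ev2 θ X Z))) e.center := by
    rw [fsmul_add_left (-_), fsmul_neg_left]
    rw [← sub_eq_zero] at hj ⊢
    rw [← hj]
    abel
  have h2 := e.fsmul_center_injective h1
  rw [d2, ev2_swap θ (lieB X Y), ev2_swap θ (lieB Y Z), ev2_swap θ (lieB Z X), lieB_skew Z X,
    ev2_neg_right, ev2_swap θ Z X, lieD_neg]
  linear_combination h2

/-! ### The equivalence of an extension with the algebroid of its curvature form -/

/-- The linear map `(v, t) ↦ σ(v) + t i(0, 1)`. -/
def splitMap (σ : AnchorSplitting L) (e : Extension p ωV L) (x : M) : Preq I M x →ₗ[ℝ] A x :=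
  LinearMap.coprod (σ.map x) (LinearMap.toSpanSingleton ℝ (A x) (e.center x))

theorem splitMap_apply (σ : AnchorSplitting L) (e : Extension p ωV L) (x : M)
    (v : TangentSpace I x) (t : ℝ) : splitMap σ e x (v, t) = σ.map x v + t • e.center x := rfl

theorem anchor_splitMap (σ : AnchorSplitting L) (e : Extension p ωV L) (x : M) (a : Preq I M x) :
    L.anchor x (splitMap σ e x a) = a.1 := by
  change L.anchor x (σ.map x a.1 + a.2 • e.center x) = a.1
  rw [map_add, map_smul, e.anchor_center, σ.anchor_map, smul_zero, add_zero]

theorem splitMap_bijective (σ : AnchorSplitting L) (e : Extension p ωV L) (x : M) :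
    Function.Bijective (splitMap σ e x) := by
  constructor
  · rintro ⟨v, t⟩ ⟨w, r⟩ h
    have h1 : v = w := (anchor_splitMap σ e x (v, t)).symm.trans
      ((congrArg (L.anchor x) h).trans (anchor_splitMap σ e x (w, r)))
    subst h1
    have h2 : t • e.center x = r • e.center x := add_left_cancel h
    rw [smul_left_injective ℝ (e.center_ne_zero x) h2]
  · intro a
    obtain ⟨t, ht⟩ := e.exists_eq_smul_center (x := x) (a := a - σ.map x (L.anchor x a))
      (by rw [map_sub, σ.anchor_map, sub_self])
    refine ⟨(L.anchor x a, t), ?_⟩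
    rw [splitMap_apply, ← ht, add_sub_cancel]

theorem splitMap_section (σ : AnchorSplitting L) (e : Extension p ωV L)
    (s : Cₛ^∞⟮I; E × ℝ, Preq I M⟯) (x : M) :
    splitMap σ e x (s x) = (σ.sec (preqFst s) + fsmul (preqSnd s) e.center) x := rfl

/-- The equivalence `(v, t) ↦ σ(v) + t i(0, 1)` from `A_θ` to `A`, where `θ` is the curvature form
of `σ`. -/
def splitIso [FiniteDimensional ℝ F] [ContMDiffVectorBundle ∞ F A I] [T2Space M]
    (σ : AnchorSplitting L) (e : Extension p ωV L) (θ : Closed2 I M)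
    (hθ : ∀ X Y, σ.curvature X Y = fsmul (ev2 θ.1 X Y) e.center) :
    AlgebroidIso (preqAlgebroid θ) L where
  map x := LinearEquiv.ofBijective (splitMap σ e x) (splitMap_bijective σ e x)
  contMDiff_map s := (σ.sec (preqFst s) + fsmul (preqSnd s) e.center).contMDiff
  contMDiff_symm s := by
    have h0 : L.anchorSec (s - σ.sec (L.anchorSec s)) = 0 := by
      ext x
      change L.anchor x (s x - σ.map x (L.anchor x (s x))) = 0
      rw [map_sub, σ.anchor_map, sub_self]
    obtain ⟨f, hf⟩ := e.exists_eq_fsmul_center h0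
    have h1 : ∀ x, (LinearEquiv.ofBijective (splitMap σ e x) (splitMap_bijective σ e x)).symm (s x)
        = preqMk (L.anchorSec s) f x := by
      intro x
      rw [LinearEquiv.symm_apply_eq]
      change s x = splitMap σ e x (preqMk (L.anchorSec s) f x)
      rw [splitMap_section]
      change s x = (σ.sec (L.anchorSec s) + fsmul f e.center) x
      rw [← hf, add_sub_cancel]
    simp only [h1]
    exact (preqMk (L.anchorSec s) f).contMDiff
  anchor_map x a := anchor_splitMap σ e x a
  bracket_map s t := by
    change σ.sec (lieB (preqFst s) (preqFst t)) + fsmul (lieD (preqFst s) (preqSnd t)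
        - lieD (preqFst t) (preqSnd s) + ev2 θ.1 (preqFst s) (preqFst t)) e.center
      = L.bracket (σ.sec (preqFst s) + fsmul (preqSnd s) e.center)
        (σ.sec (preqFst t) + fsmul (preqSnd t) e.center)
    have hb : L.bracket (σ.sec (preqFst s)) (σ.sec (preqFst t))
        = σ.sec (lieB (preqFst s) (preqFst t))
          + fsmul (ev2 θ.1 (preqFst s) (preqFst t)) e.center := by
      rw [← hθ, AnchorSplitting.curvature, add_sub_cancel]
    have ha : L.anchorSec (σ.sec (preqFst s) + fsmul (preqSnd s) e.center) = preqFst s :=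
      ContMDiffSection.ext fun x => anchor_splitMap σ e x (s x)
    rw [L.bracket_add, e.bracket_fsmul_center, ha, L.skew, L.bracket_add, e.bracket_fsmul_center,
      σ.anchorSec_sec, L.skew (σ.sec (preqFst t)), hb, sub_eq_add_neg, fsmul_add_left,
      fsmul_add_left, fsmul_neg_left]
    abel

theorem splitIso_map [FiniteDimensional ℝ F] [ContMDiffVectorBundle ∞ F A I] [T2Space M]
    (σ : AnchorSplitting L) (e : Extension p ωV L) (θ : Closed2 I M)
    (hθ : ∀ X Y, σ.curvature X Y = fsmul (ev2 θ.1 X Y) e.center) (x : M) (v : TangentSpace I x)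
    (t : ℝ) : (splitIso σ e θ hθ).map x (v, t) = σ.map x v + t • e.center x := rfl

end Extensions

/-! ### Transport of extensions along isomorphisms -/

section Transport

variable {p : C^∞⟮I, M; I', B⟯} {ωV : VClosed2 p}
  {F : Type*} [NormedAddCommGroup F] [NormedSpace ℝ F] {A : M → Type*}
  [TopologicalSpace (TotalSpace F A)] [∀ x, TopologicalSpace (A x)] [FiberBundle F A]
  [∀ x, AddCommGroup (A x)] [∀ x, Module ℝ (A x)] [VectorBundle ℝ F A]
  {F' : Type*} [NormedAddCommGroup F'] [NormedSpace ℝ F'] {A' : M → Type*}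
  [TopologicalSpace (TotalSpace F' A')] [∀ x, TopologicalSpace (A' x)] [FiberBundle F' A']
  [∀ x, AddCommGroup (A' x)] [∀ x, Module ℝ (A' x)] [VectorBundle ℝ F' A']
  {L : LieAlgebroid I F A} {L' : LieAlgebroid I F' A'}

/-- The image of a section under an isomorphism of Lie algebroids. -/
def AlgebroidIso.mapSec (Φ : AlgebroidIso L L') (s : Cₛ^∞⟮I; F, A⟯) : Cₛ^∞⟮I; F', A'⟯ :=
  ⟨fun x => Φ.map x (s x), Φ.contMDiff_map s⟩

theorem AlgebroidIso.mapSec_injective (Φ : AlgebroidIso L L') :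
    Function.Injective (Φ.mapSec : Cₛ^∞⟮I; F, A⟯ → Cₛ^∞⟮I; F', A'⟯) := fun _ _ h =>
  ContMDiffSection.ext fun x =>
    (Φ.map x).injective (congrArg (fun r : Cₛ^∞⟮I; F', A'⟯ => r x) h)

theorem AlgebroidIso.mapSec_bracket (Φ : AlgebroidIso L L') (s t : Cₛ^∞⟮I; F, A⟯) :
    Φ.mapSec (L.bracket s t) = L'.bracket (Φ.mapSec s) (Φ.mapSec t) := Φ.bracket_map s t

theorem AlgebroidIso.anchor_symm (Φ : AlgebroidIso L L') (x : M) (a : A' x) :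
    L.anchor x ((Φ.map x).symm a) = L'.anchor x a := by
  rw [← Φ.anchor_map, LinearEquiv.apply_symm_apply]

/-- The extension structure on `A` obtained from one on `A'` and an isomorphism `A → A'`. -/
def Extension.comap (Φ : AlgebroidIso L L') (e : Extension p ωV L') : Extension p ωV L where
  incl x := (Φ.map x).symm.toLinearMap.comp (e.incl x)
  contMDiff_incl s := Φ.contMDiff_symm (e.inclSec s)
  injective x := (Φ.map x).symm.injective.comp (e.injective x)
  ker_iff x a := by
    rw [← Φ.anchor_map, e.ker_iff]
    constructor
    · rintro ⟨s, hs⟩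
      exact ⟨s, by rw [LinearMap.comp_apply, hs]; exact (Φ.map x).symm_apply_apply a⟩
    · rintro ⟨s, rfl⟩
      exact ⟨s, ((Φ.map x).apply_symm_apply _).symm⟩
  surjective x w := by
    obtain ⟨a, ha⟩ := e.surjective x w
    exact ⟨(Φ.map x).symm a, by rw [Φ.anchor_symm, ha]⟩
  anchor_incl x v t := (Φ.anchor_symm x _).trans (e.anchor_incl x v t)
  bracket_incl s t := by
    have h1 : ∀ s : ASec p, Φ.mapSec ⟨fun x => (Φ.map x).symm (e.inclSec s x),
        Φ.contMDiff_symm (e.inclSec s)⟩ = e.inclSec s := fun s =>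
      ContMDiffSection.ext fun x => (Φ.map x).apply_symm_apply _
    apply Φ.mapSec_injective
    rw [Φ.mapSec_bracket]
    exact (congrArg₂ L'.bracket (h1 s) (h1 t)).trans ((e.bracket_incl s t).trans (h1 _).symm)
  central a := by
    have h1 : Φ.mapSec ⟨fun x => (Φ.map x).symm (e.inclSec (0, 1) x),
        Φ.contMDiff_symm (e.inclSec (0, 1))⟩ = e.inclSec (0, 1) :=
      ContMDiffSection.ext fun x => (Φ.map x).apply_symm_apply _
    apply Φ.mapSec_injective
    rw [Φ.mapSec_bracket]
    refine (congrArg (L'.bracket (Φ.mapSec a)) h1).trans ((e.central _).trans ?_)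
    exact ContMDiffSection.ext fun x => (map_zero (Φ.map x)).symm

theorem Extension.comap_incl (Φ : AlgebroidIso L L') (e : Extension p ωV L') (x : M)
    (a : vert p x × ℝ) : (e.comap Φ).incl x a = (Φ.map x).symm (e.incl x a) := rfl

/-- The isomorphism along which an extension is transported is an equivalence of extensions. -/
def Extension.comapIso (Φ : AlgebroidIso L L') (e : Extension p ωV L') :
    ExtensionIso (e.comap Φ) e :=
  ⟨Φ, fun x a => (Φ.map x).apply_symm_apply (e.incl x a)⟩

end Transport

/-! ### Splittings over the base and their couples -/

section HorizontalSplittings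

variable {p : C^∞⟮I, M; I', B⟯} {ωV : VClosed2 p}

/-- A connection is used to extend vertical vectors to vertical fields. -/
theorem vform2_ext [T2Space M] [T2Space B] (h : EhresmannConnection p) {η η' : VForm2 p}
    (hη : ∀ Y Z : VSec p, vev2 η Y Z = vev2 η' Y Z) : η = η' := by
  apply Subtype.ext
  funext x
  ext v w
  obtain ⟨X, hX⟩ := exists_section_eq I E (v : TangentSpace I x)
  obtain ⟨Y, hY⟩ := exists_section_eq I E (w : TangentSpace I x)
  have h1 : η.1 x (verProj h x (X x)) (verProj h x (Y x))
      = η'.1 x (verProj h x (X x)) (verProj h x (Y x)) :=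
    congrArg (fun f : SFun I M => f x) (hη (ver h X) (ver h Y))
  rwa [hX, hY, verProj_vert, verProj_vert] at h1

/-- The couple of a connection and a closed two-form that restricts to `ωV`. -/
def formCouple [T2Space M] [T2Space B] (h : EhresmannConnection p) (θ : Closed2 I M)
    (hθ : restrict2 p θ.1 = ωV.1) : Couple ωV.1 where
  D := formD h θ.1
  symbol := hlift h
  isSymmetry := by
    rw [← hθ]
    exact (closedEq2_iff h θ.1).1 ((mem_closed2_iff h θ.1).1 θ.2).2.1
  projects := hlift_projects h
  D_add u v a := by
    refine Prod.ext (Subtype.ext ?_) ?_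
    · change lieB (hlift h (u + v)) a.1.1 = lieB (hlift h u) a.1.1 + lieB (hlift h v) a.1.1
      rw [hlift_add, lieB_add_left]
    · change lieD (hlift h (u + v)) a.2 + ev2 θ.1 (hlift h (u + v)) a.1.1
        = lieD (hlift h u) a.2 + ev2 θ.1 (hlift h u) a.1.1
          + (lieD (hlift h v) a.2 + ev2 θ.1 (hlift h v) a.1.1)
      rw [hlift_add, lieD_add_left, ev2_add_left]
      abel
  D_fsmul f u a := by
    -- functions pulled back from `B` are constant along vertical fields
    have h2 : lieD a.1.1 (f.comp p) = 0 := by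
      ext x
      change mvfderiv I (f ∘ p) x (a.1.1 x) = 0
      rw [mvfderiv_comp_apply (I' := I) (I := I') (g := f) (f := p) x (f.mdiff (p x))
        (p.contMDiff.contMDiffAt.mdifferentiableAt (by simp))]
      have h3 : mfderiv I I' p x (a.1.1 x) = 0 := a.1.2 x
      rw [h3, map_zero]
    refine Prod.ext (Subtype.ext ?_) ?_
    · change lieB (hlift h (fsmul f u)) a.1.1 = fsmul (f.comp p) (lieB (hlift h u) a.1.1)
      rw [hlift_fsmul, lieB_fsmul_left, h2, fsmul_zero_left, sub_zero]
    · change lieD (hlift h (fsmul f u)) a.2 + ev2 θ.1 (hlift h (fsmul f u)) a.1.1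
        = f.comp p * (lieD (hlift h u) a.2 + ev2 θ.1 (hlift h u) a.1.1)
      rw [hlift_fsmul, lieD_fsmul_left, ev2_fsmul_left, mul_add]
  w := formW h θ.1
  w_self u := by
    refine Prod.ext (Subtype.ext ?_) ?_
    · change lieB (hlift h u) (hlift h u) - hlift h (lieB u u) = 0
      ext x
      change VectorField.mlieBracket I (hlift h u) (hlift h u) x
        - h.lift x (VectorField.mlieBracket I' u u (p x)) = 0
      rw [VectorField.mlieBracket_self, VectorField.mlieBracket_self]
      simp
    · ext x
      exact θ.1.2.1 x (hlift h u x)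
  w_add u v t := by
    refine Prod.ext (Subtype.ext ?_) ?_
    · change lieB (hlift h (u + v)) (hlift h t) - hlift h (lieB (u + v) t)
        = (lieB (hlift h u) (hlift h t) - hlift h (lieB u t))
          + (lieB (hlift h v) (hlift h t) - hlift h (lieB v t))
      rw [hlift_add, lieB_add_left, lieB_add_left, hlift_add]
      abel
    · change ev2 θ.1 (hlift h (u + v)) (hlift h t) = _
      rw [hlift_add, ev2_add_left]
      rfl
  w_fsmul f u t := by
    have h2 : lieD (hlift h t) (f.comp p) = (lieD t f).comp p := by
      ext x
      change mvfderiv I (f ∘ p) x (hlift h t x) = mvfderiv I' f (p x) (t (p x))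
      rw [mvfderiv_comp_apply (I' := I) (I := I') (g := f) (f := p) x (f.mdiff (p x))
        (p.contMDiff.contMDiffAt.mdifferentiableAt (by simp))]
      have h3 : mfderiv I I' p x (hlift h t x) = t (p x) := hlift_projects h t x
      rw [h3]
    have h3 : ∀ u v, hlift h (u - v) = hlift h u - hlift h v := fun u v =>
      ContMDiffSection.ext fun x => map_sub (h.lift x) (u (p x)) (v (p x))
    refine Prod.ext (Subtype.ext ?_) ?_
    · change lieB (hlift h (fsmul f u)) (hlift h t) - hlift h (lieB (fsmul f u) t)
        = fsmul (f.comp p) (lieB (hlift h u) (hlift h t) - hlift h (lieB u t))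
      rw [hlift_fsmul, lieB_fsmul_left, lieB_fsmul_left, h3, hlift_fsmul, hlift_fsmul, h2,
        sub_sub_sub_cancel_right]
      exact ContMDiffSection.ext fun x => (smul_sub (f (p x)) _ _).symm
    · change ev2 θ.1 (hlift h (fsmul f u)) (hlift h t) = _
      rw [hlift_fsmul, ev2_fsmul_left]
      rfl
  w_skew u v := by
    refine Prod.ext (Subtype.ext ?_) ?_
    · change lieB (hlift h u) (hlift h v) - hlift h (lieB u v)
        = -(lieB (hlift h v) (hlift h u) - hlift h (lieB v u))
      have h1 : hlift h (-lieB v u) = -hlift h (lieB v u) :=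
        ContMDiffSection.ext fun x => map_neg (h.lift x) (lieB v u (p x))
      rw [lieB_skew, lieB_skew u v, h1]
      abel
    · exact ev2_swap θ.1 (hlift h u) (hlift h v)

theorem formCouple_isOf [T2Space M] [T2Space B] (h : EhresmannConnection p) (θ : Closed2 I M)
    (hθ : restrict2 p θ.1 = ωV.1) : (formCouple h θ hθ).IsOf h θ.1 :=
  ⟨fun _ => rfl, fun _ _ => rfl, fun _ _ => rfl⟩

theorem Couple.ext_fields {c c' : Couple ωV.1} (hs : ∀ u, c.symbol u = c'.symbol u)
    (hD : ∀ u a, c.D u a = c'.D u a) (hw : ∀ u v, c.w u v = c'.w u v) : c = c' := by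
  obtain ⟨D, s, _, _, _, _, w, _, _, _, _⟩ := c
  obtain ⟨D', s', _, _, _, _, w', _, _, _, _⟩ := c'
  obtain rfl : D = D' := funext fun u => funext fun a => hD u a
  obtain rfl : s = s' := funext hs
  obtain rfl : w = w' := funext fun u => funext fun v => hw u v
  rfl

theorem Couple.IsOf.unique {c c' : Couple ωV.1} {h : EhresmannConnection p} {θ : Form2 I M}
    (hc : c.IsOf h θ) (hc' : c'.IsOf h θ) : c = c' :=
  Couple.ext_fields (fun u => by rw [hc.symbol_eq, hc'.symbol_eq])
    (fun u a => by rw [hc.D_eq, hc'.D_eq]) (fun u v => by rw [hc.w_eq, hc'.w_eq])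

theorem Couple.IsOf.curvEq_and_bianchiEq [T2Space M] [T2Space B] {c : Couple ωV.1}
    {h : EhresmannConnection p} {θ : Closed2 I M} (hθ : restrict2 p θ.1 = ωV.1)
    (hc : c.IsOf h θ.1) : CurvEq ωV.1 c.D c.w ∧ BianchiEq c.D c.w := by
  have hD : c.D = formD h θ.1 := funext fun u => funext fun a => hc.D_eq u a
  have hw : c.w = formW h θ.1 := funext fun u => funext fun v => hc.w_eq u v
  obtain ⟨-, -, h3, h4⟩ := (mem_closed2_iff h θ.1).1 θ.2
  rw [hD, hw, ← hθ]
  exact ⟨(closedEq3_iff h θ.1).1 h3, (closedEq4_iff h θ.1).1 h4⟩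

variable {F : Type*} [NormedAddCommGroup F] [NormedSpace ℝ F]
  {A : M → Type*}
  [TopologicalSpace (TotalSpace F A)] [∀ x, TopologicalSpace (A x)] [FiberBundle F A]
  [∀ x, AddCommGroup (A x)] [∀ x, Module ℝ (A x)] [VectorBundle ℝ F A]
  {L : LieAlgebroid I F A}

theorem Couple.IsInduced.unique {c c' : Couple ωV.1} {e : Extension p ωV L}
    {k : HorSplitting p L} (hc : c.IsInduced e k) (hc' : c'.IsInduced e k) : c = c' :=
  Couple.ext_fields
    (fun u => ContMDiffSection.ext fun x => by rw [hc.symbol_eq, hc'.symbol_eq])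
    (fun u a => e.inclSec_injective (by rw [hc.D_eq, hc'.D_eq]))
    (fun u v => e.inclSec_injective (by rw [hc.w_eq, hc'.w_eq]))

/-- The composition of a splitting of the anchor with a horizontal lift. -/
def AnchorSplitting.compLift (σ : AnchorSplitting L) (h : EhresmannConnection p) :
    HorSplitting p L where
  map x := (σ.map x).comp (h.lift x)
  mfderiv_map x w := by
    rw [LinearMap.comp_apply, σ.anchor_map, h.mfderiv_lift]
  contMDiff_map u := σ.contMDiff_map (hlift h u)

/-- The connection whose horizontal lift is the anchor of a splitting over the base. -/
def HorSplitting.connection (k : HorSplitting p L) : EhresmannConnection p where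
  lift x := (L.anchor x).comp (k.map x)
  mfderiv_lift x w := k.mfderiv_map x w
  contMDiff_lift u := L.contMDiff_anchor (k.sec u)

/-- The splitting of the anchor that extends `k` by the inclusion `v ↦ i(v, 0)` of vertical
vectors. -/
def HorSplitting.anchorSplitting [T2Space B] (k : HorSplitting p L) (e : Extension p ωV L) :
    AnchorSplitting L where
  map x := (e.incl x).comp ((LinearMap.inl ℝ (vert p x) ℝ).comp (verProj k.connection x))
    + (k.map x).comp (mfderiv I I' p x : TangentSpace I x →ₗ[ℝ] TangentSpace I' (p x))
  anchor_map x v := by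
    change L.anchor x (e.incl x (verProj k.connection x v, 0) + k.map x (mfderiv I I' p x v)) = v
    rw [map_add, e.anchor_incl]
    exact verProj_add_lift k.connection x v
  contMDiff_map X := (e.inclSec (ver k.connection X, 0)).contMDiff.add_section
    (contMDiff_comp_mfderiv k.map k.contMDiff_map X)

theorem HorSplitting.anchorSplitting_map [T2Space B] (k : HorSplitting p L)
    (e : Extension p ωV L) (x : M) (v : TangentSpace I x) : (k.anchorSplitting e).map x v
      = e.incl x (verProj k.connection x v, 0) + k.map x (mfderiv I I' p x v) := rfl

theorem HorSplitting.anchorSplitting_vert [T2Space B] (k : HorSplitting p L)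
    (e : Extension p ωV L) (x : M) (v : vert p x) :
    (k.anchorSplitting e).map x (v : TangentSpace I x) = e.incl x (v, 0) := by
  have hv : mfderiv I I' p x (v : TangentSpace I x) = 0 := v.2
  rw [anchorSplitting_map, verProj_vert, hv, map_zero, add_zero]

theorem HorSplitting.anchorSplitting_lift [T2Space B] (k : HorSplitting p L)
    (e : Extension p ωV L) (x : M) (w : TangentSpace I' (p x)) :
    (k.anchorSplitting e).map x (k.connection.lift x w) = k.map x w := by
  rw [anchorSplitting_map, verProj_lift, k.connection.mfderiv_lift]
  change e.incl x 0 + _ = _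
  rw [map_zero, zero_add]

theorem HorSplitting.anchorSplitting_sec_vert [T2Space B] (k : HorSplitting p L)
    (e : Extension p ωV L) (Y : VSec p) : (k.anchorSplitting e).sec Y.1 = e.inclSec (Y, 0) :=
  ContMDiffSection.ext fun x => k.anchorSplitting_vert e x (vat Y x)

theorem HorSplitting.anchorSplitting_sec_hlift [T2Space B] (k : HorSplitting p L)
    (e : Extension p ωV L) (u : VField I' B) :
    (k.anchorSplitting e).sec (hlift k.connection u) = k.sec u :=
  ContMDiffSection.ext fun x => k.anchorSplitting_lift e x (u (p x))

/-- On vertical vectors the splitting `i ⊕ k` is `i(·, 0)`, so its curvature form restricts to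
`ωV`. -/
theorem HorSplitting.restrict2_eq [T2Space M] [T2Space B] (k : HorSplitting p L)
    (e : Extension p ωV L) {θ : Form2 I M}
    (hθ : ∀ X Y, (k.anchorSplitting e).curvature X Y = fsmul (ev2 θ X Y) e.center) :
    restrict2 p θ = ωV.1 := by
  refine vform2_ext k.connection fun Y Z => e.fsmul_center_injective ?_
  have h0 : ∀ X : VField I M, lieD X 0 = 0 := fun X => lieD_zero X
  have h1 : L.bracket (e.inclSec (Y, 0)) (e.inclSec (Z, 0))
      = e.inclSec (vbr Y Z, lieD Y.1 0 - lieD Z.1 0 + vev2 ωV.1 Y Z) := e.bracket_incl (Y, 0) (Z, 0)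
  have h2 : (k.anchorSplitting e).sec (lieB Y.1 Z.1) = e.inclSec (vbr Y Z, 0) :=
    k.anchorSplitting_sec_vert e (vbr Y Z)
  change fsmul (ev2 θ Y.1 Z.1) e.center = _
  rw [← hθ, AnchorSplitting.curvature, k.anchorSplitting_sec_vert, k.anchorSplitting_sec_vert, h1,
    h0, h0, e.inclSec_eq, h2, add_sub_cancel_left, sub_self, zero_add]

/-- The couple of the curvature form of the splitting `i ⊕ k` is the one induced by `k`. -/
theorem HorSplitting.isInduced [T2Space M] [T2Space B] (k : HorSplitting p L)
    (e : Extension p ωV L) (θ : Closed2 I M)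
    (hθ : ∀ X Y, (k.anchorSplitting e).curvature X Y = fsmul (ev2 θ.1 X Y) e.center)
    (hr : restrict2 p θ.1 = ωV.1) :
    (formCouple k.connection θ hr).IsInduced e k := by
  set σ := k.anchorSplitting e with hσ
  have hb : ∀ X Y, L.bracket (σ.sec X) (σ.sec Y)
      = σ.sec (lieB X Y) + fsmul (ev2 θ.1 X Y) e.center := fun X Y => by
    rw [← hθ, AnchorSplitting.curvature, add_sub_cancel]
  refine ⟨fun u x => rfl, fun u s => ?_, fun u v => ?_⟩
  · rw [e.inclSec_eq, e.inclSec_eq s, ← k.anchorSplitting_sec_vert, ← k.anchorSplitting_sec_vert,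
      ← k.anchorSplitting_sec_hlift e, ← hσ, L.bracket_add, e.bracket_fsmul_center,
      σ.anchorSec_sec, hb, add_assoc, ← fsmul_add_left, add_comm (ev2 _ _ _)]
    rfl
  · rw [e.inclSec_eq, ← k.anchorSplitting_sec_vert, ← k.anchorSplitting_sec_hlift e,
      ← k.anchorSplitting_sec_hlift e, ← k.anchorSplitting_sec_hlift e, ← hσ, hb]
    change σ.sec (lieB (hlift k.connection u) (hlift k.connection v)
      - hlift k.connection (lieB u v)) + fsmul (ev2 θ.1 _ _) e.center = _
    rw [σ.sec_sub]
    abel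

end HorizontalSplittings

/-! ### The two-form of a couple -/

section Couples

variable {p : C^∞⟮I, M; I', B⟯} {ωV : VClosed2 p}

theorem avBracket_zero_right (η : VForm2 p) (b : ASec p) (f : SFun I M) :
    avBracket η b (0, f) = (0, lieD b.1.1 f) := by
  refine Prod.ext (Subtype.ext (lieB_zero_right b.1.1)) ?_
  change lieD b.1.1 f - lieD (0 : VField I M) b.2 + vev2 η b.1 0 = lieD b.1.1 f
  have h1 : lieD (0 : VField I M) b.2 = 0 := by
    ext x
    exact map_zero (mvfderiv I b.2 x)
  have h2 : vev2 η b.1 0 = 0 := by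
    ext x
    exact map_zero (η.1 x (vat b.1 x))
  rw [h1, h2, sub_zero, add_zero]

theorem Couple.D_zero_right (c : Couple ωV.1) (u : VField I' B) (g : SFun I M) :
    c.D u (0, g) = (0, lieD (c.symbol u) g) := by
  have h0 : ∀ f : SFun I M, asmul f ((0, 1) : ASec p) = (0, f) := fun f => by
    refine Prod.ext (Subtype.ext (ContMDiffSection.ext fun x => smul_zero (f x))) ?_
    exact mul_one f
  have h1 := (c.isSymmetry u).leibniz g (0, 1)
  rw [h0, h0, (c.isSymmetry u).central] at h1
  rw [h1]
  have h2 : asmul g (0 : ASec p) = 0 :=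
    Prod.ext (Subtype.ext (ContMDiffSection.ext fun x => smul_zero (g x))) (mul_zero g)
  rw [h2, zero_add]

theorem Couple.lieD_symbol (c : Couple ωV.1) (u : VField I' B) (g : SFun I M) :
    lieD (c.symbol u) g = (c.D u (0, g)).2 := by
  rw [c.D_zero_right]

/-- The symbols of the symmetries of a couple are the horizontal lifts of a connection. -/
theorem Couple.exists_connection [T2Space M] [T2Space B] (c : Couple ωV.1) :
    ∃ h : EhresmannConnection p, ∀ u, hlift h u = c.symbol u := by
  have hadd : ∀ u v, c.symbol (u + v) = c.symbol u + c.symbol v := fun u v =>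
    eq_of_lieD_eq fun g => by
      rw [lieD_add_left, c.lieD_symbol, c.lieD_symbol, c.lieD_symbol, c.D_add]
      rfl
  have hsmul : ∀ (f : SFun I' B) u, c.symbol (fsmul f u) = fsmul (f.comp p) (c.symbol u) :=
    fun f u => eq_of_lieD_eq fun g => by
      rw [lieD_fsmul_left, c.lieD_symbol, c.lieD_symbol, c.D_fsmul]
      rfl
  choose l hl using fun x : M => exists_tensor (x₀ := p x)
    (fun u : VField I' B => c.symbol u x) (fun u v => by rw [hadd]; rfl)
    (fun f u => by rw [hsmul]; rfl)
  refine ⟨⟨l, fun x w => ?_, fun u => ?_⟩, fun u => ?_⟩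
  · obtain ⟨u, rfl⟩ := exists_section_eq I' E' w
    rw [← hl]
    exact c.projects u x
  · simp only [← hl]
    exact (c.symbol u).contMDiff
  · exact ContMDiffSection.ext fun x => (hl x u).symm

/-- The vertical component of `D_u(Y, g)` is forced to be `[h(u), Y]`, by the derivation property
for the bracket with `(0, f)`. -/
theorem Couple.D_fst [T2Space M] (c : Couple ωV.1) {h : EhresmannConnection p}
    (hh : ∀ u, hlift h u = c.symbol u) (u : VField I' B) (a : ASec p) :
    (c.D u a).1 = brH h u a.1 := by
  apply Subtype.ext
  refine eq_of_lieD_eq fun f => ?_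
  have h1 := (c.isSymmetry u).bracket a (0, f)
  rw [avBracket_zero_right, c.D_zero_right, c.D_zero_right, avBracket_zero_right,
    avBracket_zero_right] at h1
  have h2 : lieD (c.symbol u) (lieD a.1.1 f)
      = lieD (c.D u a).1.1 f + lieD a.1.1 (lieD (c.symbol u) f) := congrArg Prod.snd h1
  change _ = lieD (lieB (hlift h u) a.1.1) f
  rw [lieD_lieB, hh, h2, add_sub_cancel_right]

/-- The curvature equation on sections `(0, f)` forces the vertical component of `w` to be the
curvature of the connection. -/
theorem Couple.w_fst [T2Space M] (c : Couple ωV.1) {h : EhresmannConnection p}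
    (hh : ∀ u, hlift h u = c.symbol u) (hc : CurvEq ωV.1 c.D c.w) (u v : VField I' B) :
    (c.w u v).1 = curv h u v := by
  apply Subtype.ext
  refine eq_of_lieD_eq fun f => ?_
  have h1 := hc u v (0, f)
  simp only [c.D_zero_right, ← hh, avBracket_zero_right] at h1
  have h2 : lieD (hlift h u) (lieD (hlift h v) f) - lieD (hlift h v) (lieD (hlift h u) f)
      - lieD (hlift h (lieB u v)) f = lieD (c.w u v).1.1 f := congrArg Prod.snd h1
  change _ = lieD (lieB (hlift h u) (hlift h v) - hlift h (lieB u v)) f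
  rw [lieD_sub_left, lieD_lieB, h2]

/-- Real-valued version of `contMDiff_comp_mfderiv`. -/
theorem contMDiff_real_comp_mfderiv [T2Space B] (κ : ∀ x : M, TangentSpace I' (p x) →ₗ[ℝ] ℝ)
    (hκ : ∀ u : VField I' B, ContMDiff I 𝓘(ℝ, ℝ) ∞ fun x => κ x (u (p x))) (X : VField I M) :
    ContMDiff I 𝓘(ℝ, ℝ) ∞ fun x => κ x (mfderiv I I' p x (X x)) := fun x =>
  (Bundle.contMDiffAt_section (E := Bundle.Trivial M ℝ) x).1
    (contMDiff_comp_mfderiv (A := Bundle.Trivial M ℝ) κ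
      (fun u y => (Bundle.contMDiffAt_section (E := Bundle.Trivial M ℝ) y).2 (hκ u y)) X x)

/-- A two-form is determined by its components with respect to a connection. -/
theorem form2_eq_of_components [T2Space M] [T2Space B] (h : EhresmannConnection p)
    {θ θ' : Form2 I M} (h1 : restrict2 p θ = restrict2 p θ')
    (h2 : ∀ u (Y : VSec p), ev2 θ (hlift h u) Y.1 = ev2 θ' (hlift h u) Y.1)
    (h3 : ∀ u v, ev2 θ (hlift h u) (hlift h v) = ev2 θ' (hlift h u) (hlift h v)) : θ = θ' := by
  refine form2_ext fun X Y => ContMDiffMap.ext fun x => ?_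
  obtain ⟨u, hu⟩ := exists_ver_add_hlift h X x
  obtain ⟨v, hv⟩ := exists_ver_add_hlift h Y x
  have h4 : ∀ Y Z : VSec p, ev2 θ Y.1 Z.1 = ev2 θ' Y.1 Z.1 := fun Y Z =>
    congrArg (fun η => vev2 η Y Z) h1
  have h5 : ∀ θ : Form2 I M, ev2 θ X Y x
      = ev2 θ ((ver h X).1 + hlift h u) ((ver h Y).1 + hlift h v) x := fun θ => by
    change θ.1 x (X x) (Y x) = θ.1 x _ _
    rw [hu, hv]
  rw [h5, h5]
  simp only [ev2_add_left, ev2_add_right]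
  rw [h4, h2, h3, ev2_swap θ (ver h X).1 (hlift h v), ev2_swap θ' (ver h X).1 (hlift h v), h2]

/-- The components of a couple assemble to a two-form: its value on `X, Y` is
`ω_V(X_V, Y_V) + α(dp X)(Y_V) - α(dp Y)(X_V) + κ(dp X, dp Y)`, where `α(u)(Y)` is the function
component of `D_u(Y, 0)` and `κ` that of `w`. -/
theorem Couple.exists_form2 [T2Space M] [T2Space B] (c : Couple ωV.1)
    (h : EhresmannConnection p) :
    ∃ θ : Form2 I M, restrict2 p θ = ωV.1 ∧
      (∀ u (Y : VSec p), ev2 θ (hlift h u) Y.1 = (c.D u (Y, 0)).2) ∧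
      ∀ u v, ev2 θ (hlift h u) (hlift h v) = (c.w u v).2 := by
  have hDadd : ∀ u (Y Z : VSec p), (c.D u (Y + Z, 0)).2 = (c.D u (Y, 0)).2 + (c.D u (Z, 0)).2 := by
    intro u Y Z
    have h1 := (c.isSymmetry u).map_add (Y, 0) (Z, 0)
    rw [Prod.mk_add_mk, add_zero] at h1
    rw [h1]
    rfl
  have hDsmul : ∀ u (f : SFun I M) (Y : VSec p),
      (c.D u (vfsmul f Y, 0)).2 = f * (c.D u (Y, 0)).2 := by
    intro u f Y
    have h1 := (c.isSymmetry u).leibniz f (Y, 0)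
    have h2 : asmul f ((Y, 0) : ASec p) = (vfsmul f Y, 0) := Prod.ext rfl (mul_zero f)
    rw [h2] at h1
    rw [h1]
    change f * (c.D u (Y, 0)).2 + lieD (c.symbol u) f * 0 = _
    rw [mul_zero, add_zero]
  have hwfsmul : ∀ (f : SFun I' B) u v, c.w u (fsmul f v) = asmul (f.comp p) (c.w u v) := by
    intro f u v
    rw [c.w_skew, c.w_fsmul, c.w_skew u v]
    refine Prod.ext (Subtype.ext (ContMDiffSection.ext fun x => ?_)) ?_
    · exact (smul_neg (f (p x)) _).symm
    · exact (mul_neg (f.comp p) _).symm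
  choose α hα using fun x : M => exists_tensor₂ (x₀ := p x) (y₀ := x)
    (fun (u : VField I' B) (X : VField I M) => (c.D u (ver h X, 0)).2 x)
    (fun u u' X => by rw [c.D_add]; rfl) (fun f u X => by rw [c.D_fsmul]; rfl)
    (fun u X X' => by rw [ver_add, hDadd]; rfl) (fun f u X => by rw [ver_fsmul, hDsmul]; rfl)
  choose κ hκ using fun x : M => exists_tensor₂ (x₀ := p x) (y₀ := p x)
    (fun u v : VField I' B => (c.w u v).2 x)
    (fun u u' v => by rw [c.w_add]; rfl) (fun f u v => by rw [c.w_fsmul]; rfl)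
    (fun u v v' => by rw [c.w_skew, c.w_add, c.w_skew u v, c.w_skew u v', neg_add]; rfl)
    (fun f u v => by rw [hwfsmul]; rfl)
  have hα' : ∀ u (Y : VSec p) x, α x (u (p x)) (Y.1 x) = (c.D u (Y, 0)).2 x := fun u Y x => by
    rw [← hα, ver_vertical]
  let dp : ∀ x : M, TangentSpace I x →ₗ[ℝ] TangentSpace I' (p x) := fun x =>
    (mfderiv I I' p x : TangentSpace I x →ₗ[ℝ] TangentSpace I' (p x))
  let μ : ∀ x : M, TangentSpace I x →ₗ[ℝ] TangentSpace I x →ₗ[ℝ] ℝ := fun x =>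
    (α x).compl₁₂ (dp x) ((vert p x).subtype.comp (verProj h x))
  let θ : Bilin I M := fun x => (ωV.1.1 x).compl₁₂ (verProj h x) (verProj h x)
    + (μ x - (μ x).flip) + (κ x).compl₁₂ (dp x) (dp x)
  have hθ : ∀ x v w, θ x v w = ωV.1.1 x (verProj h x v) (verProj h x w)
      + (α x (mfderiv I I' p x v) (verProj h x w) - α x (mfderiv I I' p x w) (verProj h x v))
      + κ x (mfderiv I I' p x v) (mfderiv I I' p x w) := fun x v w => rfl
  have hμ : ∀ X Y : VField I M, ContMDiff I 𝓘(ℝ, ℝ) ∞ fun x =>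
      α x (mfderiv I I' p x (X x)) (verProj h x (Y x)) := fun X Y =>
    contMDiff_real_comp_mfderiv
      (fun x => (α x).flip (verProj h x (Y x) : TangentSpace I x)) (fun u => by
        have h1 : (fun x => (α x).flip (verProj h x (Y x) : TangentSpace I x) (u (p x)))
            = fun x => (c.D u (ver h Y, 0)).2 x := funext fun x => hα' u (ver h Y) x
        rw [h1]
        exact (c.D u (ver h Y, 0)).2.contMDiff) X
  have hκs : ∀ X Y : VField I M, ContMDiff I 𝓘(ℝ, ℝ) ∞ fun x =>
      κ x (mfderiv I I' p x (X x)) (mfderiv I I' p x (Y x)) := fun X Y =>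
    contMDiff_real_comp_mfderiv (fun x => (κ x).flip (mfderiv I I' p x (Y x)))
      (fun u => contMDiff_real_comp_mfderiv (fun x => κ x (u (p x))) (fun v => by
        simp only [← hκ]
        exact (c.w u v).2.contMDiff) Y) X
  have hmem : θ ∈ Form2 I M := by
    refine ⟨fun x v => ?_, fun X Y => ?_⟩
    · obtain ⟨u, hu⟩ := exists_section_eq I' E' (mfderiv I I' p x v)
      rw [hθ, sub_self, add_zero, ωV.1.2.1, zero_add, ← hu, ← hκ, c.w_self]
      rfl
    · simp only [hθ]
      exact ((vev2 ωV.1 (ver h X) (ver h Y)).contMDiff.add ((hμ X Y).sub (hμ Y X))).add (hκs X Y)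
  refine ⟨⟨θ, hmem⟩, ?_, fun u Y => ContMDiffMap.ext fun x => ?_,
    fun u v => ContMDiffMap.ext fun x => ?_⟩
  · refine vform2_ext h fun Y Z => ContMDiffMap.ext fun x => ?_
    change θ x (Y.1 x) (Z.1 x) = ωV.1.1 x (vat Y x) (vat Z x)
    have hY : mfderiv I I' p x (Y.1 x) = 0 := Y.2 x
    have hZ : mfderiv I I' p x (Z.1 x) = 0 := Z.2 x
    have hY' : verProj h x (Y.1 x) = vat Y x := verProj_vert h x (vat Y x)
    have hZ' : verProj h x (Z.1 x) = vat Z x := verProj_vert h x (vat Z x)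
    rw [hθ, hY, hZ, hY', hZ']
    simp
  · change θ x (h.lift x (u (p x))) (Y.1 x) = _
    have hY : mfderiv I I' p x (Y.1 x) = 0 := Y.2 x
    have hY' : verProj h x (Y.1 x) = vat Y x := verProj_vert h x (vat Y x)
    rw [hθ, h.mfderiv_lift, verProj_lift, hY, hY', ← hα']
    simp [vat]
  · change θ x (h.lift x (u (p x))) (h.lift x (v (p x))) = _
    rw [hθ, h.mfderiv_lift, h.mfderiv_lift, verProj_lift, verProj_lift, hκ]
    simp

theorem EhresmannConnection.ext_hlift [T2Space B] {h h' : EhresmannConnection p}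
    (hh : ∀ u, hlift h u = hlift h' u) : h = h' := by
  have h1 : h.lift = h'.lift := by
    funext x
    ext w
    obtain ⟨u, rfl⟩ := exists_section_eq I' E' w
    exact congrArg (fun X : VField I M => X x) (hh u)
  obtain ⟨l, _, _⟩ := h
  obtain ⟨l', _, _⟩ := h'
  obtain rfl : l = l' := h1
  rfl

/-- Couples subject to the structure equations come from a unique connection and closed two-form. -/
theorem Couple.existsUnique_isOf [T2Space M] [T2Space B] (c : Couple ωV.1)
    (hc : CurvEq ωV.1 c.D c.w) (hb : BianchiEq c.D c.w) :
    ∃! q : EhresmannConnection p × Closed2 I M,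
      restrict2 p q.2.1 = ωV.1 ∧ c.IsOf q.1 q.2.1 := by
  obtain ⟨h, hh⟩ := c.exists_connection
  obtain ⟨θ, hr, hα, hκ⟩ := c.exists_form2 h
  have hD : c.D = formD h θ := by
    funext u a
    refine Prod.ext (c.D_fst hh u a) ?_
    have h1 := (c.isSymmetry u).map_add (a.1, 0) (0, a.2)
    rw [Prod.mk_add_mk, add_zero, zero_add, c.D_zero_right] at h1
    have h2 : (c.D u a).2 = (c.D u (a.1, 0)).2 + lieD (c.symbol u) a.2 := congrArg Prod.snd h1
    rw [h2, ← hα, ← hh, add_comm]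
    rfl
  have hw : c.w = formW h θ := by
    funext u v
    exact Prod.ext (c.w_fst hh hc u v) (hκ u v).symm
  have hθ : θ ∈ Closed2 I M := by
    refine (mem_closed2_iff h θ).2 ⟨fun Y Z W => ?_, (closedEq2_iff h θ).2 fun u => ?_,
      (closedEq3_iff h θ).2 ?_, (closedEq4_iff h θ).2 ?_⟩
    · rw [hr]
      exact ωV.2 Y Z W
    · rw [hr, ← hD, hh]
      exact c.isSymmetry u
    · rw [hr, ← hD, ← hw]
      exact hc
    · rw [← hD, ← hw]
      exact hb
  refine ⟨(h, ⟨θ, hθ⟩), ⟨hr, fun u => (hh u).symm, fun u a => by rw [hD], fun u v => by rw [hw]⟩,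
    ?_⟩
  rintro ⟨h', θ', hθ'⟩ ⟨hr', hs', hD', hw'⟩
  obtain rfl : h' = h := EhresmannConnection.ext_hlift fun u => by rw [hh, hs']
  have h1 : θ' = θ := by
    refine form2_eq_of_components h' (hr'.trans hr.symm) (fun u Y => ?_) fun u v => ?_
    · rw [hα, hD']
      change _ = lieD (hlift h' u) 0 + ev2 θ' (hlift h' u) Y.1
      rw [lieD_zero, zero_add]
    · rw [hκ, hw']
      rfl
  subst h1
  rfl

end Couples

/-! ### Correspondences -/

section Correspondence

variable {p : C^∞⟮I, M; I', B⟯} {ωV : VClosed2 p}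
  {F : Type*} [NormedAddCommGroup F] [NormedSpace ℝ F] [FiniteDimensional ℝ F] {A : M → Type*}
  [TopologicalSpace (TotalSpace F A)] [∀ x, TopologicalSpace (A x)] [FiberBundle F A]
  [∀ x, AddCommGroup (A x)] [∀ x, Module ℝ (A x)] [VectorBundle ℝ F A]
  [ContMDiffVectorBundle ∞ F A I] {L : LieAlgebroid I F A}

theorem restrictH_eq_iff_exists_extension (hp : ∀ x : M, Function.Surjective (mfderiv I I' p x))
    (θ : Closed2 I M) : restrictH p (class2 θ) = vclass2 ωV ↔
      ∃ e : Extension p ωV (preqAlgebroid θ), ∀ x, e.incl x (0, 1) = (0, (1 : ℝ)) := by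
  rw [restrictH_class2_eq_iff]
  constructor
  · rintro ⟨γ, hγ⟩
    refine ⟨preqExtension hp θ γ hγ, fun x => ?_⟩
    rw [preqExtension_incl, map_zero, add_zero]
    rfl
  · rintro ⟨e, he⟩
    obtain ⟨γ, hγ⟩ := exists_vform_of_incl e he
    exact ⟨γ, vev2_eq_of_incl e hγ⟩

/-- An extension is equivalent to the algebroid of the curvature form of any splitting of its
anchor. -/
theorem AnchorSplitting.existsUnique_form (hp : ∀ x : M, Function.Surjective (mfderiv I I' p x))
    [T2Space M] (e : Extension p ωV L) (σ : AnchorSplitting L) :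
    ∃! θ : Closed2 I M,
      restrictH p (class2 θ) = vclass2 ωV ∧
      (∀ (X Y : VField I M) (x : M), σ.curvature X Y x = e.incl x (0, ev2 θ.1 X Y x)) ∧
      ∃ e' : Extension p ωV (preqAlgebroid θ), (∀ x, e'.incl x (0, 1) = (0, (1 : ℝ))) ∧
        ∃ Φ : ExtensionIso e' e, ∀ x (v : TangentSpace I x),
          Φ.map x (v, (0 : ℝ)) = σ.map x v := by
  obtain ⟨θ, hθ⟩ := σ.exists_form2 e
  have hc := σ.mem_closed2 e hθ
  let Φ := splitIso σ e ⟨θ, hc⟩ hθ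
  have h1 : ∀ x, (e.comap Φ).incl x (0, 1) = (0, (1 : ℝ)) := fun x => by
    rw [Extension.comap_incl, LinearEquiv.symm_apply_eq]
    refine Eq.symm ((splitIso_map σ e ⟨θ, hc⟩ hθ x 0 1).trans ?_)
    rw [map_zero, zero_add, one_smul]
    rfl
  refine ⟨⟨θ, hc⟩, ⟨(restrictH_eq_iff_exists_extension hp _).2 ⟨_, h1⟩, fun X Y x => ?_,
    e.comap Φ, h1, e.comapIso Φ, fun x v => ?_⟩, ?_⟩
  · rw [hθ, e.incl_zero]
    rfl
  · refine (splitIso_map σ e ⟨θ, hc⟩ hθ x v 0).trans ?_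
    rw [zero_smul, add_zero]
  · rintro θ' ⟨-, h2, -⟩
    refine Subtype.ext (form2_ext fun X Y => e.fsmul_center_injective ?_)
    refine ContMDiffSection.ext fun x => ?_
    change ev2 θ'.1 X Y x • e.center x = (fsmul (ev2 θ X Y) e.center) x
    rw [← e.incl_zero, ← h2, hθ]

/-- The couple of a connection and a closed two-form is induced by the algebroid of the form. -/
theorem exists_preq_isInduced [T2Space M] [T2Space B] (h : EhresmannConnection p)
    (θ : Closed2 I M) (hθ : restrict2 p θ.1 = ωV.1) :
    ∃ (e : Extension p ωV (preqAlgebroid θ)) (k : HorSplitting p (preqAlgebroid θ))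
      (c : Couple ωV.1),
      (∀ x (v : vert p x) (t : ℝ), e.incl x (v, t) = ((v : TangentSpace I x), t)) ∧
      (∀ x (w : TangentSpace I' (p x)), k.map x w = (h.lift x w, (0 : ℝ))) ∧
      c.IsInduced e k ∧ c.IsOf h θ.1 := by
  have h0 : ∀ Y Z : VSec p,
      vev2 ωV.1 Y Z = vev2 (restrict2 p θ.1) Y Z + dV1 (0 : VForm1 p) Y Z := by
    intro Y Z
    have h1 := dV1_smul 0 (0 : VForm1 p) Y Z
    rw [zero_smul, zero_smul] at h1
    rw [h1, hθ, add_zero]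
  let e := preqExtension (fun x w => ⟨h.lift x w, h.mfderiv_lift x w⟩) θ 0 h0
  have he : ∀ x (v : vert p x) (t : ℝ), e.incl x (v, t) = ((v : TangentSpace I x), t) :=
    fun x v t => Prod.ext rfl (add_zero t)
  let k : HorSplitting p (preqAlgebroid θ) :=
    { map := fun x => (LinearMap.inl ℝ (TangentSpace I x) ℝ).comp (h.lift x)
      mfderiv_map := h.mfderiv_lift
      contMDiff_map := fun u => (preqMk (hlift h u) 0).contMDiff }
  have hi : ∀ s, e.inclSec s = preqMk s.1.1 s.2 := fun s =>
    ContMDiffSection.ext fun x => he x (vat s.1 x) (s.2 x)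
  have hk : ∀ u, k.sec u = preqMk (hlift h u) 0 := fun u => rfl
  refine ⟨e, k, formCouple h θ hθ, he, fun x w => rfl, ⟨fun u x => rfl, fun u s => ?_,
    fun u v => ?_⟩, formCouple_isOf h θ hθ⟩
  · rw [hi, hi, hk]
    apply preq_ext
    · rfl
    · change lieD (hlift h u) s.2 + ev2 θ.1 (hlift h u) s.1.1
        = lieD (hlift h u) s.2 - lieD s.1.1 0 + ev2 θ.1 (hlift h u) s.1.1
      rw [lieD_zero, sub_zero]
  · rw [hi, hk, hk, hk]
    apply preq_ext
    · rfl
    · change ev2 θ.1 (hlift h u) (hlift h v)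
        = lieD (hlift h u) 0 - lieD (hlift h v) 0 + ev2 θ.1 (hlift h u) (hlift h v) - 0
      rw [lieD_zero, lieD_zero, sub_zero, sub_zero, zero_add]

/-- A splitting over the base induces a unique couple, that of the curvature form of the splitting
`i ⊕ k` of the anchor, and the extension is equivalent to the algebroid of this form. -/
theorem HorSplitting.correspondence [T2Space M] [T2Space B] (e : Extension p ωV L)
    (k : HorSplitting p L) :
    (∃! c : Couple ωV.1, c.IsInduced e k) ∧
    ∀ c : Couple ωV.1, c.IsInduced e k →
      CurvEq ωV.1 c.D c.w ∧ BianchiEq c.D c.w ∧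
      ∃ (h : EhresmannConnection p) (θ : Closed2 I M),
        restrict2 p θ.1 = ωV.1 ∧ c.IsOf h θ.1 ∧
        ∃ e' : Extension p ωV (preqAlgebroid θ),
          (∀ x (v : vert p x) (t : ℝ), e'.incl x (v, t) = ((v : TangentSpace I x), t)) ∧
          ∃ Φ : ExtensionIso e' e,
            ∀ x (w : TangentSpace I' (p x)), Φ.map x (h.lift x w, (0 : ℝ)) = k.map x w := by
  obtain ⟨θ, hθ⟩ := (k.anchorSplitting e).exists_form2 e
  have hc := (k.anchorSplitting e).mem_closed2 e hθ
  have hr := k.restrict2_eq e hθ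
  have hind := k.isInduced e ⟨θ, hc⟩ hθ hr
  refine ⟨⟨_, hind, fun c' hc' => hc'.unique hind⟩, fun c hci => ?_⟩
  obtain rfl := hci.unique hind
  have hof := formCouple_isOf k.connection ⟨θ, hc⟩ hr
  obtain ⟨h3, h4⟩ := hof.curvEq_and_bianchiEq hr
  let Φ := splitIso (k.anchorSplitting e) e ⟨θ, hc⟩ hθ
  refine ⟨h3, h4, k.connection, ⟨θ, hc⟩, hr, hof, e.comap Φ, fun x v t => ?_, e.comapIso Φ,
    fun x w => ?_⟩
  · rw [Extension.comap_incl, LinearEquiv.symm_apply_eq]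
    refine Eq.symm ((splitIso_map _ e ⟨θ, hc⟩ hθ x v t).trans ?_)
    rw [k.anchorSplitting_vert, ← e.incl_eq]
  · refine (splitIso_map _ e ⟨θ, hc⟩ hθ x _ 0).trans ?_
    rw [zero_smul, add_zero, k.anchorSplitting_lift]

end Correspondence

end

end ClosedExtension

theorem mainTheorem6
    {E : Type*} [NormedAddCommGroup E] [NormedSpace ℝ E] [FiniteDimensional ℝ E]
    {H : Type*} [TopologicalSpace H] (I : ModelWithCorners ℝ E H) [I.Boundaryless]
    {M : Type*} [TopologicalSpace M] [ChartedSpace H M] [IsManifold I ∞ M]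
    [T2Space M] [SigmaCompactSpace M]
    {E' : Type*} [NormedAddCommGroup E'] [NormedSpace ℝ E'] [FiniteDimensional ℝ E']
    {H' : Type*} [TopologicalSpace H'] (I' : ModelWithCorners ℝ E' H') [I'.Boundaryless]
    {B : Type*} [TopologicalSpace B] [ChartedSpace H' B] [IsManifold I' ∞ B]
    [T2Space B] [SigmaCompactSpace B]
    (p : C^∞⟮I, M; I', B⟯) (hp : IsCompleteFibration p) (ωV : VClosed2 p) :
    -- the class of a closed form `θ` restricts to that of `ωV` iff `A_θ` is an extension of `A_V`
    (∀ θ : Closed2 I M, restrictH p (class2 θ) = vclass2 ωV ↔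
      ∃ e : Extension p ωV (preqAlgebroid θ), ∀ x, e.incl x (0, 1) = (0, (1 : ℝ))) ∧
    -- these extensions are given by the primitives of `ωV - θ|_V`
    (∀ (θ : Closed2 I M) (γ : VForm1 p),
      (∀ Y Z : VSec p, vev2 ωV.1 Y Z = vev2 (restrict2 p θ.1) Y Z + dV1 γ Y Z) ↔
      ∃ e : Extension p ωV (preqAlgebroid θ),
        ∀ x (v : vert p x) (t : ℝ), e.incl x (v, t) = ((v : TangentSpace I x), t + γ.1 x v)) ∧
    (∀ (θ : Closed2 I M) (e : Extension p ωV (preqAlgebroid θ)),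
      (∀ x, e.incl x (0, 1) = (0, (1 : ℝ))) →
      ∃ γ : VForm1 p,
        ∀ x (v : vert p x) (t : ℝ), e.incl x (v, t) = ((v : TangentSpace I x), t + γ.1 x v)) ∧
    -- every extension is equivalent to one of these, through the curvature of a splitting
    (∀ (F : Type*) [NormedAddCommGroup F] [NormedSpace ℝ F] [FiniteDimensional ℝ F] (A : M → Type*)
      [TopologicalSpace (TotalSpace F A)] [∀ x, TopologicalSpace (A x)] [FiberBundle F A]
      [∀ x, AddCommGroup (A x)] [∀ x, Module ℝ (A x)] [VectorBundle ℝ F A]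
      [ContMDiffVectorBundle ∞ F A I] (L : LieAlgebroid I F A) (e : Extension p ωV L),
      Nonempty (AnchorSplitting L) ∧
      ∀ σ : AnchorSplitting L, ∃! θ : Closed2 I M,
        restrictH p (class2 θ) = vclass2 ωV ∧
        (∀ (X Y : VField I M) (x : M), σ.curvature X Y x = e.incl x (0, ev2 θ.1 X Y x)) ∧
        ∃ e' : Extension p ωV (preqAlgebroid θ), (∀ x, e'.incl x (0, 1) = (0, (1 : ℝ))) ∧
          ∃ Φ : ExtensionIso e' e, ∀ x (v : TangentSpace I x), Φ.map x (v, (0 : ℝ)) = σ.map x v) ∧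
    -- equivalence of extensions and equality of classes
    (∀ (θ θ' : Closed2 I M) (γ γ' : VForm1 p) (e : Extension p ωV (preqAlgebroid θ))
      (e' : Extension p ωV (preqAlgebroid θ')),
      (∀ x (v : vert p x) (t : ℝ), e.incl x (v, t) = ((v : TangentSpace I x), t + γ.1 x v)) →
      (∀ x (v : vert p x) (t : ℝ), e'.incl x (v, t) = ((v : TangentSpace I x), t + γ'.1 x v)) →
      (Nonempty (ExtensionIso e e') ↔ ∃ β : Form1 I M,
        (∀ X Y : VField I M, ev2 θ.1 X Y = ev2 θ'.1 X Y + d1 β X Y) ∧ γ' = γ + restrict1 p β)) ∧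
    (∀ θ θ' : Closed2 I M,
      (∃ Φ : AlgebroidIso (preqAlgebroid θ) (preqAlgebroid θ'),
        ∀ x, Φ.map x (0, (1 : ℝ)) = (0, (1 : ℝ))) ↔ class2 θ = class2 θ') ∧
    -- the closedness equations are the structure equations
    (∀ (h : EhresmannConnection p) (θ : Form2 I M),
      (θ ∈ Closed2 I M ↔ ClosedEq1 p θ ∧ ClosedEq2 h θ ∧ ClosedEq3 h θ ∧ ClosedEq4 h θ) ∧
      (restrict2 p θ = ωV.1 →
        (ClosedEq2 h θ ↔ ∀ u : VField I' B, IsSymmetry ωV.1 (hlift h u) (formD h θ u)) ∧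
        (ClosedEq3 h θ ↔ CurvEq ωV.1 (formD h θ) (formW h θ)) ∧
        (ClosedEq4 h θ ↔ BianchiEq (formD h θ) (formW h θ)))) ∧
    -- couples subject to the structure equations are the closed forms extending `ωV`, together
    -- with a connection
    (∀ c : Couple ωV.1, CurvEq ωV.1 c.D c.w → BianchiEq c.D c.w →
      ∃! q : EhresmannConnection p × Closed2 I M,
        restrict2 p q.2.1 = ωV.1 ∧ c.IsOf q.1 q.2.1) ∧
    (∀ (h : EhresmannConnection p) (θ : Closed2 I M), restrict2 p θ.1 = ωV.1 →
      ∃! c : Couple ωV.1, c.IsOf h θ.1 ∧ CurvEq ωV.1 c.D c.w ∧ BianchiEq c.D c.w) ∧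
    -- the couple of `h` and `θ` is the one induced by `A_θ` and the horizontal bundle of `h`
    (∀ (h : EhresmannConnection p) (θ : Closed2 I M), restrict2 p θ.1 = ωV.1 →
      ∃ (e : Extension p ωV (preqAlgebroid θ)) (k : HorSplitting p (preqAlgebroid θ))
        (c : Couple ωV.1),
        (∀ x (v : vert p x) (t : ℝ), e.incl x (v, t) = ((v : TangentSpace I x), t)) ∧
        (∀ x (w : TangentSpace I' (p x)), k.map x w = (h.lift x w, (0 : ℝ))) ∧
        c.IsInduced e k ∧ c.IsOf h θ.1) ∧
    -- every extension with a complement of `A_V` is the one of its couple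
    (∀ (F : Type*) [NormedAddCommGroup F] [NormedSpace ℝ F] [FiniteDimensional ℝ F] (A : M → Type*)
      [TopologicalSpace (TotalSpace F A)] [∀ x, TopologicalSpace (A x)] [FiberBundle F A]
      [∀ x, AddCommGroup (A x)] [∀ x, Module ℝ (A x)] [VectorBundle ℝ F A]
      [ContMDiffVectorBundle ∞ F A I] (L : LieAlgebroid I F A) (e : Extension p ωV L),
      Nonempty (HorSplitting p L) ∧
      ∀ k : HorSplitting p L,
        (∃! c : Couple ωV.1, c.IsInduced e k) ∧
        ∀ c : Couple ωV.1, c.IsInduced e k →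
          CurvEq ωV.1 c.D c.w ∧ BianchiEq c.D c.w ∧
          ∃ (h : EhresmannConnection p) (θ : Closed2 I M),
            restrict2 p θ.1 = ωV.1 ∧ c.IsOf h θ.1 ∧
            ∃ e' : Extension p ωV (preqAlgebroid θ),
              (∀ x (v : vert p x) (t : ℝ), e'.incl x (v, t) = ((v : TangentSpace I x), t)) ∧
              ∃ Φ : ExtensionIso e' e,
                ∀ x (w : TangentSpace I' (p x)), Φ.map x (h.lift x w, (0 : ℝ)) = k.map x w) := by
  obtain ⟨hsurj, h₀, -⟩ := hp
  refine ⟨restrictH_eq_iff_exists_extension hsurj, fun θ γ => ⟨fun hγ => ?_, ?_⟩,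
    fun θ e he => exists_vform_of_incl e he, ?_, ?_, exists_iso_iff_class2_eq, ?_,
    fun c hc hb => c.existsUnique_isOf hc hb, ?_, exists_preq_isInduced, ?_⟩
  · exact ⟨preqExtension hsurj θ γ hγ, preqExtension_incl hsurj θ γ hγ⟩
  · rintro ⟨e, he⟩
    exact vev2_eq_of_incl e he
  · intro F _ _ _ A _ _ _ _ _ _ _ L e
    exact ⟨nonempty_anchorSplitting L e.anchor_surjective,
      AnchorSplitting.existsUnique_form hsurj e⟩
  · intro θ θ' γ γ' e e' he he'
    exact nonempty_extensionIso_iff he he'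
  · intro h θ
    refine ⟨mem_closed2_iff h θ, fun hθ => ?_⟩
    rw [← hθ]
    exact ⟨closedEq2_iff h θ, closedEq3_iff h θ, closedEq4_iff h θ⟩
  · intro h θ hθ
    have hof := formCouple_isOf h θ hθ
    exact ⟨_, ⟨hof, hof.curvEq_and_bianchiEq hθ⟩, fun c hc => hc.1.unique hof⟩
  · intro F _ _ _ A _ _ _ _ _ _ _ L e
    obtain ⟨σ⟩ := nonempty_anchorSplitting L e.anchor_surjective
    exact ⟨⟨σ.compLift h₀⟩, HorSplitting.correspondence e⟩
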